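/- Let $A$ be a separable C$^\ast$-algebra and let $\mathfrak r=(\rho_n)_{n\in\mathbb N}$ ($\mathbb N=\{0,1,2,\dots\}$) be a sequence of nondegenerate $\ast$-endomorphisms of $A$ (each $\rho_n$ maps some approximate unit of $A$ to an approximate unit of $A$) such that (i) $\limsup_{n\to\infty}\|\rho_n(a)\|=\|a\|$ for all $a\in A$; (ii) no closed two-sided ideal $I$ of $A$ other than $0$ and $A$ satisfies $\rho_n(I)\subset I$ for all $n\in\mathbb N$. Let $\mathcal E_{\mathfrak r}=\ell^2(\mathbb N)\otimes A$ be the standard right Hilbert $A$-module with the left action $a\cdot(\delta_n\otimes b)=\delta_n\otimes\rho_n(a)b$, and let $\mathcal T_{\mathcal E_{\mathfrak r}}$ be its Toeplitz–Pimsner algebra, that is, the C$^\ast$-algebra of adjointable operators on the full Fock module $\bigoplus_{k\ge 0}\mathcal E_{\mathfrak r}^{\otimes k}$ (with $\mathcal E_{\mathfrak r}^{\otimes 0}=A$) generated by the left action of $A$, through which $A\subset\mathcal T_{\mathcal E_{\mathfrak r}}$, and the creation operators $T_\xi\colon\eta\mapsto\xi\otimes\eta$, $\xi\in\mathcal E_{\mathfrak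 r}$. For a real sequence $\mathfrak x=(x_n)_{n\in\mathbb N}$ let $\gamma_{\mathfrak x}$ be the flow (point-norm continuous action of $\mathbb R$) on $\mathcal T_{\mathcal E_{\mathfrak r}}$ with $\gamma_{\mathfrak x,t}(a)=a$ for $a\in A$ and $\gamma_{\mathfrak x,t}(T_{\delta_n\otimes a})=e^{i x_n t}T_{\delta_n\otimes a}$, and let $K_{\mathfrak x}\subset\mathbb T^{\mathbb N}$ be the closure of $\{(e^{i x_n t})_{n\in\mathbb N}: t\in\mathbb R\}$. A weight on a C$^\ast$-algebra $B$ is an additive, positively homogeneous map $\varphi\colon B_+\to[0,\infty]$ with $\varphi(0)=0$; all weights below are understood to be proper, i.e. nonzero, lower semicontinuous and densely defined ($\{b\in B_+:\varphi(b)<\infty\}$ is dense in $B_+$). Let $\mathcal M_\varphi$ be the linear span of $\{b\in B_+:\varphi(b)<\infty\}$. The weight is tracial if $\varphi(b^*b)=\varphi(bb^*)$ for all $b\in B$. For a flow $\gamma$ on $B$ let $\mathcal A_\gamma$ be the algebra of entire elements, i.e. those $b$ for which $t\mapsto\gamma_t(b)$ extends to an entire function $z\mapsto\gamma_z(b)$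 on $\mathbb C$. For $\beta\in\mathbb R$, a $\gamma$-$\beta$-KMS weight is a weight $\varphi$ with $\varphi\circ\gamma_t=\varphi$ for all $t\in\mathbb R$ and $$\varphi(b^*b)=\varphi\big(\gamma_{-i\beta/2}(b)\,\gamma_{-i\beta/2}(b)^*\big)\quad\text{for all } b\in\bigcap_{z\in\mathbb C}\gamma_z(\mathcal A_\gamma\cap\mathcal M_\varphi).$$ Let $\mathrm{Ped}(A)$ be the Pedersen ideal, the smallest dense two-sided ideal of $A$. Theorem. Assume that $K_{\mathfrak x}$ contains all constant sequences in $\mathbb T^{\mathbb N}$. Then for every $\beta\in\mathbb R$, the map $\varphi\mapsto\varphi|_{A_+}$ is a bijection from the set of $\gamma_{\mathfrak x}$-$\beta$-KMS weights on $\mathcal T_{\mathcal E_{\mathfrak r}}$ onto the set of tracial weights $\tau$ on $A$ satisfying $$\sum_{n\in\mathbb N}e^{-\beta x_n}\,\tau(\rho_n(a))\le\tau(a)\qquad\text{for all } a\in\mathrm{Ped}(A)_+ .$$ (Both sets may be empty.) -/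

import Mathlib

open Filter Topology
open scoped NNReal ENNReal

namespace ToeplitzKMS

/-! ### The standard Hilbert module `ℓ²(ι) ⊗ A` -/

section StandardModule

variable {ι A : Type*} [NonUnitalCStarAlgebra A]

section Aux

open WithCStarModule in
/-- The Cauchy–Schwarz inequality for finite sums in a C*-algebra. -/
theorem norm_sum_star_mul_le (s : Finset ι) (f g : ι → A) :
    ‖∑ i ∈ s, star (f i) * g i‖ ≤
      √‖∑ i ∈ s, star (f i) * f i‖ * √‖∑ i ∈ s, star (g i) * g i‖ := by
  let _ : PartialOrder A := CStarAlgebra.spectralOrder A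
  let _ : StarOrderedRing A := CStarAlgebra.spectralOrderedRing A
  let x : WithCStarModule A (s → A) := (equiv A _).symm fun i => star (f i)
  let y : WithCStarModule A (s → A) := (equiv A _).symm fun i => star (g i)
  have h := CStarModule.norm_inner_le (A := A) (WithCStarModule A (s → A)) (x := y) (y := x)
  rw [pi_norm, pi_norm, pi_inner, mul_comm] at h
  simp only [inner_def, x, y, equiv_symm_pi_apply, star_star] at h
  rw [Finset.sum_coe_sort s (fun i => star (f i) * g i),
    Finset.sum_coe_sort s (fun i => star (f i) * f i),
    Finset.sum_coe_sort s (fun i => star (g i) * g i)] at h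
  exact h

open WithCStarModule in
theorem sqrt_norm_sum_add_le (s : Finset ι) (f g : ι → A) :
    √‖∑ i ∈ s, star (f i + g i) * (f i + g i)‖ ≤
      √‖∑ i ∈ s, star (f i) * f i‖ + √‖∑ i ∈ s, star (g i) * g i‖ := by
  let _ : PartialOrder A := CStarAlgebra.spectralOrder A
  let _ : StarOrderedRing A := CStarAlgebra.spectralOrderedRing A
  let x : WithCStarModule A (s → A) := (equiv A _).symm fun i => star (f i)
  let y : WithCStarModule A (s → A) := (equiv A _).symm fun i => star (g i)
  have h := CStarModule.norm_triangle (A := A) x y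
  rw [pi_norm, pi_norm, pi_norm] at h
  simp only [inner_def, x, y, equiv_symm_pi_apply, star_star, add_apply, ← star_add] at h
  rw [Finset.sum_coe_sort s (fun i => star (f i + g i) * (f i + g i)),
    Finset.sum_coe_sort s (fun i => star (f i) * f i),
    Finset.sum_coe_sort s (fun i => star (g i) * g i)] at h
  exact h

theorem norm_sum_le_tsum {f : ι → A} (hf : Summable fun i => star (f i) * f i) (s : Finset ι) :
    ‖∑ i ∈ s, star (f i) * f i‖ ≤ ‖∑' i, star (f i) * f i‖ := by
  let _ : PartialOrder A := CStarAlgebra.spectralOrder A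
  let _ : StarOrderedRing A := CStarAlgebra.spectralOrderedRing A
  exact CStarAlgebra.norm_le_norm_of_nonneg_of_le
    (Finset.sum_nonneg fun i _ => star_mul_self_nonneg _)
    (hf.sum_le_tsum s fun i _ => star_mul_self_nonneg _)

theorem norm_tsum_le {f : ι → A} {C : ℝ} (hf : Summable fun i => star (f i) * f i)
    (h : ∀ s : Finset ι, ‖∑ i ∈ s, star (f i) * f i‖ ≤ C) :
    ‖∑' i, star (f i) * f i‖ ≤ C :=
  le_of_tendsto' hf.hasSum.norm h

theorem summable_star_mul {f g : ι → A} (hf : Summable fun i => star (f i) * f i)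
    (hg : Summable fun i => star (g i) * g i) : Summable fun i => star (f i) * g i := by
  rw [summable_iff_vanishing_norm] at hf hg ⊢
  intro ε hε
  obtain ⟨s, hs⟩ := hf ε hε
  obtain ⟨t, ht⟩ := hg ε hε
  classical
  refine ⟨s ∪ t, fun u hu => ?_⟩
  rw [Finset.disjoint_union_right] at hu
  have h1 := hs u hu.1
  have h2 := ht u hu.2
  calc _ ≤ _ := norm_sum_star_mul_le u f g
    _ < √ε * √ε := mul_lt_mul'' (Real.sqrt_lt_sqrt (norm_nonneg _) h1)
        (Real.sqrt_lt_sqrt (norm_nonneg _) h2) (Real.sqrt_nonneg _) (Real.sqrt_nonneg _)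
    _ = ε := Real.mul_self_sqrt hε.le

theorem summable_star_mul_of_le {f g : ι → A} {C : ℝ}
    (hg : Summable fun i => star (g i) * g i)
    (h : ∀ s : Finset ι, ‖∑ i ∈ s, star (f i) * f i‖ ≤ C * ‖∑ i ∈ s, star (g i) * g i‖) :
    Summable fun i => star (f i) * f i := by
  rw [summable_iff_vanishing_norm] at hg ⊢
  intro ε hε
  obtain ⟨s, hs⟩ := hg (ε / (|C| + 1)) (by positivity)
  refine ⟨s, fun t ht => ?_⟩
  calc _ ≤ _ := h t
    _ ≤ (|C| + 1) * ‖∑ i ∈ t, star (g i) * g i‖ := by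
        gcongr; linarith [le_abs_self C]
    _ < (|C| + 1) * (ε / (|C| + 1)) := by gcongr; exact hs t ht
    _ = ε := by field_simp

end Aux

variable (ι A) in
/-- The families `f : ι → A` for which `∑ i, (f i)* (f i)` converges in norm. -/
def stdSubmodule : Submodule ℂ (ι → A) where
  carrier := {f | Summable fun i => star (f i) * f i}
  zero_mem' := by simp
  add_mem' {f g} hf hg := by
    simp only [Set.mem_ofPred_eq] at hf hg ⊢
    have := ((hf.add (summable_star_mul hf hg)).add (summable_star_mul hg hf)).add hg
    refine this.congr fun i => ?_
    simp only [Pi.add_apply, star_add]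
    noncomm_ring
  smul_mem' c f hf := by
    simp only [Set.mem_ofPred_eq] at hf ⊢
    refine (hf.const_smul (star c * c)).congr fun i => ?_
    simp only [Pi.smul_apply, star_smul, smul_mul_smul_comm]

variable (ι A) in
/-- The standard right Hilbert `A`-module `ℓ²(ι) ⊗ A`: all families `f : ι → A` for which
`∑ i, (f i)* (f i)` converges in norm. The element `δ_i ⊗ a` is the family which is `a` at `i`
and zero elsewhere, and `A` acts from the right entrywise. -/
def StdModule : Type _ := stdSubmodule ι A

namespace StdModule

noncomputable instance : AddCommGroup (StdModule ι A) :=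
  inferInstanceAs (AddCommGroup (stdSubmodule ι A))

noncomputable instance : Module ℂ (StdModule ι A) :=
  inferInstanceAs (Module ℂ (stdSubmodule ι A))

/-- The family underlying an element of `ℓ²(ι) ⊗ A`. -/
@[coe] def toFun (f : StdModule ι A) : ι → A := Subtype.val f

instance : CoeFun (StdModule ι A) fun _ => ι → A := ⟨toFun⟩

/-- Build an element of `ℓ²(ι) ⊗ A` from a family. -/
def mk (f : ι → A) (hf : Summable fun i => star (f i) * f i) : StdModule ι A := ⟨f, hf⟩

@[simp] theorem mk_apply (f : ι → A) (hf : Summable fun i => star (f i) * f i) (i : ι) :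
    mk f hf i = f i := rfl

theorem summable (f : StdModule ι A) : Summable fun i => star (f i) * f i := f.2

@[ext] theorem ext {f g : StdModule ι A} (h : ∀ i, f i = g i) : f = g := Subtype.ext (funext h)

@[simp] theorem add_apply (f g : StdModule ι A) (i : ι) : (f + g) i = f i + g i := rfl
@[simp] theorem sub_apply (f g : StdModule ι A) (i : ι) : (f - g) i = f i - g i := rfl
@[simp] theorem zero_apply (i : ι) : (0 : StdModule ι A) i = 0 := rfl
@[simp] theorem smul_apply (c : ℂ) (f : StdModule ι A) (i : ι) : (c • f) i = c • f i := rfl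

/-- The `A`-valued inner product `⟨f, g⟩ = ∑ i, (f i)* (g i)`. -/
noncomputable def ip (f g : StdModule ι A) : A := ∑' i, star (f i) * g i

theorem summable_ip (f g : StdModule ι A) : Summable fun i => star (f i) * g i :=
  summable_star_mul f.summable g.summable

/-- The right action of `A` on `ℓ²(ι) ⊗ A`. -/
def rsmul (f : StdModule ι A) (a : A) : StdModule ι A :=
  mk (fun i => f i * a) (by
    refine ((f.summable.mul_left (star a)).mul_right a).congr fun i => ?_
    simp only [star_mul, mul_assoc])

@[simp] theorem rsmul_apply (f : StdModule ι A) (a : A) (i : ι) : f.rsmul a i = f i * a := rfl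

theorem ip_rsmul (f g : StdModule ι A) (a : A) : ip f (g.rsmul a) = ip f g * a := by
  simp only [ip, rsmul_apply, ← mul_assoc]
  exact (summable_ip f g).tsum_mul_right a

theorem star_ip (f g : StdModule ι A) : star (ip f g) = ip g f := by
  rw [ip, tsum_star]
  simp [ip]

theorem ip_add_right (f g h : StdModule ι A) : ip f (g + h) = ip f g + ip f h := by
  simp only [ip, add_apply, mul_add]
  exact (summable_ip f g).tsum_add (summable_ip f h)

theorem ip_smul_right (c : ℂ) (f g : StdModule ι A) : ip f (c • g) = c • ip f g := by
  simp only [ip, smul_apply, mul_smul_comm]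
  exact (summable_ip f g).tsum_const_smul c

theorem ip_add_left (f g h : StdModule ι A) : ip (f + g) h = ip f h + ip g h := by
  rw [← star_ip, ip_add_right, star_add, star_ip, star_ip]

theorem ip_smul_left (c : ℂ) (f g : StdModule ι A) : ip (c • f) g = star c • ip f g := by
  rw [← star_ip, ip_smul_right, star_smul, star_ip]

/-- The Hilbert module norm `‖f‖ = ‖⟨f, f⟩‖ ^ (1/2)`. -/
noncomputable instance : Norm (StdModule ι A) := ⟨fun f => √‖ip f f‖⟩

theorem norm_def (f : StdModule ι A) : ‖f‖ = √‖ip f f‖ := rfl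

theorem sqrt_norm_sum_le_norm (f : StdModule ι A) (s : Finset ι) :
    √‖∑ i ∈ s, star (f i) * f i‖ ≤ ‖f‖ :=
  Real.sqrt_le_sqrt (norm_sum_le_tsum f.summable s)

theorem norm_le_of_forall {f : StdModule ι A} {C : ℝ}
    (h : ∀ s : Finset ι, √‖∑ i ∈ s, star (f i) * f i‖ ≤ C) : ‖f‖ ≤ C := by
  have hC : 0 ≤ C := (Real.sqrt_nonneg _).trans (h ∅)
  rw [norm_def, Real.sqrt_le_left hC]
  exact norm_tsum_le f.summable fun s => (Real.sqrt_le_left hC).1 (h s)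

theorem norm_apply_le (f : StdModule ι A) (i : ι) : ‖f i‖ ≤ ‖f‖ := by
  have := sqrt_norm_sum_le_norm f {i}
  rwa [Finset.sum_singleton, CStarRing.norm_star_mul_self, Real.sqrt_mul_self (norm_nonneg _)]
    at this

theorem normedSpaceCore : NormedSpace.Core ℂ (StdModule ι A) where
  norm_nonneg f := Real.sqrt_nonneg _
  norm_eq_zero_iff f := by
    constructor
    · intro h
      ext i
      exact norm_le_zero_iff.1 ((norm_apply_le f i).trans h.le)
    · rintro rfl
      simp [norm_def, ip]
  norm_smul c f := by
    rw [norm_def, norm_def, ip_smul_left, ip_smul_right, smul_smul, norm_smul, norm_mul, norm_star,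
      Real.sqrt_mul (by positivity), Real.sqrt_mul_self (norm_nonneg _)]
  norm_triangle f g := norm_le_of_forall fun s =>
    (sqrt_norm_sum_add_le s f g).trans
      (add_le_add (sqrt_norm_sum_le_norm f s) (sqrt_norm_sum_le_norm g s))

noncomputable instance : NormedAddCommGroup (StdModule ι A) :=
  NormedAddCommGroup.ofCore normedSpaceCore

noncomputable instance : NormedSpace ℂ (StdModule ι A) := NormedSpace.ofCore normedSpaceCore

theorem norm_sq (f : StdModule ι A) : ‖f‖ ^ 2 = ‖ip f f‖ := Real.sq_sqrt (norm_nonneg _)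

theorem norm_ip_le (f g : StdModule ι A) : ‖ip f g‖ ≤ ‖f‖ * ‖g‖ :=
  le_of_tendsto' (summable_ip f g).hasSum.norm fun s =>
    (norm_sum_star_mul_le s f g).trans
      (mul_le_mul (sqrt_norm_sum_le_norm f s) (sqrt_norm_sum_le_norm g s) (Real.sqrt_nonneg _)
        (norm_nonneg _))

theorem ip_sub_right (f g h : StdModule ι A) : ip f (g - h) = ip f g - ip f h := by
  rw [eq_sub_iff_add_eq, ← ip_add_right, sub_add_cancel]

theorem eq_of_ip_eq {f g : StdModule ι A} (h : ∀ k, ip k f = ip k g) : f = g := by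
  rw [← sub_eq_zero, ← norm_eq_zero, ← sq_eq_zero_iff, norm_sq, ip_sub_right, h, sub_self,
    norm_zero]

instance : CompleteSpace (StdModule ι A) := by
  refine Metric.complete_of_cauchySeq_tendsto fun u hu => ?_
  have hco : ∀ i, CauchySeq fun n => u n i := fun i => by
    rw [Metric.cauchySeq_iff] at hu ⊢
    intro ε hε
    obtain ⟨N, hN⟩ := hu ε hε
    refine ⟨N, fun m hm n hn => lt_of_le_of_lt ?_ (hN m hm n hn)⟩
    rw [dist_eq_norm, dist_eq_norm, ← sub_apply]
    exact norm_apply_le _ i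
  choose g hg using fun i => cauchySeq_tendsto_of_complete (hco i)
  have key : ∀ ε > 0, ∃ N, ∀ n ≥ N, ∀ s : Finset ι,
      √‖∑ i ∈ s, star (u n i - g i) * (u n i - g i)‖ ≤ ε := by
    intro ε hε
    obtain ⟨N, hN⟩ := Metric.cauchySeq_iff.1 hu ε hε
    refine ⟨N, fun n hn s => ?_⟩
    have ht : Tendsto (fun m => √‖∑ i ∈ s, star (u n i - u m i) * (u n i - u m i)‖) atTop
        (𝓝 √‖∑ i ∈ s, star (u n i - g i) * (u n i - g i)‖) := by
      refine (Tendsto.norm (tendsto_finsetSum s fun i _ => ?_)).sqrt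
      exact ((tendsto_const_nhds.sub (hg i)).star).mul (tendsto_const_nhds.sub (hg i))
    refine le_of_tendsto ht (eventually_atTop.2 ⟨N, fun m hm => ?_⟩)
    have h := (hN n hn m hm).le
    rw [dist_eq_norm] at h
    exact (sqrt_norm_sum_le_norm (u n - u m) s).trans h
  have hsum : Summable fun i => star (g i) * g i := by
    rw [summable_iff_vanishing_norm]
    intro ε hε
    have hε' : 0 < √ε := Real.sqrt_pos.2 hε
    obtain ⟨N, hN⟩ := key (√ε / 4) (by positivity)
    obtain ⟨s, hs⟩ := summable_iff_vanishing_norm.1 (u N).summable (ε / 4) (by positivity)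
    refine ⟨s, fun t ht => ?_⟩
    have h1 := sqrt_norm_sum_add_le t (fun i => g i - u N i) (u N)
    have h2 := hN N le_rfl t
    have h3 : √‖∑ i ∈ t, star (u N i) * u N i‖ ≤ √ε / 2 := by
      rw [Real.sqrt_le_left (by positivity), div_pow, Real.sq_sqrt hε.le]
      have := hs t ht
      norm_num
      linarith
    have h4 : ∀ i, star (g i - u N i) * (g i - u N i) = star (u N i - g i) * (u N i - g i) := by
      intro i
      rw [← neg_sub (u N i), star_neg, neg_mul_neg]
    simp only [sub_add_cancel, h4] at h1
    rw [← Real.sqrt_lt_sqrt_iff (norm_nonneg _)]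
    linarith
  refine ⟨mk g hsum, Metric.tendsto_atTop.2 fun ε hε => ?_⟩
  obtain ⟨N, hN⟩ := key (ε / 2) (by positivity)
  refine ⟨N, fun n hn => ?_⟩
  rw [dist_eq_norm]
  refine lt_of_le_of_lt (norm_le_of_forall (C := ε / 2) fun s => ?_) (by linarith)
  exact hN n hn s

/-! ### Adjointable operators -/

variable (ι A) in
/-- The bounded operators on `ℓ²(ι) ⊗ A` which have an adjoint for the `A`-valued inner product. -/
def adjointableSubalgebra : Subalgebra ℂ (StdModule ι A →L[ℂ] StdModule ι A) where
  carrier := {T | ∃ S : StdModule ι A →L[ℂ] StdModule ι A, ∀ f g, ip (T f) g = ip f (S g)}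
  mul_mem' := by
    rintro T T' ⟨S, hS⟩ ⟨S', hS'⟩
    exact ⟨S' * S, fun f g => by simp [hS, hS']⟩
  add_mem' := by
    rintro T T' ⟨S, hS⟩ ⟨S', hS'⟩
    exact ⟨S + S', fun f g => by simp [hS, hS', ip_add_left, ip_add_right]⟩
  algebraMap_mem' c := ⟨star c • 1, fun f g => by
    simp [Algebra.algebraMap_eq_smul_one, ip_smul_left, ip_smul_right]⟩

variable (ι A) in
/-- The algebra `𝔹_A(ℓ²(ι) ⊗ A)` of all bounded adjointable operators on `ℓ²(ι) ⊗ A`, with the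
operator norm. (Adjointable operators are automatically right `A`-linear.) -/
def Adjointable : Type _ := adjointableSubalgebra ι A

noncomputable instance : NormedRing (Adjointable ι A) :=
  inferInstanceAs (NormedRing (adjointableSubalgebra ι A))

noncomputable instance : NormedAlgebra ℂ (Adjointable ι A) :=
  inferInstanceAs (NormedAlgebra ℂ (adjointableSubalgebra ι A))

/-- The bounded operator underlying an adjointable operator. -/
@[coe] def Adjointable.toCLM (T : Adjointable ι A) : StdModule ι A →L[ℂ] StdModule ι A :=
  Subtype.val T

noncomputable instance : CoeFun (Adjointable ι A) fun _ => StdModule ι A → StdModule ι A :=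
  ⟨fun T => T.toCLM⟩

/-- A bounded linear map on `ℓ²(ι) ⊗ A` with a bounded adjoint is an adjointable operator. -/
def mkAdjointable (T S : StdModule ι A →L[ℂ] StdModule ι A)
    (h : ∀ f g, ip (T f) g = ip f (S g)) : Adjointable ι A := ⟨T, S, h⟩

namespace Adjointable

@[ext] theorem ext {T S : Adjointable ι A} (h : ∀ f i, T f i = S f i) : T = S :=
  Subtype.ext (ContinuousLinearMap.ext fun f => StdModule.ext (h f))

@[simp] theorem mkAdjointable_apply (T S : StdModule ι A →L[ℂ] StdModule ι A)
    (h : ∀ f g, ip (T f) g = ip f (S g)) (f : StdModule ι A) : mkAdjointable T S h f = T f := rfl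

@[simp] theorem add_apply (T S : Adjointable ι A) (f : StdModule ι A) :
    (T + S) f = T f + S f := rfl
@[simp] theorem mul_apply (T S : Adjointable ι A) (f : StdModule ι A) :
    (T * S) f = T (S f) := rfl
@[simp] theorem smul_apply (c : ℂ) (T : Adjointable ι A) (f : StdModule ι A) :
    (c • T) f = c • T f := rfl
@[simp] theorem zero_apply (f : StdModule ι A) : (0 : Adjointable ι A) f = 0 := rfl
@[simp] theorem one_apply (f : StdModule ι A) : (1 : Adjointable ι A) f = f := rfl

theorem norm_def (T : Adjointable ι A) : ‖T‖ = ‖T.toCLM‖ := rfl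

theorem le_opNorm (T : Adjointable ι A) (f : StdModule ι A) : ‖T f‖ ≤ ‖T‖ * ‖f‖ :=
  T.toCLM.le_opNorm f

theorem exists_adjoint (T : Adjointable ι A) :
    ∃ S : Adjointable ι A, ∀ f g, ip (T f) g = ip f (S g) := by
  obtain ⟨S, hS⟩ := Subtype.property T
  refine ⟨mkAdjointable S T.toCLM fun f g => ?_, hS⟩
  rw [← star_ip g, ← hS, star_ip]
  rfl

end Adjointable

/-- The adjoint of an adjointable operator. -/
noncomputable def adj (T : Adjointable ι A) : Adjointable ι A := T.exists_adjoint.choose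

theorem ip_adj_right (T : Adjointable ι A) (f g : StdModule ι A) :
    ip f (adj T g) = ip (T f) g := (T.exists_adjoint.choose_spec f g).symm

theorem adj_eq_of {T S : Adjointable ι A} (h : ∀ f g, ip (T f) g = ip f (S g)) :
    adj T = S :=
  Adjointable.ext fun g i => congrArg (fun k : StdModule ι A => k i) <| eq_of_ip_eq fun f => by
    rw [ip_adj_right, h]

noncomputable instance : StarRing (Adjointable ι A) where
  star := adj
  star_involutive T := adj_eq_of fun f g => by
    rw [← star_ip, ip_adj_right, star_ip]
  star_mul T S := adj_eq_of fun f g => by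
    change ip (T (S f)) g = ip f (adj S (adj T g))
    rw [ip_adj_right, ip_adj_right]
  star_add T S := adj_eq_of fun f g => by
    change ip (T f + S f) g = ip f ((adj T) g + (adj S) g)
    rw [ip_add_right, ip_adj_right, ip_adj_right, ip_add_left]

theorem ip_star_right (T : Adjointable ι A) (f g : StdModule ι A) :
    ip f ((star T) g) = ip (T f) g := ip_adj_right T f g

theorem star_eq_of {T S : Adjointable ι A} (h : ∀ f g, ip (T f) g = ip f (S g)) :
    star T = S := adj_eq_of h

instance : StarModule ℂ (Adjointable ι A) where
  star_smul c T := star_eq_of fun f g => by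
    change ip (c • T f) g = ip f (star c • (star T) g)
    rw [ip_smul_right, ip_star_right, ip_smul_left]

theorem norm_sq_le_norm_star_mul (T : Adjointable ι A) : ‖T‖ * ‖T‖ ≤ ‖star T * T‖ := by
  rw [← sq]
  refine (Real.le_sqrt (norm_nonneg _) (norm_nonneg _)).1 ?_
  refine ContinuousLinearMap.opNorm_le_bound T.toCLM (Real.sqrt_nonneg _) fun f => ?_
  refine le_of_sq_le_sq ?_ (by positivity)
  rw [mul_pow, Real.sq_sqrt (norm_nonneg _), norm_sq, ← ip_star_right]
  calc _ ≤ ‖f‖ * ‖(star T * T) f‖ := norm_ip_le _ _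
    _ ≤ ‖f‖ * (‖star T * T‖ * ‖f‖) := by gcongr; exact (star T * T).le_opNorm f
    _ = _ := by ring

theorem norm_le_norm_star (T : Adjointable ι A) : ‖T‖ ≤ ‖star T‖ := by
  by_contra! h
  have h0 : 0 < ‖T‖ := (norm_nonneg _).trans_lt h
  have := (norm_sq_le_norm_star_mul T).trans (norm_mul_le _ _)
  nlinarith

instance : CompleteSpace (Adjointable ι A) := by
  refine Metric.complete_of_cauchySeq_tendsto fun u hu => ?_
  have hs : ∀ T : Adjointable ι A, ‖star T‖ ≤ ‖T‖ := fun T => by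
    simpa using norm_le_norm_star (star T)
  have hu1 : CauchySeq fun n => (u n).toCLM := hu.map uniformContinuous_subtype_val
  have hu2 : CauchySeq fun n => (star (u n)).toCLM := by
    rw [Metric.cauchySeq_iff] at hu ⊢
    intro ε hε
    obtain ⟨N, hN⟩ := hu ε hε
    refine ⟨N, fun m hm n hn => lt_of_le_of_lt ?_ (hN m hm n hn)⟩
    rw [dist_eq_norm, dist_eq_norm]
    have := hs (u m - u n)
    rwa [star_sub] at this
  obtain ⟨T, hT⟩ := cauchySeq_tendsto_of_complete hu1
  obtain ⟨S, hS⟩ := cauchySeq_tendsto_of_complete hu2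
  have hip : ∀ f g, ip (T f) g = ip f (S g) := fun f g => by
    have c1 : Tendsto (fun n => ip ((u n) f) g) atTop (𝓝 (ip (T f) g)) := by
      rw [tendsto_iff_norm_sub_tendsto_zero] at hT ⊢
      refine squeeze_zero (fun _ => norm_nonneg _) (fun n => ?_)
        (by simpa using hT.mul_const (‖f‖ * ‖g‖))
      have : ip ((u n) f) g - ip (T f) g = ip (((u n).toCLM - T) f) g := by
        rw [sub_eq_iff_eq_add, ← ip_add_left, _root_.sub_apply, sub_add_cancel]
      rw [this, ← mul_assoc]
      exact (norm_ip_le _ _).trans (by gcongr; exact ContinuousLinearMap.le_opNorm _ _)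
    have c2 : Tendsto (fun n => ip f ((star (u n)) g)) atTop (𝓝 (ip f (S g))) := by
      rw [tendsto_iff_norm_sub_tendsto_zero] at hS ⊢
      refine squeeze_zero (fun _ => norm_nonneg _) (fun n => ?_)
        (by simpa using hS.mul_const (‖g‖) |>.const_mul ‖f‖)
      rw [← ip_sub_right]
      exact (norm_ip_le _ _).trans
        (by gcongr; exact ContinuousLinearMap.le_opNorm ((star (u n)).toCLM - S) g)
    simp only [ip_star_right] at c2
    exact tendsto_nhds_unique c1 c2
  exact ⟨⟨T, S, hip⟩, tendsto_subtype_rng.2 hT⟩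

noncomputable instance : CStarAlgebra (Adjointable ι A) where
  norm_mul_self_le T := norm_sq_le_norm_star_mul T

/-! ### Basic adjointable operators -/

theorem star_mkAdjointable (T S : StdModule ι A →L[ℂ] StdModule ι A)
    (h : ∀ f g, ip (T f) g = ip f (S g)) (h' : ∀ f g, ip (S f) g = ip f (T g)) :
    star (mkAdjointable T S h) = mkAdjointable S T h' :=
  star_eq_of h

theorem star_mkAdjointable_apply (T S : StdModule ι A →L[ℂ] StdModule ι A)
    (h : ∀ f g, ip (T f) g = ip f (S g)) (f : StdModule ι A) :
    star (mkAdjointable T S h) f = S f := by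
  rw [star_mkAdjointable T S h fun f g => by rw [← star_ip, ← h, star_ip]]
  rfl

theorem norm_diag_le {d : ι → A} {C : ℝ} (hd : ∀ i, ‖d i‖ ≤ C) (f : ι → A) (s : Finset ι) :
    ‖∑ i ∈ s, star (d i * f i) * (d i * f i)‖ ≤ C ^ 2 * ‖∑ i ∈ s, star (f i) * f i‖ := by
  let _ : PartialOrder A := CStarAlgebra.spectralOrder A
  let _ : StarOrderedRing A := CStarAlgebra.spectralOrderedRing A
  have hle : ∀ i, star (d i * f i) * (d i * f i) ≤ C ^ 2 • (star (f i) * f i) := fun i => by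
    have h1 : star (d i * f i) * (d i * f i) = star (f i) * (star (d i) * d i) * f i := by
      simp only [star_mul, mul_assoc]
    rw [h1]
    refine (CStarAlgebra.star_left_conjugate_le_norm_smul (.star_mul_self _)).trans ?_
    refine smul_le_smul_of_nonneg_right ?_ (star_mul_self_nonneg _)
    rw [CStarRing.norm_star_mul_self, sq]
    exact mul_self_le_mul_self (norm_nonneg _) (hd i)
  calc _ ≤ ‖∑ i ∈ s, C ^ 2 • (star (f i) * f i)‖ :=
        CStarAlgebra.norm_le_norm_of_nonneg_of_le
          (Finset.sum_nonneg fun i _ => star_mul_self_nonneg _)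
          (Finset.sum_le_sum fun i _ => hle i)
    _ = _ := by rw [← Finset.smul_sum, norm_smul, Real.norm_of_nonneg (sq_nonneg C)]

/-- The bounded operator `(f i)_i ↦ (d i * f i)_i` for a bounded family `d` in `A`. -/
noncomputable def diagCLM (d : ι → A) (C : ℝ) (hd : ∀ i, ‖d i‖ ≤ C) :
    StdModule ι A →L[ℂ] StdModule ι A :=
  LinearMap.mkContinuous
    { toFun := fun f => mk (fun i => d i * f i)
        (summable_star_mul_of_le f.summable (norm_diag_le hd f))
      map_add' := fun f g => by ext i; simp [mul_add]
      map_smul' := fun c f => by ext i; simp [mul_smul_comm] } |C| (fun f => norm_le_of_forall fun s => by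
    calc _ ≤ √(C ^ 2 * ‖∑ i ∈ s, star (f i) * f i‖) := Real.sqrt_le_sqrt (norm_diag_le hd f s)
      _ = |C| * √‖∑ i ∈ s, star (f i) * f i‖ := by
        rw [Real.sqrt_mul (sq_nonneg C), Real.sqrt_sq_eq_abs]
      _ ≤ |C| * ‖f‖ := by gcongr; exact sqrt_norm_sum_le_norm f s)

@[simp] theorem diagCLM_apply (d : ι → A) (C : ℝ) (hd : ∀ i, ‖d i‖ ≤ C) (f : StdModule ι A)
    (i : ι) : diagCLM d C hd f i = d i * f i := rfl

theorem ip_diagCLM (d : ι → A) (C : ℝ) (hd : ∀ i, ‖d i‖ ≤ C) (hd' : ∀ i, ‖star d i‖ ≤ C)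
    (f g : StdModule ι A) : ip (diagCLM d C hd f) g = ip f (diagCLM (star d) C hd' g) := by
  simp [ip, mul_assoc]

/-- The diagonal operator `(f i)_i ↦ (d i * f i)_i`, as an adjointable operator. -/
noncomputable def diag (d : ι → A) (C : ℝ) (hd : ∀ i, ‖d i‖ ≤ C) : Adjointable ι A :=
  mkAdjointable (diagCLM d C hd) (diagCLM (star d) C fun i => by simpa using hd i)
    (ip_diagCLM d C hd _)

@[simp] theorem diag_apply (d : ι → A) (C : ℝ) (hd : ∀ i, ‖d i‖ ≤ C) (f : StdModule ι A)
    (i : ι) : (diag d C hd) f i = d i * f i := rfl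

theorem star_diag_apply (d : ι → A) (C : ℝ) (hd : ∀ i, ‖d i‖ ≤ C) (f : StdModule ι A)
    (i : ι) : (star (diag d C hd)) f i = star (d i) * f i := by
  rw [diag, star_mkAdjointable_apply, diagCLM_apply, Pi.star_apply]

theorem star_smul_mul_smul {z : ℂ} (hz : ‖z‖ = 1) (a : A) :
    star (z • a) * (z • a) = star a * a := by
  have : star z * z = 1 := by
    rw [Complex.star_def, ← Complex.normSq_eq_conj_mul_self, Complex.normSq_eq_norm_sq, hz]; simp
  rw [star_smul, smul_mul_smul_comm, this, one_smul]

/-- The bounded operator `(f i)_i ↦ (exp (√-1 θ_i) • f i)_i` for a family of real angles. -/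
noncomputable def phaseCLM (θ : ι → ℝ) : StdModule ι A →L[ℂ] StdModule ι A :=
  LinearMap.mkContinuous
    { toFun := fun f => mk (fun i => (Complex.exp (θ i * Complex.I)) • f i)
        (f.summable.congr fun i => (star_smul_mul_smul (Complex.norm_exp_ofReal_mul_I _) _).symm)
      map_add' := fun f g => by ext i; simp
      map_smul' := fun c f => by ext i; simp [smul_comm c] } 1 (fun f => by
    rw [one_mul, norm_def, norm_def]
    refine (congrArg (fun a : A => √‖a‖) (tsum_congr fun i => ?_)).le
    exact star_smul_mul_smul (Complex.norm_exp_ofReal_mul_I _) _)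

@[simp] theorem phaseCLM_apply (θ : ι → ℝ) (f : StdModule ι A) (i : ι) :
    phaseCLM θ f i = Complex.exp (θ i * Complex.I) • f i := rfl

theorem ip_phaseCLM (θ : ι → ℝ) (f g : StdModule ι A) :
    ip (phaseCLM θ f) g = ip f (phaseCLM (-θ) g) := by
  simp only [ip, phaseCLM_apply, star_smul, smul_mul_assoc, mul_smul_comm, Pi.neg_apply]
  refine tsum_congr fun i => ?_
  rw [Complex.star_def, ← Complex.exp_conj]
  simp

/-- The operator `(f i)_i ↦ (exp (√-1 θ_i) • f i)_i`, as an adjointable operator. -/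
noncomputable def phaseOp (θ : ι → ℝ) : Adjointable ι A :=
  mkAdjointable (phaseCLM θ) (phaseCLM (-θ)) (ip_phaseCLM θ)

@[simp] theorem phaseOp_apply (θ : ι → ℝ) (f : StdModule ι A) (i : ι) :
    (phaseOp θ) f i = Complex.exp (θ i * Complex.I) • f i := rfl

theorem star_phaseOp (θ : ι → ℝ) : star (phaseOp θ : Adjointable ι A) = phaseOp (-θ) :=
  star_eq_of (ip_phaseCLM θ)

theorem phaseOp_mul (θ η : ι → ℝ) :
    (phaseOp θ * phaseOp η : Adjointable ι A) = phaseOp (θ + η) := by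
  refine Adjointable.ext fun f i => ?_
  change Complex.exp (θ i * Complex.I) • Complex.exp (η i * Complex.I) • f i =
    Complex.exp ((θ i + η i : ℝ) * Complex.I) • f i
  rw [smul_smul, ← Complex.exp_add, Complex.ofReal_add, add_mul]

theorem phaseOp_zero : (phaseOp 0 : Adjointable ι A) = 1 := by
  refine Adjointable.ext fun f i => ?_
  change Complex.exp ((0 : ℝ) * Complex.I) • f i = f i
  simp

/-- The diagonal unitary `u (δ_i ⊗ a) = exp (√-1 θ_i) δ_i ⊗ a` on `ℓ²(ι) ⊗ A`. -/
noncomputable def phase (θ : ι → ℝ) : unitary (Adjointable ι A) :=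
  ⟨phaseOp θ, by
    rw [Unitary.mem_iff, star_phaseOp, phaseOp_mul, phaseOp_mul, neg_add_cancel, add_neg_cancel,
      phaseOp_zero]
    exact ⟨rfl, rfl⟩⟩

end StdModule
end StandardModule

/-! ### The Fock module and the Toeplitz–Pimsner algebra -/

section Toeplitz

open StdModule

variable {A : Type*} [NonUnitalCStarAlgebra A]

/-- `ρ_𝔫 = ρ_{i_n} ∘ ⋯ ∘ ρ_{i_1}` for a word `𝔫 = (i_1, …, i_n)`, with `ρ_∅ = id`. -/
def wordHom (ρ : ℕ → A →⋆ₙₐ[ℂ] A) : List ℕ → (A →⋆ₙₐ[ℂ] A)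
  | [] => NonUnitalStarAlgHom.id ℂ A
  | i :: l => (wordHom ρ l).comp (ρ i)

variable (A) in
/-- The full Fock module `⨁_n E^{⊗n}` of the C*-correspondence `E = ℓ²(ℕ) ⊗ A` with left action
`a (δ_i ⊗ b) = δ_i ⊗ ρ_i(a) b`. Here `E^{⊗n}` is identified with `ℓ²(ℕⁿ) ⊗ A` by
`(δ_{i_1} ⊗ a_1) ⊗ ⋯ ⊗ (δ_{i_n} ⊗ a_n) ↦ δ_𝔫 ⊗ ρ_{(i_2,…,i_n)}(a_1) ⋯ ρ_{(i_n)}(a_{n-1}) a_n`,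
so that the Fock module is `ℓ²` of all finite words, tensored with `A`. -/
abbrev Fock : Type _ := StdModule (List ℕ) A

/-- The left action of `A` on the Fock module: `a (δ_𝔫 ⊗ b) = δ_𝔫 ⊗ ρ_𝔫(a) b`. -/
noncomputable def leftAct (ρ : ℕ → A →⋆ₙₐ[ℂ] A) : A →⋆ₙₐ[ℂ] Adjointable (List ℕ) A where
  toFun a := diag (fun l => wordHom ρ l a) ‖a‖ fun l => NonUnitalStarAlgHom.norm_apply_le _ a
  map_smul' c a := Adjointable.ext (fun f l => by
    change wordHom ρ l (c • a) * f l = c • (wordHom ρ l a * f l)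
    rw [map_smul, smul_mul_assoc])
  map_zero' := Adjointable.ext (fun f l => by
    change wordHom ρ l 0 * f l = 0
    rw [map_zero, zero_mul])
  map_add' a b := Adjointable.ext (fun f l => by
    change wordHom ρ l (a + b) * f l = wordHom ρ l a * f l + wordHom ρ l b * f l
    rw [map_add, add_mul])
  map_mul' a b := Adjointable.ext (fun f l => by
    change wordHom ρ l (a * b) * f l = wordHom ρ l a * (wordHom ρ l b * f l)
    rw [map_mul, mul_assoc])
  map_star' a := Adjointable.ext (fun f l => by
    change wordHom ρ l (star a) * f l = (star (diag (fun l => wordHom ρ l a) ‖a‖ _)) f l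
    rw [star_diag_apply, map_star])

theorem leftAct_apply (ρ : ℕ → A →⋆ₙₐ[ℂ] A) (a : A) (f : Fock A) (l : List ℕ) :
    (leftAct ρ a) f l = wordHom ρ l a * f l := rfl

/-- The family `δ_i ⊗ f`: it is `f l` at the word `i :: l`, and zero at words which do not start
with `i`. -/
def consFun (i : ℕ) (f : List ℕ → A) : List ℕ → A
  | [] => 0
  | j :: l => if j = i then f l else 0

theorem consFun_eq_zero (i : ℕ) (f : List ℕ → A) {l : List ℕ}
    (hl : l ∉ Set.range (List.cons i)) : consFun i f l = 0 := by
  match l with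
  | [] => rfl
  | j :: l =>
    refine if_neg ?_
    rintro rfl
    exact hl ⟨l, rfl⟩

theorem consFun_cons (i : ℕ) (f : List ℕ → A) (l : List ℕ) : consFun i f (i :: l) = f l :=
  if_pos rfl

theorem consFun_summable (i : ℕ) (f : Fock A) :
    Summable fun l => star (consFun i f l) * consFun i f l := by
  rw [← (List.cons_injective (a := i)).summable_iff
    fun l hl => by rw [consFun_eq_zero i f hl]; simp]
  exact f.summable.congr fun l => by simp [consFun_cons]

/-- The isometry `T_i : ξ ↦ δ_i ⊗ ξ` of the Fock module, as a bounded operator. -/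
noncomputable def consCLM (i : ℕ) : Fock A →L[ℂ] Fock A :=
  LinearMap.mkContinuous
    { toFun := fun f => mk (consFun i f) (consFun_summable i f)
      map_add' := fun f g => by
        ext l
        match l with
        | [] => simp [consFun]
        | j :: l => by_cases h : j = i <;> simp [consFun, h]
      map_smul' := fun c f => by
        ext l
        match l with
        | [] => simp [consFun]
        | j :: l => by_cases h : j = i <;> simp [consFun, h] } 1 (fun f => by
    rw [one_mul, norm_def, norm_def]
    refine (congrArg (fun a : A => √‖a‖) ?_).le
    change ∑' l, star (consFun i f l) * consFun i f l = ∑' l, star (f l) * f l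
    rw [← (List.cons_injective (a := i)).tsum_eq]
    · simp [consFun_cons]
    · intro l hl
      by_contra h
      exact hl (by simp [consFun_eq_zero i f h]))

/-- The adjoint of `T_i`: `(T_i* f)(l) = f (i :: l)`. -/
noncomputable def unconsCLM (i : ℕ) : Fock A →L[ℂ] Fock A :=
  LinearMap.mkContinuous
    { toFun := fun f => mk (fun l => f (i :: l))
        (f.summable.comp_injective (List.cons_injective (a := i)))
      map_add' := fun f g => rfl
      map_smul' := fun c f => rfl } 1 (fun f => by
    rw [one_mul]
    refine norm_le_of_forall fun s => ?_
    have := sqrt_norm_sum_le_norm f (s.map ⟨List.cons i, List.cons_injective⟩)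
    rwa [Finset.sum_map] at this)

theorem ip_consCLM (i : ℕ) (f g : Fock A) : ip (consCLM i f) g = ip f (unconsCLM i g) := by
  change ∑' l, star (consFun i f l) * g l = ∑' l, star (f l) * g (i :: l)
  rw [← (List.cons_injective (a := i)).tsum_eq]
  · simp [consFun_cons]
  · intro l hl
    by_contra h
    exact hl (by simp [consFun_eq_zero i f h])

/-- The isometry `T_i : ξ ↦ δ_i ⊗ ξ` of the Fock module. -/
noncomputable def consOp (i : ℕ) : Adjointable (List ℕ) A :=
  mkAdjointable (consCLM i) (unconsCLM i) (ip_consCLM i)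

theorem consOp_apply (i : ℕ) (f : Fock A) (l : List ℕ) :
    (consOp i) f l = consFun i f l := rfl

theorem star_consOp_apply (i : ℕ) (f : Fock A) (l : List ℕ) :
    (star (consOp i : Adjointable (List ℕ) A)) f l = f (i :: l) := by
  rw [consOp, star_mkAdjointable_apply]; rfl

theorem star_consOp_mul_consOp (i j : ℕ) :
    star (consOp i) * consOp j = (if i = j then 1 else 0 : Adjointable (List ℕ) A) := by
  refine Adjointable.ext fun f l => ?_
  change (star (consOp i : Adjointable (List ℕ) A)) ((consOp j) f) l = _
  rw [star_consOp_apply, consOp_apply]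
  by_cases h : i = j
  · subst h
    rw [if_pos rfl]
    exact consFun_cons i f l
  · rw [if_neg h]
    exact if_neg h

theorem norm_sum_consOp_le (ρ : ℕ → A →⋆ₙₐ[ℂ] A) (ξ : ℕ → A) (s : Finset ℕ) :
    ‖∑ i ∈ s, consOp i * leftAct ρ (ξ i)‖ * ‖∑ i ∈ s, consOp i * leftAct ρ (ξ i)‖ ≤
      ‖∑ i ∈ s, star (ξ i) * ξ i‖ := by
  rw [← CStarRing.norm_star_mul_self]
  have : star (∑ i ∈ s, consOp i * leftAct ρ (ξ i)) * (∑ i ∈ s, consOp i * leftAct ρ (ξ i)) =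
      leftAct ρ (∑ i ∈ s, star (ξ i) * ξ i) := by
    rw [star_sum, Finset.sum_mul_sum, map_sum]
    refine Finset.sum_congr rfl fun i hi => ?_
    rw [Finset.sum_eq_single_of_mem i hi]
    · rw [star_mul, mul_assoc, ← mul_assoc (star (consOp i)), star_consOp_mul_consOp, if_pos rfl,
        one_mul, map_mul, map_star]
    · intro j _ hj
      rw [star_mul, mul_assoc, ← mul_assoc (star (consOp i)), star_consOp_mul_consOp,
        if_neg hj.symm, zero_mul, mul_zero]
  rw [this]
  exact NonUnitalStarAlgHom.norm_apply_le _ _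

theorem summable_creation (ρ : ℕ → A →⋆ₙₐ[ℂ] A) (ξ : StdModule ℕ A) :
    Summable fun i => consOp i * leftAct ρ (ξ i) := by
  rw [summable_iff_vanishing_norm]
  intro ε hε
  obtain ⟨s, hs⟩ := summable_iff_vanishing_norm.1 ξ.summable (ε * ε) (by positivity)
  refine ⟨s, fun t ht => ?_⟩
  exact lt_of_mul_self_lt_mul_self₀ hε.le ((norm_sum_consOp_le ρ ξ t).trans_lt (hs t ht))

/-- The creation operator `T_ξ : η ↦ ξ ⊗ η` on the Fock module, for
`ξ = ∑ i, δ_i ⊗ ξ_i ∈ ℓ²(ℕ) ⊗ A`. In coordinates it is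
`(T_ξ f)(i, l) = ρ_l(ξ_i) f(l)`, see `creation_apply_cons`. -/
noncomputable def creation (ρ : ℕ → A →⋆ₙₐ[ℂ] A) (ξ : StdModule ℕ A) :
    Adjointable (List ℕ) A := ∑' i, consOp i * leftAct ρ (ξ i)

theorem hasSum_creation_apply (ρ : ℕ → A →⋆ₙₐ[ℂ] A) (ξ : StdModule ℕ A) (f : Fock A)
    (l : List ℕ) :
    HasSum (fun i => consFun i (fun l' => wordHom ρ l' (ξ i) * f l') l)
      ((creation ρ ξ) f l) := by
  let ev : Adjointable (List ℕ) A →+ A :=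
    { toFun := fun T => T f l
      map_zero' := rfl
      map_add' := fun T S => rfl }
  have hev : Continuous ev := AddMonoidHomClass.continuous_of_bound ev ‖f‖ fun T => by
    refine (StdModule.norm_apply_le (T f) l).trans ?_
    rw [mul_comm]
    exact T.le_opNorm f
  exact (summable_creation ρ ξ).hasSum.map ev hev

theorem creation_apply_nil (ρ : ℕ → A →⋆ₙₐ[ℂ] A) (ξ : StdModule ℕ A) (f : Fock A) :
    (creation ρ ξ) f [] = 0 :=
  (hasSum_creation_apply ρ ξ f []).unique (by simp [consFun])

theorem creation_apply_cons (ρ : ℕ → A →⋆ₙₐ[ℂ] A) (ξ : StdModule ℕ A) (f : Fock A)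
    (i : ℕ) (l : List ℕ) :
    (creation ρ ξ) f (i :: l) = wordHom ρ l (ξ i) * f l := by
  refine (hasSum_creation_apply ρ ξ f (i :: l)).unique ?_
  have := hasSum_single (f := fun j => consFun j (fun l' => wordHom ρ l' (ξ j) * f l') (i :: l)) i
    fun j hj => if_neg hj.symm
  simpa only [consFun_cons] using this

/-- The Toeplitz–Pimsner algebra of `ℓ²(ℕ) ⊗ A` in its realization on the Fock module:
the C*-algebra generated by (the left action of) `A` and all creation operators `T_ξ`. -/
noncomputable def toeplitz (ρ : ℕ → A →⋆ₙₐ[ℂ] A) :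
    NonUnitalStarSubalgebra ℂ (Adjointable (List ℕ) A) :=
  (NonUnitalStarAlgebra.adjoin ℂ
    (Set.range (leftAct ρ) ∪ Set.range (creation ρ))).topologicalClosure

instance isClosed_toeplitz (ρ : ℕ → A →⋆ₙₐ[ℂ] A) :
    IsClosed (toeplitz ρ : Set (Adjointable (List ℕ) A)) :=
  NonUnitalStarSubalgebra.isClosed_topologicalClosure _

/-- The order on the C*-algebra `toeplitz ρ` given by its positive cone. -/
noncomputable instance (ρ : ℕ → A →⋆ₙₐ[ℂ] A) : PartialOrder (toeplitz ρ) :=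
  CStarAlgebra.spectralOrder (toeplitz ρ)

instance (ρ : ℕ → A →⋆ₙₐ[ℂ] A) : StarOrderedRing (toeplitz ρ) :=
  CStarAlgebra.spectralOrderedRing (toeplitz ρ)

theorem leftAct_mem (ρ : ℕ → A →⋆ₙₐ[ℂ] A) (a : A) : leftAct ρ a ∈ toeplitz ρ :=
  NonUnitalStarSubalgebra.le_topologicalClosure _
    (NonUnitalStarAlgebra.subset_adjoin ℂ _ (Or.inl ⟨a, rfl⟩))

theorem creation_mem (ρ : ℕ → A →⋆ₙₐ[ℂ] A) (ξ : StdModule ℕ A) : creation ρ ξ ∈ toeplitz ρ :=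
  NonUnitalStarSubalgebra.le_topologicalClosure _
    (NonUnitalStarAlgebra.subset_adjoin ℂ _ (Or.inr ⟨ξ, rfl⟩))

/-- The canonical inclusion of `A` into the Toeplitz–Pimsner algebra. -/
noncomputable def incl (ρ : ℕ → A →⋆ₙₐ[ℂ] A) : A →⋆ₙₐ[ℂ] toeplitz ρ :=
  NonUnitalStarAlgHom.codRestrict (leftAct ρ) (toeplitz ρ) (leftAct_mem ρ)

theorem incl_injective (ρ : ℕ → A →⋆ₙₐ[ℂ] A) : Function.Injective (incl ρ) := by
  refine (injective_iff_map_eq_zero (incl ρ)).2 fun a ha => ?_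
  have h1 : leftAct ρ a = 0 := congrArg Subtype.val ha
  let f : Fock A := mk (fun l => if l = [] then star a else 0)
    (summable_of_ne_finset_zero (s := {[]}) fun l hl => by
      rw [if_neg (by simpa using hl), mul_zero])
  have h2 : (leftAct ρ a) f [] = 0 := by rw [h1]; rfl
  rw [leftAct_apply] at h2
  simpa [f, wordHom, CStarRing.mul_star_self_eq_zero_iff] using h2

end Toeplitz

/-! ### Flows -/

section Flow

/-- A flow on a C*-algebra `B`: a point-norm continuous action of `ℝ` by `*`-automorphisms.
(The maps are invertible, as `toFun (-t)` is the inverse of `toFun t`.) -/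
structure CStarFlow (B : Type*) [NonUnitalCStarAlgebra B] where
  /-- the `*`-homomorphism at time `t` -/
  toFun : ℝ → B →⋆ₙₐ[ℂ] B
  map_zero : ∀ b, toFun 0 b = b
  map_add : ∀ s t b, toFun (s + t) b = toFun s (toFun t b)
  continuous_apply : ∀ b, Continuous fun t => toFun t b

open StdModule

variable {A : Type*} [NonUnitalCStarAlgebra A]

/-- Conjugation by the unitary `δ_𝔫 ⊗ b ↦ exp (√-1 x_𝔫 t) δ_𝔫 ⊗ b` of the Fock module, where
`x_𝔫 = x_{i_1} + ⋯ + x_{i_n}`. This unitary is the direct sum of the tensor powers of the unitary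
`u_t : δ_i ⊗ b ↦ exp (√-1 x_i t) δ_i ⊗ b` of `ℓ²(ℕ) ⊗ A`. -/
noncomputable def fockConj (x : ℕ → ℝ) (t : ℝ) :
    Adjointable (List ℕ) A ≃⋆ₐ[ℂ] Adjointable (List ℕ) A :=
  Unitary.conjStarAlgAut ℂ _ (phase fun l => (l.map x).sum * t)

theorem fockConj_apply (x : ℕ → ℝ) (t : ℝ) (T : Adjointable (List ℕ) A) (f : Fock A)
    (l : List ℕ) : fockConj x t T f l = Complex.exp (((l.map x).sum * t : ℝ) * Complex.I) •
      T (phaseOp (fun l => -((l.map x).sum * t)) f) l := by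
  rw [fockConj, Unitary.conjStarAlgAut_apply]
  have : star ((phase fun l : List ℕ => (l.map x).sum * t :
      unitary (Adjointable (List ℕ) A)) : Adjointable (List ℕ) A) =
      phaseOp fun l => -((l.map x).sum * t) := star_phaseOp _
  rw [this]
  rfl

theorem fockConj_leftAct (ρ : ℕ → A →⋆ₙₐ[ℂ] A) (x : ℕ → ℝ) (t : ℝ) (a : A) :
    fockConj x t (leftAct ρ a) = leftAct ρ a := by
  refine Adjointable.ext fun f l => ?_
  rw [fockConj_apply, leftAct_apply, leftAct_apply, phaseOp_apply, mul_smul_comm, smul_smul,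
    ← Complex.exp_add]
  simp

/-- The quasi-free action is given on creation operators by `T_ξ ↦ T_{u_t ξ}`. -/
theorem fockConj_creation (ρ : ℕ → A →⋆ₙₐ[ℂ] A) (x : ℕ → ℝ) (t : ℝ) (ξ : StdModule ℕ A) :
    fockConj x t (creation ρ ξ) = creation ρ (phaseOp (fun i => x i * t) ξ) := by
  refine Adjointable.ext fun f l => ?_
  rw [fockConj_apply]
  match l with
  | [] => rw [creation_apply_nil, creation_apply_nil, smul_zero]
  | i :: l =>
    rw [creation_apply_cons, creation_apply_cons, phaseOp_apply, phaseOp_apply, map_smul,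
      smul_mul_assoc, mul_smul_comm, smul_smul, ← Complex.exp_add]
    congr 2
    push_cast [List.map_cons, List.sum_cons]
    ring

theorem fockConj_zero (x : ℕ → ℝ) (T : Adjointable (List ℕ) A) : fockConj x 0 T = T := by
  have : (phase (fun l : List ℕ => (l.map x).sum * 0) : unitary (Adjointable (List ℕ) A)) = 1 :=
    Subtype.ext (by
      have := phaseOp_zero (ι := List ℕ) (A := A)
      simp only [mul_zero]
      exact this)
  rw [fockConj, this, map_one]
  rfl

theorem fockConj_add (x : ℕ → ℝ) (s t : ℝ) (T : Adjointable (List ℕ) A) :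
    fockConj x (s + t) T = fockConj x s (fockConj x t T) := by
  have : (phase (fun l : List ℕ => (l.map x).sum * (s + t)) : unitary (Adjointable (List ℕ) A)) =
      phase (fun l : List ℕ => (l.map x).sum * s) * phase (fun l : List ℕ => (l.map x).sum * t) :=
    Subtype.ext (by
      simp only [mul_add]
      exact (phaseOp_mul _ _).symm)
  rw [fockConj, this, map_mul]
  rfl

theorem norm_fockConj_le (x : ℕ → ℝ) (t : ℝ) (T : Adjointable (List ℕ) A) :
    ‖fockConj x t T‖ ≤ ‖T‖ := NonUnitalStarAlgHom.norm_apply_le _ T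

theorem isClosed_continuous_fockConj (x : ℕ → ℝ) :
    IsClosed {T : Adjointable (List ℕ) A | Continuous fun t => fockConj x t T} := by
  refine isClosed_of_closure_subset fun T hT => ?_
  refine continuous_of_uniform_approx_of_continuous fun u hu => ?_
  obtain ⟨ε, hε, hεu⟩ := Metric.mem_uniformity_dist.1 hu
  obtain ⟨S, hS, hST⟩ := Metric.mem_closure_iff.1 hT ε hε
  refine ⟨fun t => fockConj x t S, hS, fun t => hεu ?_⟩
  rw [dist_eq_norm, ← map_sub]
  rw [dist_eq_norm] at hST
  exact (norm_fockConj_le x t _).trans_lt hST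

/-- The operators on which the quasi-free action is norm continuous. -/
noncomputable def continuousPart (x : ℕ → ℝ) :
    NonUnitalStarSubalgebra ℂ (Adjointable (List ℕ) A) where
  carrier := {T | Continuous fun t => fockConj x t T}
  zero_mem' := by simpa using continuous_const
  add_mem' {S T} hS hT := by
    simp only [Set.mem_ofPred_eq, _root_.map_add] at *
    exact hS.add hT
  mul_mem' {S T} hS hT := by
    simp only [Set.mem_ofPred_eq, map_mul] at *
    exact hS.mul hT
  smul_mem' c T hT := by
    simp only [Set.mem_ofPred_eq, map_smul] at *
    exact hT.const_smul c
  star_mem' {T} hT := by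
    simp only [Set.mem_ofPred_eq, map_star] at *
    exact hT.star

theorem fockConj_consOp_mul (ρ : ℕ → A →⋆ₙₐ[ℂ] A) (x : ℕ → ℝ) (t : ℝ) (i : ℕ) (a : A) :
    fockConj x t (consOp i * leftAct ρ a) =
      Complex.exp ((x i * t : ℝ) * Complex.I) • (consOp i * leftAct ρ a) := by
  refine Adjointable.ext fun f l => ?_
  rw [fockConj_apply]
  change Complex.exp _ • consFun i (fun l' => wordHom ρ l' a * (Complex.exp _ • f l')) l =
    Complex.exp _ • consFun i (fun l' => wordHom ρ l' a * f l') l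
  match l with
  | [] => simp [consFun]
  | j :: l =>
    by_cases h : j = i
    · subst h
      rw [consFun_cons, consFun_cons, mul_smul_comm, smul_smul, ← Complex.exp_add]
      congr 2
      push_cast [List.map_cons, List.sum_cons]
      ring
    · simp [consFun, h]

theorem toeplitz_le_continuousPart (ρ : ℕ → A →⋆ₙₐ[ℂ] A) (x : ℕ → ℝ) :
    toeplitz ρ ≤ continuousPart x := by
  refine NonUnitalStarSubalgebra.topologicalClosure_minimal _ ?_ (isClosed_continuous_fockConj x)
  refine NonUnitalStarAlgebra.adjoin_le (Set.union_subset ?_ ?_)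
  · rintro _ ⟨a, rfl⟩
    change Continuous fun t => fockConj x t (leftAct ρ a)
    simp only [fockConj_leftAct]
    exact continuous_const
  · rintro _ ⟨ξ, rfl⟩
    refine (isClosed_continuous_fockConj x).mem_of_tendsto (summable_creation ρ ξ).hasSum
      (Eventually.of_forall fun s => ?_)
    refine sum_mem (S := continuousPart x) fun i _ => ?_
    change Continuous fun t => fockConj x t (consOp i * leftAct ρ (ξ i))
    simp only [fockConj_consOp_mul]
    fun_prop

/-- The operators which are mapped into the Toeplitz–Pimsner algebra at time `t`. -/
noncomputable def fockConjPreimage (ρ : ℕ → A →⋆ₙₐ[ℂ] A) (x : ℕ → ℝ) (t : ℝ) :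
    NonUnitalStarSubalgebra ℂ (Adjointable (List ℕ) A) where
  carrier := {T | fockConj x t T ∈ toeplitz ρ}
  zero_mem' := by
    rw [Set.mem_ofPred_eq, _root_.map_zero]
    exact zero_mem _
  add_mem' {a b} ha hb := by
    rw [Set.mem_ofPred_eq, _root_.map_add]
    exact add_mem ha hb
  mul_mem' {a b} ha hb := by
    rw [Set.mem_ofPred_eq, map_mul]
    exact mul_mem ha hb
  smul_mem' c a ha := by
    rw [Set.mem_ofPred_eq, map_smul]
    exact SMulMemClass.smul_mem c ha
  star_mem' {a} ha := by
    rw [Set.mem_ofPred_eq, map_star]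
    exact star_mem ha

theorem isClosed_fockConjPreimage (ρ : ℕ → A →⋆ₙₐ[ℂ] A) (x : ℕ → ℝ) (t : ℝ) :
    IsClosed (fockConjPreimage ρ x t : Set (Adjointable (List ℕ) A)) := by
  have hc : Continuous fun T : Adjointable (List ℕ) A => fockConj x t T :=
    AddMonoidHomClass.continuous_of_bound (fockConj x t) 1 fun T => by
      simpa using norm_fockConj_le x t T
  exact (isClosed_toeplitz ρ).preimage hc

theorem mem_fockConjPreimage {ρ : ℕ → A →⋆ₙₐ[ℂ] A} {x : ℕ → ℝ} {t : ℝ}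
    {T S : Adjointable (List ℕ) A} (h : fockConj x t T = S) (hS : S ∈ toeplitz ρ) :
    T ∈ fockConjPreimage ρ x t := by
  subst h
  exact hS

theorem toeplitz_le_fockConjPreimage (ρ : ℕ → A →⋆ₙₐ[ℂ] A) (x : ℕ → ℝ) (t : ℝ) :
    toeplitz ρ ≤ fockConjPreimage ρ x t := by
  refine NonUnitalStarSubalgebra.topologicalClosure_minimal _ ?_ (isClosed_fockConjPreimage ρ x t)
  refine NonUnitalStarAlgebra.adjoin_le (Set.union_subset ?_ ?_)
  · rintro _ ⟨a, rfl⟩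
    exact mem_fockConjPreimage (fockConj_leftAct ρ x t a) (leftAct_mem ρ a)
  · rintro _ ⟨ξ, rfl⟩
    exact mem_fockConjPreimage (fockConj_creation ρ x t ξ) (creation_mem ρ _)

theorem fockConj_mem (ρ : ℕ → A →⋆ₙₐ[ℂ] A) (x : ℕ → ℝ) (t : ℝ) {T : Adjointable (List ℕ) A}
    (hT : T ∈ toeplitz ρ) : fockConj x t T ∈ toeplitz ρ :=
  toeplitz_le_fockConjPreimage ρ x t hT

/-- The quasi-free flow `γ_x` on the Toeplitz–Pimsner algebra induced by the unitary
representation `u_t (δ_i ⊗ a) = exp (√-1 x_i t) δ_i ⊗ a` of `ℝ` on `ℓ²(ℕ) ⊗ A`. It fixes `A` and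
maps `T_ξ` to `T_{u_t ξ}`. -/
noncomputable def quasiFreeFlow (ρ : ℕ → A →⋆ₙₐ[ℂ] A) (x : ℕ → ℝ) : CStarFlow (toeplitz ρ) where
  toFun t := NonUnitalStarAlgHom.codRestrict
    (((fockConj x t : Adjointable (List ℕ) A ≃⋆ₐ[ℂ] Adjointable (List ℕ) A) :
      Adjointable (List ℕ) A →⋆ₙₐ[ℂ] Adjointable (List ℕ) A).comp
      (NonUnitalStarSubalgebraClass.subtype (toeplitz ρ)))
    (toeplitz ρ) fun T => fockConj_mem ρ x t T.2
  map_zero T := Subtype.ext (fockConj_zero x T.1)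
  map_add s t T := Subtype.ext (fockConj_add x s t T.1)
  continuous_apply T := (toeplitz_le_continuousPart ρ x T.2 :
    Continuous fun t => fockConj x t T.1).subtype_mk _

theorem quasiFreeFlow_incl (ρ : ℕ → A →⋆ₙₐ[ℂ] A) (x : ℕ → ℝ) (t : ℝ) (a : A) :
    (quasiFreeFlow ρ x).toFun t (incl ρ a) = incl ρ a :=
  Subtype.ext (fockConj_leftAct ρ x t a)

theorem quasiFreeFlow_creation (ρ : ℕ → A →⋆ₙₐ[ℂ] A) (x : ℕ → ℝ) (t : ℝ) (ξ : StdModule ℕ A) :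
    (quasiFreeFlow ρ x).toFun t ⟨creation ρ ξ, creation_mem ρ ξ⟩ =
      ⟨creation ρ (phaseOp (fun i => x i * t) ξ), creation_mem ρ _⟩ :=
  Subtype.ext (fockConj_creation ρ x t ξ)

end Flow

/-! ### Weights and the KMS condition -/

section Weights

variable {B : Type*} [NonUnitalCStarAlgebra B] [PartialOrder B] [StarOrderedRing B]

variable (B) in
/-- A weight on a C*-algebra: an additive, positively homogeneous map from the positive cone to
`[0, ∞]` (with `0 * ∞ = 0`). -/
@[ext]
structure CStarWeight where
  /-- the underlying map on the positive cone -/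
  toFun : {b : B // 0 ≤ b} → ℝ≥0∞
  map_zero : toFun ⟨0, le_rfl⟩ = 0
  map_add : ∀ a b : {b : B // 0 ≤ b}, toFun ⟨a.1 + b.1, add_nonneg a.2 b.2⟩ = toFun a + toFun b
  map_smul : ∀ (r : ℝ≥0) (a : {b : B // 0 ≤ b}),
    toFun ⟨(r : ℝ) • a.1, smul_nonneg r.2 a.2⟩ = r * toFun a

namespace CStarWeight

/-- A weight is proper if it is nonzero, lower semicontinuous and densely defined. -/
structure IsProper (φ : CStarWeight B) : Prop where
  ne_zero : ∃ b, φ.toFun b ≠ 0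
  lowerSemicontinuous : LowerSemicontinuous φ.toFun
  dense : Dense {b | φ.toFun b < ∞}

/-- The span `M_φ` of the positive elements of finite weight. -/
def finiteSpan (φ : CStarWeight B) : Submodule ℂ B :=
  Submodule.span ℂ {b | ∃ hb : 0 ≤ b, φ.toFun ⟨b, hb⟩ < ∞}

/-- A weight is tracial if `φ(b* b) = φ(b b*)` for all `b`. -/
def IsTracial (φ : CStarWeight B) : Prop :=
  ∀ b : B, φ.toFun ⟨star b * b, star_mul_self_nonneg b⟩ =
    φ.toFun ⟨b * star b, mul_star_self_nonneg b⟩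

/-- The restriction of a weight along a `*`-homomorphism. -/
def comap {C : Type*} [NonUnitalCStarAlgebra C] [PartialOrder C] [StarOrderedRing C]
    (j : C →⋆ₙₐ[ℂ] B) (φ : CStarWeight B) : CStarWeight C where
  toFun c := φ.toFun ⟨j c.1, map_nonneg j c.2⟩
  map_zero := by
    simp only [_root_.map_zero]
    exact φ.map_zero
  map_add a b := by
    simp only [_root_.map_add]
    exact φ.map_add ⟨j a.1, map_nonneg j a.2⟩ ⟨j b.1, map_nonneg j b.2⟩
  map_smul r a := by
    have h : j ((r : ℝ) • a.1) = (r : ℝ) • j a.1 := by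
      rw [← Complex.coe_smul, ← Complex.coe_smul, _root_.map_smul]
    simp only [h]
    exact φ.map_smul r ⟨j a.1, map_nonneg j a.2⟩

end CStarWeight

namespace CStarFlow

variable {B : Type*} [NonUnitalCStarAlgebra B]

/-- `b` is entire for the flow `α` if its orbit map extends to an entire function. -/
def IsEntire (α : CStarFlow B) (b : B) : Prop :=
  ∃ f : ℂ → B, Differentiable ℂ f ∧ ∀ t : ℝ, f t = α.toFun t b

open Classical in
/-- The entire extension `z ↦ α_z(b)` of the orbit map of an entire element `b`
(it is unique by the identity theorem). The value is `0` if `b` is not entire. -/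
noncomputable def extend (α : CStarFlow B) (z : ℂ) (b : B) : B :=
  if h : α.IsEntire b then h.choose z else 0

theorem differentiable_extend (α : CStarFlow B) {b : B} (h : α.IsEntire b) :
    Differentiable ℂ fun z => α.extend z b := by
  simpa only [extend, dif_pos h] using h.choose_spec.1

theorem extend_ofReal (α : CStarFlow B) {b : B} (h : α.IsEntire b) (t : ℝ) :
    α.extend t b = α.toFun t b := by
  simpa only [extend, dif_pos h] using h.choose_spec.2 t

variable [PartialOrder B] [StarOrderedRing B]

/-- The set `M_φ^α = ⋂_z α_z(𝓐_α ∩ M_φ)`, where `𝓐_α` is the set of entire elements. -/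
def kmsDomain (α : CStarFlow B) (φ : CStarWeight B) : Set B :=
  ⋂ z : ℂ, α.extend z '' {b | α.IsEntire b ∧ b ∈ φ.finiteSpan}

/-- `φ` is an `α`-`β`-KMS weight: a proper weight which is `α`-invariant and satisfies
`φ(b* b) = φ(α_{-iβ/2}(b) α_{-iβ/2}(b)*)` for all `b ∈ M_φ^α`. -/
structure IsKMSWeight (α : CStarFlow B) (β : ℝ) (φ : CStarWeight B) : Prop where
  proper : φ.IsProper
  invariant : ∀ (t : ℝ) (b : {b : B // 0 ≤ b}),
    φ.toFun ⟨α.toFun t b.1, map_nonneg (α.toFun t) b.2⟩ = φ.toFun b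
  kms : ∀ b ∈ α.kmsDomain φ,
    φ.toFun ⟨star b * b, star_mul_self_nonneg b⟩ =
      φ.toFun ⟨α.extend (-(Complex.I * β / 2)) b * star (α.extend (-(Complex.I * β / 2)) b),
        mul_star_self_nonneg _⟩

end CStarFlow
end Weights

/-! ### Ideals and the standing conditions -/

section Ideals

variable {A : Type*} [NonUnitalCStarAlgebra A]

/-- A (not necessarily closed) two-sided ideal of a C*-algebra, as a subspace. -/
def IsAlgIdeal (I : Submodule ℂ A) : Prop :=
  ∀ a ∈ I, ∀ b : A, a * b ∈ I ∧ b * a ∈ I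

variable (A) in
/-- The Pedersen ideal of `A`: the smallest dense two-sided ideal of `A`. -/
def pedersenIdeal : Submodule ℂ A :=
  sInf {I | IsAlgIdeal I ∧ Dense (I : Set A)}

/-- A `*`-endomorphism is nondegenerate if it maps an approximate unit to an approximate unit. -/
def IsNondegenerate (σ : A →⋆ₙₐ[ℂ] A) : Prop :=
  ∃ l : Filter A, l.IsApproximateUnit ∧ (l.map σ).IsApproximateUnit

/-- For every `a`, `limsup ‖ρ_n(a)‖ = ‖a‖`. -/
def LimsupNorm (ρ : ℕ → A →⋆ₙₐ[ℂ] A) : Prop :=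
  ∀ a : A, limsup (fun n => ‖ρ n a‖) atTop = ‖a‖

/-- There is no closed two-sided ideal `I`, other than `0` and `A`, with `ρ_n(I) ⊆ I` for all
`n`. -/
def NoInvariantIdeal (ρ : ℕ → A →⋆ₙₐ[ℂ] A) : Prop :=
  ∀ I : Submodule ℂ A, IsAlgIdeal I → IsClosed (I : Set A) →
    (∀ n, ∀ a ∈ I, ρ n a ∈ I) → I = ⊥ ∨ I = ⊤

end Ideals

/-- The closure `K_x` of `{(exp (√-1 x_n t))_n : t ∈ ℝ}` in the infinite torus. -/
def torusClosure (x : ℕ → ℝ) : Set (ℕ → Circle) :=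
  closure (Set.range fun (t : ℝ) (n : ℕ) => Circle.exp (x n * t))

end ToeplitzKMS

/-! The flow has pure point spectrum. By the covariance relation a T_i = T_i ρ_i(a) the monomials
T_u a T_v* span a dense subalgebra, and each is an eigenvector of frequency x_u - x_v, where x_u is
the sum of x over the letters of u. On eigenvectors of frequency s the KMS condition reads φ(b*b) =
e^{βs} φ(bb*), and approximate units of finite weight inside the fixed-point algebra remove its
domain restriction (`IsKMSWeight.val_eigen`). The hypothesis on K_x enters only through
`length_eq_of_sum_eq`: words of equal frequency have equal length.

Restriction. Elements of A are fixed by the flow, so the restriction τ of a KMS weight is a trace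
(`IsKMSWeight.isTracial_comap`). It is densely defined because finite-weight elements can be
projected to fixed points and then dominate spectral cutoffs of elements of A
(`IsKMSWeight.denselyDefined_comap`). For the inequality, the elements T_n p T_n* with 0 ≤ p ≤ 1 are
pairwise orthogonal with sums of norm at most 1, and the KMS condition turns φ(a^{1/2} T_n p T_n*
a^{1/2}) into e^{-βx_n} τ(p^{1/2} ρ_n(a) p^{1/2}) (`tsum_val_le_of_isKMSWeight`).

Injectivity. A KMS weight is the supremum of its compressions b ↦ φ(e b e), with e from an
approximate unit of A of finite weight (`IsKMSWeight.iSup_conj`), and these are bounded functionals.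
Invariance kills monomials of nonzero frequency. At frequency zero the words u and v have equal
length, so T_u and T_v are equal or have orthogonal ranges; polarization and the KMS condition then
move everything into A (`lin_monoT_eq`).

Surjectivity. The functional truncated at k sums e^{-βx_w} (τ - Σ_n e^{-βx_n} τ∘ρ_n)(T_ww) over
words w shorter than k and e^{-βx_w} τ(T_ww) over words of length k. On polynomials it is eventually
constant in k (`trunc_succ`), so limits exist after compressing by an e in A with τ(e*e) finite
(`tendsto_compr`). The matrix entries of an eigenvector X live at a single value of |v| - |w|,
whence the truncations of X*X and XX* agree up to the factor e^{βs} and a shift of k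
(`trunc_eigen`), and the shift disappears in the limit. The supremum over the compressions is the
extension `kmsExt`, and Parseval's identity (`PurePoint.tsum_proj_eq`) carries the KMS identity from
eigenvectors to all entire elements. -/

namespace ToeplitzKMS

/-! ### Resolvent-type elements -/

section Resolvent

variable {A : Type*} [NonUnitalCStarAlgebra A] [PartialOrder A] [StarOrderedRing A]

/-- The element `r (1 + r)⁻¹` for positive `r`. -/
noncomputable def res (r : A) : A := cfcₙ (fun x : ℝ => x / (1 + |x|)) r

/-- The absolute value in `res` serves this purpose: it changes nothing on positive elements, but
makes the function continuous on the whole line. -/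
theorem continuous_res_fun : Continuous fun x : ℝ => x / (1 + |x|) := by
  fun_prop (disch := intro x; positivity)

theorem nonneg_of_mem_quasispectrum {r : A} (hr : 0 ≤ r) {x : ℝ} (hx : x ∈ quasispectrum ℝ r) :
    0 ≤ x := quasispectrum_nonneg_of_nonneg r hr x hx

theorem res_nonneg {r : A} (hr : 0 ≤ r) : 0 ≤ res r :=
  cfcₙ_nonneg fun x hx => by
    have := nonneg_of_mem_quasispectrum hr hx
    positivity

omit [PartialOrder A] [StarOrderedRing A] in
theorem norm_res_le (r : A) : ‖res r‖ ≤ 1 := by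
  refine norm_cfcₙ_le fun x _ => ?_
  rw [norm_div, Real.norm_eq_abs, Real.norm_eq_abs, abs_of_pos (by positivity : 0 < 1 + |x|),
    div_le_one (by positivity)]
  linarith [abs_nonneg x]

/-- Operator monotonicity of 1 - (1 + x)⁻¹. It makes the net of all `res r`, over positive r of
finite weight, increasing. -/
theorem res_mono {r s : A} (hr : 0 ≤ r) (h : r ≤ s) : res r ≤ res s := by
  have key : ∀ t : A, 0 ≤ t → res t = cfcₙ (fun x : ℝ => 1 - (1 + x)⁻¹) t := fun t ht =>
    cfcₙ_congr fun x hx => by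
      have := nonneg_of_mem_quasispectrum ht hx
      simp only [abs_of_nonneg this]
      field_simp
      ring
  rw [key r hr, key s (hr.trans h)]
  exact CFC.monotoneOn_one_sub_one_add_inv_real hr (hr.trans h) h

theorem res_le {r : A} (hr : 0 ≤ r) : res r ≤ r := by
  conv_rhs => rw [← cfcₙ_id' ℝ r]
  refine cfcₙ_mono (fun x hx => ?_) continuous_res_fun.continuousOn
  have := nonneg_of_mem_quasispectrum hr hx
  exact div_le_self this (by linarith [abs_nonneg x])

theorem map_res {C : Type*} [NonUnitalCStarAlgebra C] [PartialOrder C] [StarOrderedRing C]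
    (j : A →⋆ₙₐ[ℂ] C) {r : A} (hr : 0 ≤ r) : j (res r) = res (j r) :=
  NonUnitalStarAlgHomClass.map_cfcₙ j _ r continuous_res_fun.continuousOn (by simp)
    (map_continuous j) hr.isSelfAdjoint (map_nonneg j hr).isSelfAdjoint

/-- The square root of `r (1 + r)⁻¹`. -/
noncomputable def rt (r : A) : A := CFC.sqrt (res r)

theorem rt_nonneg (r : A) : 0 ≤ rt r := CFC.sqrt_nonneg _

theorem star_rt (r : A) : star (rt r) = rt r := (rt_nonneg r).isSelfAdjoint.star_eq

theorem rt_mul_rt {r : A} (hr : 0 ≤ r) : rt r * rt r = res r :=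
  CFC.sqrt_mul_sqrt_self _ (res_nonneg hr)

theorem norm_rt_le {r : A} (hr : 0 ≤ r) : ‖rt r‖ ≤ 1 := by
  have h : ‖rt r‖ * ‖rt r‖ ≤ 1 := by
    rw [← CStarRing.norm_star_mul_self, star_rt, rt_mul_rt hr]
    exact norm_res_le r
  nlinarith [norm_nonneg (rt r)]

/-- With y = a - ea one has a - e²a = y + ey, and expanding (y + ey)*(y + ey) adds only positive
terms to y*y. Thus the square root of an approximate unit approximates at least as well. -/
theorem norm_sub_mul_le_of_nonneg {e : A} (he : 0 ≤ e) (a : A) :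
    ‖a - e * a‖ ≤ ‖a - e * e * a‖ := by
  set y := a - e * a with hy
  have h1 : a - e * e * a = y + e * y := by rw [hy]; noncomm_ring
  rw [h1]
  have hse : star e = e := he.isSelfAdjoint.star_eq
  have h2 : star y * y ≤ star (y + e * y) * (y + e * y) := by
    have h3 : star (y + e * y) * (y + e * y) =
        star y * y + (2 • (star y * e * y) + star (e * y) * (e * y)) := by
      simp only [star_add, star_mul, hse]
      noncomm_ring
    rw [h3]
    refine le_add_of_nonneg_right (add_nonneg ?_ (star_mul_self_nonneg _))
    exact nsmul_nonneg (star_left_conjugate_nonneg he y) 2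
  have h3 := CStarAlgebra.norm_le_norm_of_nonneg_of_le (star_mul_self_nonneg y) h2
  rw [CStarRing.norm_star_mul_self, CStarRing.norm_star_mul_self] at h3
  exact (mul_self_le_mul_self_iff (norm_nonneg _) (norm_nonneg _)).2 h3

theorem norm_sub_rt_mul_le {r : A} (hr : 0 ≤ r) (a : A) :
    ‖a - rt r * a‖ ≤ ‖a - res r * a‖ := by
  simpa [rt_mul_rt hr] using norm_sub_mul_le_of_nonneg (rt_nonneg r) a

/-- The left side is (1 - q) r (1 - q) for q = `res r`, written without a unit. Functional calculus
turns it into x/(1 + x)², which is at most 1 for x ≥ 0. -/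
theorem norm_defect_le {r : A} (hr : 0 ≤ r) :
    ‖r - res r * r - r * res r + res r * r * res r‖ ≤ 1 := by
  have hc := continuous_res_fun
  have h : r - res r * r - r * res r + res r * r * res r = cfcₙ (fun x : ℝ =>
      x - x / (1 + |x|) * x - x * (x / (1 + |x|)) + x / (1 + |x|) * x * (x / (1 + |x|))) r := by
    have c1 := hc.continuousOn (s := quasispectrum ℝ r)
    have c0 : ContinuousOn (fun x : ℝ => x) (quasispectrum ℝ r) := continuousOn_id
    have hid : cfcₙ (fun x : ℝ => x) r = r := cfcₙ_id' ℝ r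
    rw [cfcₙ_add (fun x : ℝ => x - x / (1 + |x|) * x - x * (x / (1 + |x|)))
        (fun x : ℝ => x / (1 + |x|) * x * (x / (1 + |x|))) r (by fun_prop) (by simp)
        (by fun_prop) (by simp),
      cfcₙ_sub (fun x : ℝ => x - x / (1 + |x|) * x) (fun x : ℝ => x * (x / (1 + |x|))) r
        (by fun_prop) (by simp) (by fun_prop) (by simp),
      cfcₙ_sub (fun x : ℝ => x) (fun x : ℝ => x / (1 + |x|) * x) r
        (by fun_prop) (by simp) (by fun_prop) (by simp),
      cfcₙ_mul (fun x : ℝ => x / (1 + |x|) * x) (fun x : ℝ => x / (1 + |x|)) r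
        (by fun_prop) (by simp) (by fun_prop) (by simp),
      cfcₙ_mul (fun x : ℝ => x / (1 + |x|)) (fun x : ℝ => x) r
        (by fun_prop) (by simp) (by fun_prop) (by simp),
      cfcₙ_mul (fun x : ℝ => x) (fun x : ℝ => x / (1 + |x|)) r
        (by fun_prop) (by simp) (by fun_prop) (by simp), hid]
    rfl
  rw [h]
  refine norm_cfcₙ_le fun x hx => ?_
  have hx0 := nonneg_of_mem_quasispectrum hr hx
  rw [abs_of_nonneg hx0]
  have : x - x / (1 + x) * x - x * (x / (1 + x)) + x / (1 + x) * x * (x / (1 + x)) =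
      x / (1 + x) ^ 2 := by field_simp; ring
  rw [this, Real.norm_of_nonneg (by positivity), div_le_one (by positivity)]
  nlinarith

/-- Write p² as p^{1/2} p p^{1/2} and bound the middle factor by its norm. -/
theorem mul_self_le_of_norm_le {p : A} (hp0 : 0 ≤ p) (hp : ‖p‖ ≤ 1) : p * p ≤ p := by
  have hs : CFC.sqrt p * CFC.sqrt p = p := CFC.sqrt_mul_sqrt_self p hp0
  have hss : star (CFC.sqrt p) = CFC.sqrt p := (CFC.sqrt_nonneg p).isSelfAdjoint.star_eq
  have h := CStarAlgebra.star_left_conjugate_le_norm_smul (a := CFC.sqrt p) (b := p)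
    hp0.isSelfAdjoint
  rw [hss, hs] at h
  have h2 : p * p = CFC.sqrt p * p * CFC.sqrt p := by
    generalize CFC.sqrt p = s at hs
    subst hs
    simp only [mul_assoc]
  rw [h2]
  exact (h.trans (smul_le_smul_of_nonneg_right hp hp0)).trans_eq (one_smul _ _)

/-- `res (n • c)` acts almost as a unit on `b` if `c` is close to `b b*`. -/
theorem norm_sub_res_nsmul_mul_sq_le {c : A} (hc : 0 ≤ c) (b : A) {n : ℕ} (hn : 0 < n) :
    ‖b - res (n • c) * b‖ ^ 2 ≤ 4 * ‖b * star b - c‖ + 1 / n := by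
  set q := res (n • c) with hq
  have hnc : 0 ≤ n • c := nsmul_nonneg hc n
  have hsq : star q = q := (res_nonneg hnc).isSelfAdjoint.star_eq
  have hqn : ‖q‖ ≤ 1 := norm_res_le _
  have h1 : ‖b - q * b‖ ^ 2 = ‖(b - q * b) * star (b - q * b)‖ := by
    rw [CStarRing.norm_self_mul_star, sq]
  set d := b * star b - c with hd
  -- This is (1 - q) bb* (1 - q) with bb* = d + c: the d part costs at most four times ‖d‖, the c
  -- part is the defect estimate.
  have h2 : (b - q * b) * star (b - q * b) =
      (d - q * d - d * q + q * d * q) + (c - q * c - c * q + q * c * q) := by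
    rw [hd, star_sub, star_mul, hsq]
    noncomm_ring
  -- The defect of n • c is at most 1 whatever n is; dividing by n gives the gain.
  have h3 : ‖c - q * c - c * q + q * c * q‖ ≤ 1 / n := by
    have h := norm_defect_le hnc
    rw [← hq] at h
    have h4 : n • c - q * n • c - n • c * q + q * n • c * q =
        n • (c - q * c - c * q + q * c * q) := by
      simp only [smul_add, smul_sub, mul_smul_comm, smul_mul_assoc]
    rw [h4, ← Nat.cast_smul_eq_nsmul ℝ, norm_smul, Real.norm_natCast] at h
    rw [le_div_iff₀ (by exact_mod_cast hn)]
    linarith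
  have b1 : ‖q * d‖ ≤ ‖d‖ := (norm_mul_le _ _).trans (by nlinarith [norm_nonneg d])
  have b2 : ‖d * q‖ ≤ ‖d‖ := (norm_mul_le _ _).trans (by nlinarith [norm_nonneg d])
  have b3 : ‖q * d * q‖ ≤ ‖d‖ := (norm_mul_le _ _).trans (by
    nlinarith [norm_nonneg d, norm_nonneg (q * d), norm_nonneg q])
  have h5 : ‖d - q * d - d * q + q * d * q‖ ≤ 4 * ‖d‖ := by
    have e1 := norm_add_le (d - q * d - d * q) (q * d * q)
    have e2 := norm_sub_le (d - q * d) (d * q)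
    have e3 := norm_sub_le d (q * d)
    linarith
  rw [h1, h2]
  exact (norm_add_le _ _).trans (add_le_add h5 h3)

/-- Formally (1 - p)² ≤ 1 - p ≤ 1 - q, sandwiched between a* and a. A good approximation by q is
thereby inherited by every larger contraction, at the price of a square root. -/
theorem norm_sub_mul_sq_le_of_le {p q : A} (hq : 0 ≤ q) (hqp : q ≤ p) (hp : ‖p‖ ≤ 1) (a : A) :
    ‖a - p * a‖ ^ 2 ≤ ‖a‖ * ‖a - q * a‖ := by
  have hp0 := hq.trans hqp
  have hsp : star p = p := hp0.isSelfAdjoint.star_eq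
  have hpp : p * p ≤ p := mul_self_le_of_norm_le hp0 hp
  have h1 : star (a - p * a) * (a - p * a) ≤ star a * (a - q * a) := by
    have e1 : star (a - p * a) * (a - p * a) =
        star a * a - 2 • (star a * p * a) + star a * (p * p) * a := by
      simp only [star_sub, star_mul, hsp]
      noncomm_ring
    have e2 : star a * (p * p) * a ≤ star a * p * a := star_left_conjugate_le_conjugate hpp a
    have e3 : star a * q * a ≤ star a * p * a := star_left_conjugate_le_conjugate hqp a
    rw [e1]
    calc star a * a - 2 • (star a * p * a) + star a * (p * p) * a
        ≤ star a * a - 2 • (star a * p * a) + star a * p * a := by gcongr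
      _ = star a * a - star a * p * a := by rw [two_smul]; abel
      _ ≤ star a * a - star a * q * a := by gcongr
      _ = _ := by noncomm_ring
  have h2 := CStarAlgebra.norm_le_norm_of_nonneg_of_le (star_mul_self_nonneg _) h1
  rw [CStarRing.norm_star_mul_self, ← sq] at h2
  exact h2.trans ((norm_mul_le _ _).trans (by rw [norm_star]))

end Resolvent
end ToeplitzKMS

namespace ToeplitzKMS

/-! ### Weights as functions on the whole algebra -/

namespace CStarWeight

variable {B : Type*} [NonUnitalCStarAlgebra B] [PartialOrder B] [StarOrderedRing B]
  (φ : CStarWeight B)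

open Classical in
/-- The value of a weight at a positive element, and zero at all other elements. -/
noncomputable def val (b : B) : ℝ≥0∞ := if h : 0 ≤ b then φ.toFun ⟨b, h⟩ else 0

theorem val_of_nonneg {b : B} (hb : 0 ≤ b) : φ.val b = φ.toFun ⟨b, hb⟩ := dif_pos hb

theorem toFun_eq_val (b : {b : B // 0 ≤ b}) : φ.toFun b = φ.val b.1 := (φ.val_of_nonneg b.2).symm

@[simp] theorem val_zero : φ.val 0 = 0 := by rw [φ.val_of_nonneg le_rfl, φ.map_zero]

theorem val_add {a b : B} (ha : 0 ≤ a) (hb : 0 ≤ b) : φ.val (a + b) = φ.val a + φ.val b := by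
  rw [φ.val_of_nonneg ha, φ.val_of_nonneg hb, φ.val_of_nonneg (add_nonneg ha hb)]
  exact φ.map_add ⟨a, ha⟩ ⟨b, hb⟩

theorem val_smul {r : ℝ} (hr : 0 ≤ r) {b : B} (hb : 0 ≤ b) :
    φ.val (r • b) = ENNReal.ofReal r * φ.val b := by
  rw [φ.val_of_nonneg hb, φ.val_of_nonneg (smul_nonneg hr hb)]
  have := φ.map_smul ⟨r, hr⟩ ⟨b, hb⟩
  rw [ENNReal.ofReal_eq_coe_nnreal hr]
  exact this

theorem val_mono {a b : B} (ha : 0 ≤ a) (h : a ≤ b) : φ.val a ≤ φ.val b := by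
  have := φ.val_add ha (sub_nonneg.2 h)
  rw [add_sub_cancel] at this
  rw [this]
  exact le_self_add

theorem val_sum {ι : Type*} (s : Finset ι) (f : ι → B) (hf : ∀ i ∈ s, 0 ≤ f i) :
    φ.val (∑ i ∈ s, f i) = ∑ i ∈ s, φ.val (f i) := by
  classical
  induction s using Finset.induction_on with
  | empty => simp
  | insert i s hi ih =>
    rw [Finset.sum_insert hi, Finset.sum_insert hi, φ.val_add (hf i (Finset.mem_insert_self i s))
      (Finset.sum_nonneg fun j hj => hf j (Finset.mem_insert_of_mem hj)),
      ih fun j hj => hf j (Finset.mem_insert_of_mem hj)]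

theorem val_nsmul (n : ℕ) {b : B} (hb : 0 ≤ b) : φ.val (n • b) = n * φ.val b := by
  rw [← Nat.cast_smul_eq_nsmul ℝ, φ.val_smul (Nat.cast_nonneg n) hb, ENNReal.ofReal_natCast]

theorem ext_val {φ ψ : CStarWeight B} (h : ∀ b, 0 ≤ b → φ.val b = ψ.val b) : φ = ψ := by
  refine CStarWeight.ext (funext fun b => ?_)
  rw [toFun_eq_val, toFun_eq_val, h b.1 b.2]

theorem val_comap {C : Type*} [NonUnitalCStarAlgebra C] [PartialOrder C] [StarOrderedRing C]
    (j : C →⋆ₙₐ[ℂ] B) {c : C} (hc : 0 ≤ c) : (comap j φ).val c = φ.val (j c) := by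
  rw [val_of_nonneg _ hc, val_of_nonneg _ (map_nonneg j hc)]
  rfl

variable {φ}

theorem val_le_of_forall_near (hφ : LowerSemicontinuous φ.toFun) {b : B} (hb : 0 ≤ b) {C : ℝ≥0∞}
    (h : ∀ δ > 0, ∃ b', 0 ≤ b' ∧ ‖b' - b‖ < δ ∧ φ.val b' ≤ C) : φ.val b ≤ C := by
  by_contra! hlt
  rw [φ.val_of_nonneg hb] at hlt
  have h1 := hφ ⟨b, hb⟩ C hlt
  obtain ⟨δ, hδ, h2⟩ := Metric.eventually_nhds_iff.1 h1
  obtain ⟨b', hb', hd, hC⟩ := h δ hδ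
  have h3 : C < φ.toFun ⟨b', hb'⟩ :=
    h2 (y := ⟨b', hb'⟩) (by rwa [Subtype.dist_eq, dist_eq_norm])
  rw [toFun_eq_val] at h3
  exact absurd hC (not_le.2 h3)

theorem val_le_of_tendsto (hφ : LowerSemicontinuous φ.toFun) {ι : Type*} {l : Filter ι} [l.NeBot]
    {f : ι → B} {b : B} (hf : ∀ i, 0 ≤ f i) (hb : Tendsto f l (𝓝 b)) {C : ℝ≥0∞}
    (h : ∀ i, φ.val (f i) ≤ C) : φ.val b ≤ C := by
  have hb0 : 0 ≤ b := ge_of_tendsto' hb hf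
  refine val_le_of_forall_near hφ hb0 fun δ hδ => ?_
  obtain ⟨i, hi⟩ := ((Metric.tendsto_nhds.1 hb) δ hδ).exists
  exact ⟨f i, hf i, by rwa [← dist_eq_norm], h i⟩

theorem lowerSemicontinuous_of_forall (h : ∀ b, 0 ≤ b → ∀ y < φ.val b, ∃ δ > 0, ∀ b', 0 ≤ b' →
    ‖b' - b‖ < δ → y < φ.val b') : LowerSemicontinuous φ.toFun := by
  intro b y hy
  rw [toFun_eq_val] at hy
  obtain ⟨δ, hδ, h2⟩ := h b.1 b.2 y hy
  refine Metric.eventually_nhds_iff.2 ⟨δ, hδ, fun b' hb' => ?_⟩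
  change y < φ.toFun b'
  rw [toFun_eq_val]
  refine h2 _ b'.2 ?_
  rwa [← dist_eq_norm, ← Subtype.dist_eq]

/-- Every positive element is a limit of positive elements of finite weight. -/
def DenselyDefined (φ : CStarWeight B) : Prop :=
  ∀ b : B, 0 ≤ b → ∀ δ > 0, ∃ c, 0 ≤ c ∧ φ.val c < ∞ ∧ ‖c - b‖ < δ

theorem denselyDefined_iff : φ.DenselyDefined ↔ Dense {b | φ.toFun b < ∞} := by
  constructor
  · intro h
    rw [Metric.dense_iff]
    intro b δ hδ
    obtain ⟨c, hc, hfin, hd⟩ := h b.1 b.2 δ hδ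
    refine ⟨⟨c, hc⟩, ?_, ?_⟩
    · rwa [Metric.mem_ball, Subtype.dist_eq, dist_eq_norm]
    · rwa [Set.mem_ofPred_eq, toFun_eq_val]
  · intro h b hb δ hδ
    obtain ⟨c, hc, hfin⟩ := Metric.dense_iff.1 h ⟨b, hb⟩ δ hδ
    refine ⟨c.1, c.2, ?_, ?_⟩
    · rwa [Set.mem_ofPred_eq, toFun_eq_val] at hfin
    · rwa [Metric.mem_ball, Subtype.dist_eq, dist_eq_norm] at hc

theorem IsProper.denselyDefined (h : φ.IsProper) : φ.DenselyDefined := denselyDefined_iff.2 h.dense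

/-- The self-adjoint element a - b is bounded by its norm before compressing by e. If φ(e*e) is
finite, this makes b ↦ φ(e* b e) Lipschitz in norm, although φ itself is only lower semicontinuous.
-/
theorem conj_le_add (e : B) {a b : B} (ha : 0 ≤ a) (hb : 0 ≤ b) :
    star e * a * e ≤ star e * b * e + ‖a - b‖ • (star e * e) := by
  have h := CStarAlgebra.star_left_conjugate_le_norm_smul (a := e) (b := a - b)
    (ha.isSelfAdjoint.sub hb.isSelfAdjoint)
  rw [mul_sub, sub_mul] at h
  exact sub_le_iff_le_add'.1 h

theorem val_conj_le_add (φ : CStarWeight B) (e : B) {a b : B} (ha : 0 ≤ a) (hb : 0 ≤ b) :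
    φ.val (star e * a * e) ≤
      φ.val (star e * b * e) + ENNReal.ofReal ‖a - b‖ * φ.val (star e * e) := by
  have he := star_mul_self_nonneg e
  have h0 : 0 ≤ star e * b * e := star_left_conjugate_nonneg hb e
  refine (φ.val_mono (star_left_conjugate_nonneg ha e) (conj_le_add e ha hb)).trans_eq ?_
  rw [φ.val_add h0 (smul_nonneg (norm_nonneg _) he), φ.val_smul (norm_nonneg _) he]

theorem val_conj_le (φ : CStarWeight B) (e : B) {a : B} (ha : 0 ≤ a) :
    φ.val (star e * a * e) ≤ ENNReal.ofReal ‖a‖ * φ.val (star e * e) := by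
  simpa using φ.val_conj_le_add e ha le_rfl

/-! ### Tracial weights -/

theorem IsTracial.val_eq (h : φ.IsTracial) (b : B) : φ.val (star b * b) = φ.val (b * star b) := by
  rw [φ.val_of_nonneg (star_mul_self_nonneg b), φ.val_of_nonneg (mul_star_self_nonneg b)]
  exact h b

theorem isTracial_of_forall (h : ∀ b, φ.val (star b * b) = φ.val (b * star b)) : φ.IsTracial := by
  intro b
  rw [toFun_eq_val, toFun_eq_val]
  exact h b

/-- The trace property for a^{1/2} e moves e to the inside, where it occurs only as e e*.
Monotonicity in e e* then becomes visible. -/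
theorem IsTracial.val_conj (h : φ.IsTracial) (e : B) {a : B} (ha : 0 ≤ a) :
    φ.val (star e * a * e) = φ.val (CFC.sqrt a * (e * star e) * CFC.sqrt a) := by
  have hss : star (CFC.sqrt a) = CFC.sqrt a := (CFC.sqrt_nonneg a).isSelfAdjoint.star_eq
  have := h.val_eq (CFC.sqrt a * e)
  rw [star_mul, hss] at this
  convert this using 2
  · conv_lhs => rw [← CFC.sqrt_mul_sqrt_self a ha]
    simp only [mul_assoc]
  · simp only [mul_assoc]

theorem IsTracial.val_conj_mono (h : φ.IsTracial) {e f : B} (hef : e * star e ≤ f * star f)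
    {a : B} (ha : 0 ≤ a) : φ.val (star e * a * e) ≤ φ.val (star f * a * f) := by
  have hss : star (CFC.sqrt a) = CFC.sqrt a := (CFC.sqrt_nonneg a).isSelfAdjoint.star_eq
  rw [h.val_conj e ha, h.val_conj f ha]
  have h1 := star_left_conjugate_nonneg (mul_star_self_nonneg e) (CFC.sqrt a)
  have h2 := star_left_conjugate_le_conjugate hef (CFC.sqrt a)
  rw [hss] at h1 h2
  exact φ.val_mono h1 h2

theorem IsTracial.val_conj_le_self (h : φ.IsTracial) {e : B} (he : ‖e‖ ≤ 1)
    {a : B} (ha : 0 ≤ a) : φ.val (star e * a * e) ≤ φ.val a := by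
  have hss : star (CFC.sqrt a) = CFC.sqrt a := (CFC.sqrt_nonneg a).isSelfAdjoint.star_eq
  have h1 := star_left_conjugate_nonneg (mul_star_self_nonneg e) (CFC.sqrt a)
  have h2 := CStarAlgebra.star_left_conjugate_le_norm_smul (a := CFC.sqrt a) (b := e * star e)
    (.mul_star_self _)
  rw [h.val_conj e ha]
  rw [hss, CFC.sqrt_mul_sqrt_self a ha, CStarRing.norm_self_mul_star] at h2
  rw [hss] at h1
  refine φ.val_mono h1 (h2.trans ?_)
  exact (smul_le_smul_of_nonneg_right (by nlinarith [norm_nonneg e]) ha).trans_eq (one_smul ℝ a)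

/-! ### The approximate unit attached to a densely defined weight -/

/-- The positive elements of finite weight, as an index set. -/
def FinIdx (φ : CStarWeight B) : Type _ := {r : B // 0 ≤ r ∧ φ.val r < ∞}

instance : Preorder φ.FinIdx := inferInstanceAs (Preorder {r : B // 0 ≤ r ∧ φ.val r < ∞})

instance : Nonempty φ.FinIdx := ⟨⟨0, le_rfl, by simp⟩⟩

instance : IsDirectedOrder φ.FinIdx := ⟨fun r s => by
  refine ⟨⟨r.1 + s.1, add_nonneg r.2.1 s.2.1, ?_⟩, ?_, ?_⟩
  · rw [φ.val_add r.2.1 s.2.1]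
    exact ENNReal.add_lt_top.2 ⟨r.2.2, s.2.2⟩
  · exact le_add_of_nonneg_right s.2.1
  · exact le_add_of_nonneg_left r.2.1⟩

/-- The increasing approximate unit `r (1 + r)⁻¹`. -/
noncomputable def unit (r : φ.FinIdx) : B := res r.1

/-- The square root of the approximate unit. -/
noncomputable def unitSqrt (r : φ.FinIdx) : B := rt r.1

theorem unit_nonneg (r : φ.FinIdx) : 0 ≤ unit r := res_nonneg r.2.1
theorem star_unitSqrt (r : φ.FinIdx) : star (unitSqrt r) = unitSqrt r := star_rt _
theorem unitSqrt_mul_self (r : φ.FinIdx) : unitSqrt r * unitSqrt r = unit r := rt_mul_rt r.2.1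
theorem norm_unitSqrt_le (r : φ.FinIdx) : ‖unitSqrt r‖ ≤ 1 := norm_rt_le r.2.1
theorem norm_unit_le (r : φ.FinIdx) : ‖unit r‖ ≤ 1 := norm_res_le _
theorem unit_mono {r s : φ.FinIdx} (h : r ≤ s) : unit r ≤ unit s := res_mono r.2.1 h

theorem val_unit_lt_top (r : φ.FinIdx) : φ.val (unit r) < ∞ :=
  (φ.val_mono (unit_nonneg r) (res_le r.2.1)).trans_lt r.2.2

theorem val_star_unitSqrt_mul_lt_top (r : φ.FinIdx) :
    φ.val (star (unitSqrt r) * unitSqrt r) < ∞ := by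
  rw [star_unitSqrt, unitSqrt_mul_self]
  exact val_unit_lt_top r

/-- A finite-weight c close to aa* makes `res (n • c)` almost a unit on a for large n; all larger
indices inherit this from monotonicity of `res`. -/
theorem DenselyDefined.eventually_norm_sub_unit_mul_lt (h : φ.DenselyDefined) (a : B) {ε : ℝ}
    (hε : 0 < ε) : ∀ᶠ r : φ.FinIdx in atTop, ‖a - unit r * a‖ < ε := by
  -- Passing to larger indices only gives ‖a - unit r * a‖² ≤ ‖a‖ η, hence this choice of η. Below,
  -- the distance η²/8 and n > 2/η² each contribute η²/2.
  obtain ⟨η, hη, hη2⟩ : ∃ η > 0, ‖a‖ * η < ε ^ 2 := by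
    refine ⟨ε ^ 2 / (‖a‖ + 1), by positivity, ?_⟩
    have : 0 < ‖a‖ + 1 := by positivity
    rw [mul_div_assoc', div_lt_iff₀ this]
    nlinarith [norm_nonneg a, sq_pos_of_pos hε]
  obtain ⟨c, hc, hfin, hd⟩ := h (a * star a) (mul_star_self_nonneg a) (η ^ 2 / 8) (by positivity)
  obtain ⟨n, hn⟩ := exists_nat_gt (2 / η ^ 2)
  have hn0 : 0 < (n : ℝ) := lt_trans (by positivity) hn
  have hn0' : 0 < n := by exact_mod_cast hn0
  have hfin' : φ.val (n • c) < ∞ := by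
    rw [φ.val_nsmul n hc]
    exact ENNReal.mul_lt_top (by simp) hfin
  refine (eventually_ge_atTop (⟨n • c, nsmul_nonneg hc n, hfin'⟩ : φ.FinIdx)).mono fun r hr => ?_
  have h1 := norm_sub_res_nsmul_mul_sq_le hc a hn0'
  have h2 := norm_sub_mul_sq_le_of_le (res_nonneg (nsmul_nonneg hc n)) (unit_mono hr)
    (norm_unit_le r) a
  have h3 : (1 : ℝ) / n < η ^ 2 / 2 := by
    rw [div_lt_div_iff₀ hn0 (by norm_num)]
    rw [div_lt_iff₀ (by positivity)] at hn
    linarith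
  rw [norm_sub_rev] at hd
  have h4 : ‖a - res (n • c) * a‖ < η := by
    refine lt_of_pow_lt_pow_left₀ 2 hη.le ?_
    linarith
  refine lt_of_pow_lt_pow_left₀ 2 hε.le ?_
  refine h2.trans_lt (lt_of_le_of_lt ?_ hη2)
  gcongr

theorem DenselyDefined.tendsto_unit_mul (h : φ.DenselyDefined) (a : B) :
    Tendsto (fun r : φ.FinIdx => unit r * a) atTop (𝓝 a) := by
  refine Metric.tendsto_nhds.2 fun ε hε => ?_
  filter_upwards [h.eventually_norm_sub_unit_mul_lt a hε] with r hr
  rwa [dist_eq_norm, norm_sub_rev]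

theorem DenselyDefined.tendsto_unitSqrt_mul (h : φ.DenselyDefined) (a : B) :
    Tendsto (fun r : φ.FinIdx => unitSqrt r * a) atTop (𝓝 a) := by
  refine Metric.tendsto_nhds.2 fun ε hε => ?_
  filter_upwards [h.eventually_norm_sub_unit_mul_lt a hε] with r hr
  rw [dist_eq_norm, norm_sub_rev]
  exact (norm_sub_rt_mul_le r.2.1 a).trans_lt hr

theorem DenselyDefined.tendsto_conj (h : φ.DenselyDefined) (a : B) :
    Tendsto (fun r : φ.FinIdx => star (unitSqrt r) * a * unitSqrt r) atTop (𝓝 a) := by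
  have h1 : Tendsto (fun r : φ.FinIdx => a * unitSqrt r) atTop (𝓝 a) := by
    have := (h.tendsto_unitSqrt_mul (star a)).star
    simpa only [star_mul, star_star, star_unitSqrt] using this
  have h2 := h.tendsto_unitSqrt_mul a
  have h3 : Tendsto (fun r : φ.FinIdx => unitSqrt r * (a * unitSqrt r - a) + unitSqrt r * a) atTop
      (𝓝 (0 + a)) := by
    refine Tendsto.add ?_ h2
    refine squeeze_zero_norm (fun r => (norm_mul_le _ _).trans
      (mul_le_of_le_one_left (norm_nonneg _) (norm_unitSqrt_le r))) ?_
    have := (h1.sub_const a).norm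
    simpa using this
  rw [zero_add] at h3
  refine h3.congr fun r => ?_
  rw [star_unitSqrt]
  noncomm_ring

theorem IsTracial.monotone_conj {ψ : CStarWeight B} (hψ : ψ.IsTracial) {a : B} (ha : 0 ≤ a) :
    Monotone fun r : φ.FinIdx => ψ.val (star (unitSqrt r) * a * unitSqrt r) := by
  intro r s hrs
  refine hψ.val_conj_mono ?_ ha
  rw [star_unitSqrt, star_unitSqrt, unitSqrt_mul_self, unitSqrt_mul_self]
  exact unit_mono hrs

/-- Traciality bounds each compression by the full value; lower semicontinuity gives the converse,
since the compressed elements converge in norm. -/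
theorem IsTracial.iSup_conj {ψ : CStarWeight B} (hψ : ψ.IsTracial)
    (hlsc : LowerSemicontinuous ψ.toFun) (h : φ.DenselyDefined) {a : B} (ha : 0 ≤ a) :
    ⨆ r : φ.FinIdx, ψ.val (star (unitSqrt r) * a * unitSqrt r) = ψ.val a := by
  refine le_antisymm (iSup_le fun r => hψ.val_conj_le_self (norm_unitSqrt_le r) ha) ?_
  exact val_le_of_tendsto hlsc (fun r => star_left_conjugate_nonneg ha _) (h.tendsto_conj a)
    fun r => le_iSup (fun r : φ.FinIdx => ψ.val (star (unitSqrt r) * a * unitSqrt r)) r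

end CStarWeight
end ToeplitzKMS

namespace ToeplitzKMS

/-! ### Spectral projections of flows with pure point spectrum -/

namespace CStarFlow

section PurePoint

variable {B : Type*} [NonUnitalCStarAlgebra B] (α : CStarFlow B)

/-- `b` is an eigenvector of frequency `s`. -/
def IsEigen (s : ℝ) (b : B) : Prop :=
  ∀ t : ℝ, α.toFun t b = Complex.exp ((s * t : ℝ) * Complex.I) • b

/-- The flow has a dense span of eigenvectors, with frequencies in the range of `fr`. -/
def PurePoint (fr : ℕ → ℝ) : Prop :=
  Dense (Submodule.span ℂ {b | ∃ i, α.IsEigen (fr i) b} : Set B)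

variable {α}

theorem norm_apply_le (t : ℝ) (b : B) : ‖α.toFun t b‖ ≤ ‖b‖ :=
  NonUnitalStarAlgHom.norm_apply_le _ b

variable (α) in
/-- The automorphism at time `t`, as a bounded operator. -/
noncomputable def clm (t : ℝ) : B →L[ℂ] B :=
  LinearMap.mkContinuous
    { toFun := α.toFun t
      map_add' := _root_.map_add _
      map_smul' := map_smul _ } 1 fun b => by simpa using norm_apply_le t b

theorem continuous_toFun (t : ℝ) : Continuous (α.toFun t) := (α.clm t).continuous

theorem IsEigen.smul {s : ℝ} {b : B} (hb : α.IsEigen s b) (c : ℂ) : α.IsEigen s (c • b) :=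
  fun t => by rw [map_smul, hb t, smul_comm]

theorem IsEigen.add {s : ℝ} {a b : B} (ha : α.IsEigen s a) (hb : α.IsEigen s b) :
    α.IsEigen s (a + b) :=
  fun t => by rw [_root_.map_add, ha t, hb t, smul_add]

theorem IsEigen.mul {s s' : ℝ} {a b : B} (ha : α.IsEigen s a) (hb : α.IsEigen s' b) :
    α.IsEigen (s + s') (a * b) := fun t => by
  rw [map_mul, ha t, hb t, smul_mul_smul_comm, ← Complex.exp_add]
  congr 2
  push_cast
  ring

theorem IsEigen.conj {s : ℝ} {b : B} (hb : α.IsEigen s b) : α.IsEigen (-s) (star b) := fun t => by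
  rw [map_star, hb t, star_smul, Complex.star_def, ← Complex.exp_conj]
  congr 2
  simp

theorem isEigen_zero_iff {b : B} : α.IsEigen 0 b ↔ ∀ t, α.toFun t b = b := by
  simp [IsEigen]

theorem isEigen_zero (s : ℝ) : α.IsEigen s (0 : B) := fun t => by simp

theorem isClosed_isEigen (s : ℝ) : IsClosed {b | α.IsEigen s b} := by
  simp only [IsEigen, Set.ofPred_forall]
  exact isClosed_iInter fun t => isClosed_eq (continuous_toFun t) (continuous_const_smul _)

variable (α) in
/-- Iterated averages which annihilate the eigenvectors of frequency `fr 0, …, fr (n - 1)`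
other than `s`. -/
noncomputable def avg (fr : ℕ → ℝ) (s : ℝ) : ℕ → B →L[ℂ] B
  | 0 => ContinuousLinearMap.id ℂ B
  -- At the time π / (fr n - s) an eigenvector of frequency fr n acquires the phase -1 relative to
  -- frequency s, so the mean vanishes on it. If fr n = s, division by zero gives time 0 and the
  -- step is the identity.
  | n + 1 => (1 / 2 : ℂ) • (avg fr s n +
      Complex.exp ((-(s * (Real.pi / (fr n - s))) : ℝ) * Complex.I) •
        (α.clm (Real.pi / (fr n - s))).comp (avg fr s n))

variable {fr : ℕ → ℝ} {s : ℝ}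

theorem avg_succ_apply (n : ℕ) (b : B) : α.avg fr s (n + 1) b = (1 / 2 : ℂ) • (α.avg fr s n b +
    Complex.exp ((-(s * (Real.pi / (fr n - s))) : ℝ) * Complex.I) •
      α.toFun (Real.pi / (fr n - s)) (α.avg fr s n b)) := rfl

theorem norm_avg_le (n : ℕ) (b : B) : ‖α.avg fr s n b‖ ≤ ‖b‖ := by
  induction n with
  | zero => exact le_rfl
  | succ n ih =>
    rw [avg_succ_apply, norm_smul]
    have h1 := norm_add_le (α.avg fr s n b)
      (Complex.exp ((-(s * (Real.pi / (fr n - s))) : ℝ) * Complex.I) •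
      α.toFun (Real.pi / (fr n - s)) (α.avg fr s n b))
    rw [norm_smul, Complex.norm_exp_ofReal_mul_I, one_mul] at h1
    have h2 := norm_apply_le (α := α) (Real.pi / (fr n - s)) (α.avg fr s n b)
    have h3 : ‖(1 / 2 : ℂ)‖ = 1 / 2 := by norm_num
    rw [h3]
    linarith

theorem IsEigen.avg_same {b : B} (hb : α.IsEigen s b) (n : ℕ) : α.avg fr s n b = b := by
  induction n with
  | zero => rfl
  | succ n ih =>
    rw [avg_succ_apply, ih, hb, smul_smul, ← Complex.exp_add, ← add_mul, ← Complex.ofReal_add,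
      neg_add_cancel, Complex.ofReal_zero, zero_mul, Complex.exp_zero, one_smul, ← two_smul ℂ b,
      smul_smul]
    norm_num

theorem IsEigen.avg {f : ℝ} {b : B} (hb : α.IsEigen f b) (n : ℕ) :
    α.IsEigen f (α.avg fr s n b) := by
  induction n with
  | zero => exact hb
  | succ n ih =>
    rw [avg_succ_apply, ih]
    exact (ih.add ((ih.smul _).smul _)).smul _

theorem IsEigen.avg_eq_zero {i : ℕ} (hi : fr i ≠ s) {b : B} (hb : α.IsEigen (fr i) b) {n : ℕ}
    (hn : i < n) : α.avg fr s n b = 0 := by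
  induction n with
  | zero => omega
  | succ n ih =>
    rw [avg_succ_apply]
    rcases Nat.lt_succ_iff_lt_or_eq.1 hn with h | rfl
    · rw [ih h]
      simp
    · rw [(hb.avg i) _, smul_smul, ← Complex.exp_add, ← add_mul, ← Complex.ofReal_add]
      have : -(s * (Real.pi / (fr i - s))) + fr i * (Real.pi / (fr i - s)) = Real.pi := by
        have := sub_ne_zero.2 hi
        field_simp
        ring
      rw [this, Complex.exp_pi_mul_I, neg_one_smul, add_neg_cancel, smul_zero]

/-- Scalar multiples of eigenvectors are eigenvectors, so closedness and additivity suffice and no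
hypothesis on scalars is needed. -/
theorem PurePoint.induction (h : α.PurePoint fr) {p : B → Prop} (hcl : IsClosed {b | p b})
    (heig : ∀ i b, α.IsEigen (fr i) b → p b) (hadd : ∀ a b, p a → p b → p (a + b)) (b : B) :
    p b := by
  have hsub : ∀ b ∈ Submodule.span ℂ {b | ∃ i, α.IsEigen (fr i) b}, p b := by
    intro b hb
    induction hb using Submodule.closure_induction with
    | zero => exact heig 0 0 (isEigen_zero _)
    | add a b _ _ ha hb => exact hadd a b ha hb
    | smul_mem c b hb =>
      obtain ⟨i, hb⟩ := hb
      exact heig i _ (hb.smul c)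
  exact hcl.closure_subset_iff.2 (fun b hb => hsub b hb) (h b)

/-- On an eigenvector the averages are eventually constant. They are contractions, so the Cauchy
property passes to the closed span. -/
theorem PurePoint.exists_tendsto_avg (h : α.PurePoint fr) (s : ℝ) (b : B) :
    ∃ l, Tendsto (fun n => α.avg fr s n b) atTop (𝓝 l) := by
  suffices hc : CauchySeq fun n => α.avg fr s n b from cauchySeq_tendsto_of_complete hc
  refine h.induction (p := fun b => CauchySeq fun n => α.avg fr s n b) ?_ ?_ ?_ b
  · refine isClosed_of_closure_subset fun b hb => ?_
    refine Metric.cauchySeq_iff.2 fun ε hε => ?_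
    obtain ⟨c, hc, hd⟩ := Metric.mem_closure_iff.1 hb (ε / 3) (by positivity)
    obtain ⟨N, hN⟩ := Metric.cauchySeq_iff.1 hc (ε / 3) (by positivity)
    refine ⟨N, fun m hm n hn => ?_⟩
    have h1 := hN m hm n hn
    have h2 : ∀ k, dist (α.avg fr s k b) (α.avg fr s k c) < ε / 3 := fun k => by
      rw [dist_eq_norm, ← map_sub]
      rw [dist_eq_norm] at hd
      exact (norm_avg_le _ _).trans_lt hd
    have h3 := dist_triangle4 (α.avg fr s m b) (α.avg fr s m c) (α.avg fr s n c) (α.avg fr s n b)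
    have h4 := h2 n
    rw [dist_comm] at h4
    linarith [h2 m]
  · intro i b hb
    by_cases hi : fr i = s
    · rw [hi] at hb
      simp only [hb.avg_same]
      exact cauchySeq_const b
    · refine (tendsto_const_nhds (x := (0 : B))).congr' ?_ |>.cauchySeq
      exact (eventually_gt_atTop i).mono fun n hn => (hb.avg_eq_zero hi hn).symm
  · intro a b ha hb
    simp only [_root_.map_add]
    exact ha.add hb

/-- The projection onto the eigenvectors of frequency `s`. -/
noncomputable def PurePoint.proj (h : α.PurePoint fr) (s : ℝ) : B →L[ℂ] B :=
  LinearMap.mkContinuous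
    { toFun := fun b => (h.exists_tendsto_avg s b).choose
      map_add' := fun a b => tendsto_nhds_unique (h.exists_tendsto_avg s (a + b)).choose_spec (by
        simpa only [_root_.map_add] using (h.exists_tendsto_avg s a).choose_spec.add
          (h.exists_tendsto_avg s b).choose_spec)
      map_smul' := fun c b => tendsto_nhds_unique (h.exists_tendsto_avg s (c • b)).choose_spec (by
        simpa only [map_smul, RingHom.id_apply] using
          (h.exists_tendsto_avg s b).choose_spec.const_smul c) } 1
    fun b => by
      rw [one_mul]
      exact le_of_tendsto' (h.exists_tendsto_avg s b).choose_spec.norm fun n => norm_avg_le n b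

variable (h : α.PurePoint fr)
include h

theorem PurePoint.tendsto_avg (s : ℝ) (b : B) :
    Tendsto (fun n => α.avg fr s n b) atTop (𝓝 (h.proj s b)) :=
  (h.exists_tendsto_avg s b).choose_spec

theorem PurePoint.norm_proj_le (s : ℝ) (b : B) : ‖h.proj s b‖ ≤ ‖b‖ :=
  le_of_tendsto' (h.tendsto_avg s b).norm fun n => norm_avg_le n b

theorem IsEigen.proj_same {b : B} (hb : α.IsEigen s b) : h.proj s b = b :=
  tendsto_nhds_unique (h.tendsto_avg s b) (by simpa only [hb.avg_same] using tendsto_const_nhds)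

theorem PurePoint.proj_fr (i : ℕ) {b : B} (hb : α.IsEigen (fr i) b) :
    h.proj s b = if fr i = s then b else 0 := by
  split_ifs with hi
  · rw [hi] at hb
    exact hb.proj_same h
  · refine tendsto_nhds_unique (h.tendsto_avg s b) (tendsto_const_nhds.congr' ?_)
    exact (eventually_gt_atTop i).mono fun n hn => (hb.avg_eq_zero hi hn).symm

theorem PurePoint.isEigen_proj (s : ℝ) (b : B) : α.IsEigen s (h.proj s b) := by
  refine h.induction (p := fun b => α.IsEigen s (h.proj s b)) ?_ ?_ ?_ b
  · exact (isClosed_isEigen s).preimage (h.proj s).continuous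
  · intro i b hb
    rw [h.proj_fr i hb]
    split_ifs with hi
    · rwa [← hi]
    · exact isEigen_zero s
  · intro a b ha hb
    rw [_root_.map_add]
    exact ha.add hb

theorem PurePoint.proj_apply (s t : ℝ) (b : B) :
    h.proj s (α.toFun t b) = Complex.exp ((s * t : ℝ) * Complex.I) • h.proj s b := by
  refine h.induction (p := fun b => h.proj s (α.toFun t b) =
    Complex.exp ((s * t : ℝ) * Complex.I) • h.proj s b) ?_ ?_ ?_ b
  · exact isClosed_eq ((h.proj s).continuous.comp (continuous_toFun t))
      ((h.proj s).continuous.const_smul _)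
  · intro i b hb
    rw [hb t, map_smul, h.proj_fr i hb]
    split_ifs with hi
    · rw [hi]
    · simp
  · intro a b ha hb
    rw [_root_.map_add, _root_.map_add, _root_.map_add, ha, hb, smul_add]

/-- Here f need not belong to the enumeration `fr`. Applying the flow at time π / (f - s) multiplies
the projection by two phases that differ by a sign, so the projection vanishes. -/
theorem IsEigen.proj_eq_zero {f : ℝ} {b : B} (hb : α.IsEigen f b) (hf : f ≠ s) :
    h.proj s b = 0 := by
  have h1 := h.proj_apply s (Real.pi / (f - s)) b
  rw [hb, map_smul] at h1
  have h2 : f * (Real.pi / (f - s)) = s * (Real.pi / (f - s)) + Real.pi := by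
    have := sub_ne_zero.2 hf
    field_simp
    ring
  rw [h2, Complex.ofReal_add, add_mul, Complex.exp_add, Complex.exp_pi_mul_I, mul_neg_one,
    neg_smul, neg_eq_iff_add_eq_zero, ← two_smul ℂ, smul_smul, smul_eq_zero] at h1
  exact h1.resolve_left (mul_ne_zero two_ne_zero (Complex.exp_ne_zero _))

theorem IsEigen.proj_eq {f : ℝ} {b : B} (hb : α.IsEigen f b) (s : ℝ) :
    h.proj s b = if f = s then b else 0 := by
  split_ifs with hf
  · subst hf
    exact hb.proj_same h
  · exact hb.proj_eq_zero h hf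

theorem IsEigen.proj_mul_left {f : ℝ} {x : B} (hx : α.IsEigen f x) (s : ℝ) (b : B) :
    h.proj s (x * b) = x * h.proj (s - f) b := by
  refine h.induction (p := fun b => h.proj s (x * b) = x * h.proj (s - f) b) ?_ ?_ ?_ b
  · exact isClosed_eq ((h.proj s).continuous.comp (continuous_const_mul x))
      ((h.proj _).continuous.const_mul x)
  · intro i b hb
    rw [(hx.mul hb).proj_eq h, hb.proj_eq h]
    by_cases hi : f + fr i = s
    · rw [if_pos hi, if_pos (by linarith)]
    · rw [if_neg hi, if_neg (fun h' => hi (by linarith)), mul_zero]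
  · intro a b ha hb
    rw [mul_add, _root_.map_add, _root_.map_add, ha, hb, mul_add]

theorem PurePoint.proj_star (s : ℝ) (b : B) : h.proj s (star b) = star (h.proj (-s) b) := by
  refine h.induction (p := fun b => h.proj s (star b) = star (h.proj (-s) b)) ?_ ?_ ?_ b
  · exact isClosed_eq ((h.proj s).continuous.comp continuous_star) (h.proj _).continuous.star
  · intro i b hb
    rw [hb.conj.proj_eq h, hb.proj_eq h]
    by_cases hi : fr i = -s
    · rw [if_pos hi, if_pos (by linarith)]
    · rw [if_neg hi, if_neg (fun h' => hi (by linarith)), star_zero]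
  · intro a b ha hb
    rw [star_add, _root_.map_add, _root_.map_add, ha, hb, star_add]

theorem PurePoint.proj_zero_star_proj_mul (s : ℝ) (b c : B) :
    h.proj 0 (star (h.proj s b) * c) = star (h.proj s b) * h.proj s c := by
  rw [(h.isEigen_proj s b).conj.proj_mul_left h, zero_sub, neg_neg]

theorem PurePoint.proj_sum_proj (F : Finset ℝ) {s : ℝ} (hs : s ∈ F) (b : B) :
    h.proj s (∑ s' ∈ F, h.proj s' b) = h.proj s b := by
  rw [map_sum, Finset.sum_eq_single_of_mem s hs, (h.isEigen_proj s b).proj_same h]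
  intro s' _ hne
  exact (h.isEigen_proj s' b).proj_eq_zero h hne

/-- Pythagoras with the fixed-point projection as inner product: for the partial sum q of the
components, the three terms q*b, b*q and q*q all project to the same sum of squares. -/
theorem PurePoint.proj_zero_star_mul_self (F : Finset ℝ) (b : B) :
    h.proj 0 (star b * b) = ∑ s ∈ F, star (h.proj s b) * h.proj s b +
      h.proj 0 (star (b - ∑ s ∈ F, h.proj s b) * (b - ∑ s ∈ F, h.proj s b)) := by
  set q := ∑ s ∈ F, h.proj s b with hq
  set S := ∑ s ∈ F, star (h.proj s b) * h.proj s b with hS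
  have h1 : h.proj 0 (star q * b) = S := by
    rw [hq, star_sum, Finset.sum_mul, map_sum]
    exact Finset.sum_congr rfl fun s _ => h.proj_zero_star_proj_mul s b b
  have h2 : h.proj 0 (star q * q) = S := by
    conv_lhs => rw [hq, star_sum, Finset.sum_mul, map_sum]
    refine Finset.sum_congr rfl fun s hs => ?_
    rw [h.proj_zero_star_proj_mul, h.proj_sum_proj F hs]
  have h3 : h.proj 0 (star b * q) = S := by
    have := h.proj_star 0 (star q * b)
    rw [neg_zero, h1, star_mul, star_star] at this
    rw [this, hS, star_sum]
    simp
  rw [star_sub, sub_mul, mul_sub, mul_sub, map_sub, map_sub, map_sub, h1, h2, h3]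
  abel

/-- Elements of the algebraic span have finitely many components. Allowing every larger set G lets
two elements be treated over the union of their sets. -/
theorem PurePoint.exists_eq_sum_proj {b : B}
    (hb : b ∈ Submodule.span ℂ {b | ∃ i, α.IsEigen (fr i) b}) :
    ∃ F : Finset ℝ, ∀ G, F ⊆ G → b = ∑ s ∈ G, h.proj s b := by
  classical
  induction hb using Submodule.closure_induction with
  | zero => exact ⟨∅, fun G _ => by simp⟩
  | add a b _ _ ha hb =>
    obtain ⟨F, hF⟩ := ha
    obtain ⟨F', hF'⟩ := hb
    refine ⟨F ∪ F', fun G hG => ?_⟩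
    simp only [_root_.map_add, Finset.sum_add_distrib]
    rw [← hF G (Finset.union_subset_left hG), ← hF' G (Finset.union_subset_right hG)]
  | smul_mem c b hb =>
    obtain ⟨i, hb⟩ := hb
    refine ⟨{fr i}, fun G hG => ?_⟩
    rw [Finset.singleton_subset_iff] at hG
    rw [Finset.sum_eq_single_of_mem _ hG, (hb.smul c).proj_same h]
    intro s _ hs
    exact (hb.smul c).proj_eq_zero h hs.symm

end PurePoint

/-! ### Positivity and invariant weights -/

section Order

variable {B : Type*} [NonUnitalCStarAlgebra B] [PartialOrder B] [StarOrderedRing B]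
  {α : CStarFlow B} {fr : ℕ → ℝ}

theorem avg_zero_nonneg (n : ℕ) {b : B} (hb : 0 ≤ b) : 0 ≤ α.avg fr 0 n b := by
  induction n with
  | zero => exact hb
  | succ n ih =>
    have h1 : (1 / 2 : ℂ) = ((1 / 2 : ℝ) : ℂ) := by norm_num
    rw [avg_succ_apply, h1, Complex.coe_smul]
    simp only [zero_mul, neg_zero, Complex.ofReal_zero, Complex.exp_zero, one_smul]
    exact smul_nonneg (by norm_num) (add_nonneg ih (map_nonneg (α.toFun _) ih))

/-- At frequency 0 the averages are convex combinations of flow translates, so an invariant weight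
is preserved exactly. In the limit, lower semicontinuity retains only an inequality. -/
theorem val_avg_zero {φ : CStarWeight B}
    (hφ : ∀ t b, 0 ≤ b → φ.val (α.toFun t b) = φ.val b) (n : ℕ) {b : B} (hb : 0 ≤ b) :
    φ.val (α.avg fr 0 n b) = φ.val b := by
  induction n with
  | zero => rfl
  | succ n ih =>
    have h1 : (1 / 2 : ℂ) = ((1 / 2 : ℝ) : ℂ) := by norm_num
    have h2 := avg_zero_nonneg (α := α) (fr := fr) n hb
    rw [avg_succ_apply, h1, Complex.coe_smul]
    simp only [zero_mul, neg_zero, Complex.ofReal_zero, Complex.exp_zero, one_smul]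
    rw [φ.val_smul (by norm_num) (add_nonneg h2 (map_nonneg (α.toFun _) h2)),
      φ.val_add h2 (map_nonneg (α.toFun _) h2), hφ _ _ h2, ih, ← two_mul, ← mul_assoc]
    have : ENNReal.ofReal (1 / 2) * 2 = 1 := by
      rw [← ENNReal.ofReal_ofNat, ← ENNReal.ofReal_mul (by norm_num)]
      norm_num
    rw [this, one_mul]

theorem PurePoint.proj_zero_nonneg (h : α.PurePoint fr) {b : B} (hb : 0 ≤ b) :
    0 ≤ h.proj 0 b :=
  ge_of_tendsto' (h.tendsto_avg 0 b) fun n => avg_zero_nonneg n hb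

theorem PurePoint.val_proj_zero_le (h : α.PurePoint fr) {φ : CStarWeight B}
    (hlsc : LowerSemicontinuous φ.toFun)
    (hφ : ∀ t b, 0 ≤ b → φ.val (α.toFun t b) = φ.val b) {b : B} (hb : 0 ≤ b) :
    φ.val (h.proj 0 b) ≤ φ.val b :=
  CStarWeight.val_le_of_tendsto hlsc (fun n => avg_zero_nonneg n hb) (h.tendsto_avg 0 b)
    fun n => (val_avg_zero hφ n hb).le

/-- Parseval's identity for bounded additive functions on the positive cone which are invariant
under the projection onto the fixed point algebra. -/
theorem PurePoint.tsum_proj_eq (h : α.PurePoint fr) {ω : B → ℝ≥0∞} {C : ℝ≥0}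
    (hadd : ∀ a b, 0 ≤ a → 0 ≤ b → ω (a + b) = ω a + ω b)
    (hbdd : ∀ a, 0 ≤ a → ω a ≤ C * ENNReal.ofReal ‖a‖)
    (hproj : ∀ a, 0 ≤ a → ω (h.proj 0 a) = ω a) (b : B) :
    ∑' s : ℝ, ω (star (h.proj s b) * h.proj s b) = ω (star b * b) := by
  have h0 : ω 0 = 0 := by simpa using hbdd 0 le_rfl
  have hsum : ∀ F : Finset ℝ, ω (∑ s ∈ F, star (h.proj s b) * h.proj s b) =
      ∑ s ∈ F, ω (star (h.proj s b) * h.proj s b) := by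
    classical
    intro F
    induction F using Finset.induction_on with
    | empty => simpa using h0
    | insert i s hi ih =>
      rw [Finset.sum_insert hi, Finset.sum_insert hi, hadd _ _ (star_mul_self_nonneg _)
        (Finset.sum_nonneg fun _ _ => star_mul_self_nonneg _), ih]
  have hS : ∀ F : Finset ℝ, 0 ≤ ∑ s ∈ F, star (h.proj s b) * h.proj s b := fun F =>
    Finset.sum_nonneg fun _ _ => star_mul_self_nonneg _
  refine le_antisymm ?_ ?_
  · rw [ENNReal.tsum_eq_iSup_sum]
    refine iSup_le fun F => ?_
    rw [← hsum, ← hproj (star b * b) (star_mul_self_nonneg b), h.proj_zero_star_mul_self F b,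
      hadd _ _ (hS F) (h.proj_zero_nonneg (star_mul_self_nonneg _))]
    exact le_self_add
  -- Approximate b by p in the span within δ. If F contains all frequencies of p, the remainder in
  -- Pythagoras depends only on c = b - p, and ω of it is at most Cδ² ≤ ε.
  · refine ENNReal.le_of_forall_pos_le_add fun ε hε _ => ?_
    obtain ⟨δ, hδ, hδε⟩ : ∃ δ : ℝ, 0 < δ ∧ C * δ ^ 2 ≤ ε := by
      refine ⟨√(ε / (C + 1)), Real.sqrt_pos.2 (by positivity), ?_⟩
      rw [Real.sq_sqrt (by positivity), mul_div_assoc', div_le_iff₀ (by positivity)]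
      nlinarith [C.2, (NNReal.coe_pos.2 hε)]
    obtain ⟨p, hp, hd⟩ := Metric.mem_closure_iff.1 (h b) δ hδ
    obtain ⟨F, hF⟩ := h.exists_eq_sum_proj hp
    have hF := hF F le_rfl
    set c := b - p with hc
    have h1 : b - ∑ s ∈ F, h.proj s b = c - ∑ s ∈ F, h.proj s c := by
      rw [hc]
      simp only [map_sub, Finset.sum_sub_distrib]
      rw [← hF]
      abel
    have h2 := h.proj_zero_star_mul_self F b
    have h3 := h.proj_zero_star_mul_self F c
    have hc0 : 0 ≤ h.proj 0 (star c * c) := h.proj_zero_nonneg (star_mul_self_nonneg _)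
    have hr0 : 0 ≤ h.proj 0 (star (c - ∑ s ∈ F, h.proj s c) * (c - ∑ s ∈ F, h.proj s c)) :=
      h.proj_zero_nonneg (star_mul_self_nonneg _)
    have h4 : ω (h.proj 0 (star (c - ∑ s ∈ F, h.proj s c) * (c - ∑ s ∈ F, h.proj s c))) ≤ ε := by
      calc _ ≤ ω (h.proj 0 (star c * c)) := by
            rw [h3, hadd _ _ (Finset.sum_nonneg fun _ _ => star_mul_self_nonneg _) hr0]
            exact le_add_self
        _ ≤ C * ENNReal.ofReal ‖h.proj 0 (star c * c)‖ := hbdd _ hc0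
        _ ≤ C * ENNReal.ofReal (δ ^ 2) := by
            gcongr
            refine (h.norm_proj_le 0 _).trans ?_
            rw [CStarRing.norm_star_mul_self, ← sq]
            rw [dist_eq_norm] at hd
            gcongr
        _ ≤ ε := by
            rw [← ENNReal.ofReal_coe_nnreal, ← ENNReal.ofReal_mul NNReal.zero_le_coe,
              ← ENNReal.ofReal_coe_nnreal]
            exact ENNReal.ofReal_le_ofReal hδε
    rw [← hproj (star b * b) (star_mul_self_nonneg b), h2, h1, hadd _ _ (hS F) hr0, hsum]
    gcongr
    exact ENNReal.sum_le_tsum F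

end Order

/-! ### Entire elements -/

section Entire

variable {B : Type*} [NonUnitalCStarAlgebra B] {α : CStarFlow B} {fr : ℕ → ℝ}

theorem eq_of_eq_ofReal {f g : ℂ → B} (hf : Differentiable ℂ f) (hg : Differentiable ℂ g)
    (h : ∀ t : ℝ, f t = g t) : f = g := by
  have hf' : AnalyticOnNhd ℂ f Set.univ := fun z _ => hf.analyticAt z
  have hg' : AnalyticOnNhd ℂ g Set.univ := fun z _ => hg.analyticAt z
  refine hf'.eq_of_frequently_eq hg' (z₀ := 0) ?_
  -- Real points accumulating at 0, as the identity theorem requires.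
  have h1 : Tendsto (fun n : ℕ => ((1 / ((n : ℝ) + 1) : ℝ) : ℂ)) atTop (𝓝[≠] 0) := by
    refine tendsto_nhdsWithin_iff.2 ⟨?_, Eventually.of_forall fun n => ?_⟩
    · rw [← Complex.ofReal_zero]
      exact (Complex.continuous_ofReal.tendsto 0).comp tendsto_one_div_add_atTop_nhds_zero_nat
    · rw [Set.mem_compl_singleton_iff, Ne, Complex.ofReal_eq_zero]
      positivity
  exact h1.frequently (Frequently.of_forall fun n => h _)

theorem extend_eq {b : B} {f : ℂ → B} (hf : Differentiable ℂ f) (h : ∀ t : ℝ, f t = α.toFun t b)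
    (z : ℂ) : α.extend z b = f z := by
  have hb : α.IsEntire b := ⟨f, hf, h⟩
  have := eq_of_eq_ofReal (α.differentiable_extend hb) hf fun t => by
    rw [α.extend_ofReal hb, h]
  exact congrFun this z

theorem IsEigen.hasExtension {s : ℝ} {b : B} (hb : α.IsEigen s b) :
    (Differentiable ℂ fun z : ℂ => Complex.exp (s * z * Complex.I) • b) ∧
      ∀ t : ℝ, Complex.exp (s * (t : ℂ) * Complex.I) • b = α.toFun t b := by
  refine ⟨?_, fun t => ?_⟩
  · intro z
    fun_prop
  · rw [hb t]
    push_cast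
    rfl

theorem IsEigen.isEntire {s : ℝ} {b : B} (hb : α.IsEigen s b) : α.IsEntire b :=
  ⟨_, hb.hasExtension.1, hb.hasExtension.2⟩

theorem IsEigen.extend_eq {s : ℝ} {b : B} (hb : α.IsEigen s b) (z : ℂ) :
    α.extend z b = Complex.exp (s * z * Complex.I) • b :=
  CStarFlow.extend_eq hb.hasExtension.1 hb.hasExtension.2 z

/-- Both sides are entire in z and agree for real z. -/
theorem PurePoint.proj_extend (h : α.PurePoint fr) (s : ℝ) {b : B} (hb : α.IsEntire b) (z : ℂ) :
    h.proj s (α.extend z b) = Complex.exp (s * z * Complex.I) • h.proj s b := by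
  have hd := (h.proj s).differentiable.comp (α.differentiable_extend hb)
  refine congrFun (eq_of_eq_ofReal hd (h.isEigen_proj s b).hasExtension.1 fun t => ?_) z
  rw [(h.isEigen_proj s b).hasExtension.2, Function.comp_apply, α.extend_ofReal hb,
    h.proj_apply, h.isEigen_proj]

end Entire
end CStarFlow
end ToeplitzKMS

namespace ToeplitzKMS

/-! ### Elements of finite weight, polarization, and continuity of compressed weights. -/

namespace CStarWeight

variable {B : Type*} [NonUnitalCStarAlgebra B] [PartialOrder B] [StarOrderedRing B]

/-- The weight with given values on the positive cone. -/
noncomputable def ofVal (f : B → ℝ≥0∞) (h0 : f 0 = 0)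
    (hadd : ∀ a b, 0 ≤ a → 0 ≤ b → f (a + b) = f a + f b)
    (hsmul : ∀ (r : ℝ) (a : B), 0 ≤ r → 0 ≤ a → f (r • a) = ENNReal.ofReal r * f a) :
    CStarWeight B where
  toFun b := f b.1
  map_zero := h0
  map_add a b := hadd _ _ a.2 b.2
  map_smul r a := (hsmul r a.1 r.2 a.2).trans (by rw [ENNReal.ofReal_coe_nnreal])

theorem val_ofVal {f : B → ℝ≥0∞} {h0 hadd hsmul} {b : B} (hb : 0 ≤ b) :
    (ofVal f h0 hadd hsmul).val b = f b := val_of_nonneg _ hb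

theorem star_add_mul_add_le (u v : B) :
    star (u + v) * (u + v) ≤ 2 • (star u * u) + 2 • (star v * v) := by
  have h : 2 • (star u * u) + 2 • (star v * v) =
      star (u + v) * (u + v) + star (u - v) * (u - v) := by
    simp only [star_add, star_sub]
    noncomm_ring
  rw [h]
  exact le_add_of_nonneg_right (star_mul_self_nonneg _)

theorem val_star_add_mul_add_lt_top {φ : CStarWeight B} {u v : B} (hu : φ.val (star u * u) < ∞)
    (hv : φ.val (star v * v) < ∞) : φ.val (star (u + v) * (u + v)) < ∞ := by
  refine (φ.val_mono (star_mul_self_nonneg _) (star_add_mul_add_le u v)).trans_lt ?_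
  have hu0 := star_mul_self_nonneg u
  have hv0 := star_mul_self_nonneg v
  rw [φ.val_add (nsmul_nonneg hu0 2) (nsmul_nonneg hv0 2), φ.val_nsmul 2 hu0, φ.val_nsmul 2 hv0]
  exact ENNReal.add_lt_top.2 ⟨ENNReal.mul_lt_top (by simp) hu, ENNReal.mul_lt_top (by simp) hv⟩

omit [PartialOrder B] [StarOrderedRing B] in
theorem polarization (x y : B) : star x * y = (1 / 4 : ℂ) • (star (y + x) * (y + x) +
    Complex.I • (star (y + Complex.I • x) * (y + Complex.I • x)) -
    star (y - x) * (y - x) - Complex.I • (star (y - Complex.I • x) * (y - Complex.I • x))) := by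
  have hI : star Complex.I = -Complex.I := by simp
  simp only [star_add, star_sub, star_smul, hI, mul_add, add_mul, mul_sub, sub_mul,
    smul_mul_assoc, mul_smul_comm, smul_add, smul_sub, smul_smul]
  match_scalars <;> ring_nf <;> norm_num

/-- The polarization identity writes x*y through four squares, each of finite weight by the
parallelogram inequality. -/
theorem star_mul_mem_finiteSpan {φ : CStarWeight B} {x y : B} (hx : φ.val (star x * x) < ∞)
    (hy : φ.val (star y * y) < ∞) : star x * y ∈ φ.finiteSpan := by
  have hmem : ∀ u : B, φ.val (star u * u) < ∞ → star u * u ∈ φ.finiteSpan := fun u hu =>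
    Submodule.subset_span ⟨star_mul_self_nonneg u, by rwa [toFun_eq_val]⟩
  have hI : φ.val (star (Complex.I • x) * (Complex.I • x)) < ∞ := by
    rwa [StdModule.star_smul_mul_smul (by simp)]
  have hneg : ∀ u : B, φ.val (star u * u) < ∞ → φ.val (star (-u) * (-u)) < ∞ := fun u hu => by
    rwa [star_neg, neg_mul_neg]
  rw [polarization x y]
  refine Submodule.smul_mem _ _ (sub_mem (sub_mem (add_mem ?_ (Submodule.smul_mem _ _ ?_)) ?_)
    (Submodule.smul_mem _ _ ?_))
  · exact hmem _ (val_star_add_mul_add_lt_top hy hx)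
  · exact hmem _ (val_star_add_mul_add_lt_top hy hI)
  · rw [sub_eq_add_neg]
    exact hmem _ (val_star_add_mul_add_lt_top hy (hneg _ hx))
  · rw [sub_eq_add_neg]
    exact hmem _ (val_star_add_mul_add_lt_top hy (hneg _ hI))

/-- A compression by an element with φ(e*e) finite is norm continuous, so a constant value along a
convergent sequence is kept in the limit. -/
theorem val_conj_tendsto_unique {φ : CStarWeight B} {e : B} (he : φ.val (star e * e) < ∞)
    {f : ℕ → B} {b : B} (hf : ∀ n, 0 ≤ f n) (hb : Tendsto f atTop (𝓝 b)) {c : ℝ≥0∞}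
    (hc : ∀ n, φ.val (star e * f n * e) = c) : φ.val (star e * b * e) = c := by
  have hb0 : 0 ≤ b := ge_of_tendsto' hb hf
  have h0 : Tendsto (fun n => ENNReal.ofReal ‖f n - b‖ * φ.val (star e * e)) atTop (𝓝 0) := by
    have h1 : Tendsto (fun n => ENNReal.ofReal ‖f n - b‖) atTop (𝓝 0) := by
      have := (tendsto_iff_norm_sub_tendsto_zero.1 hb)
      simpa using ENNReal.tendsto_ofReal this
    simpa using ENNReal.Tendsto.mul_const h1 (Or.inr he.ne)
  refine le_antisymm ?_ ?_
  · have h1 := h0.const_add c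
    rw [add_zero] at h1
    refine ge_of_tendsto' h1 fun n => ?_
    have := φ.val_conj_le_add e hb0 (hf n)
    rwa [hc, norm_sub_rev] at this
  · have h1 := h0.const_add (φ.val (star e * b * e))
    rw [add_zero] at h1
    refine ge_of_tendsto' h1 fun n => ?_
    have := φ.val_conj_le_add e (hf n) hb0
    rwa [hc] at this

end CStarWeight

theorem map_sqrt {B C : Type*} [NonUnitalCStarAlgebra B] [PartialOrder B] [StarOrderedRing B]
    [NonUnitalCStarAlgebra C] [PartialOrder C] [StarOrderedRing C] (j : B →⋆ₙₐ[ℂ] C) {b : B}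
    (hb : 0 ≤ b) : j (CFC.sqrt b) = CFC.sqrt (j b) := by
  symm
  rw [CFC.sqrt_eq_iff _ _ (map_nonneg j hb) (map_nonneg j (CFC.sqrt_nonneg b)), ← map_mul,
    CFC.sqrt_mul_sqrt_self b hb]

/-! ### The KMS condition for eigenvectors. -/

namespace CStarFlow

variable {B : Type*} [NonUnitalCStarAlgebra B] [PartialOrder B] [StarOrderedRing B]
  {α : CStarFlow B} {fr : ℕ → ℝ} {β : ℝ} {φ : CStarWeight B}

theorem IsEigen.res_fixed {r : B} (hr0 : 0 ≤ r) (hr : α.IsEigen 0 r) : α.IsEigen 0 (res r) := by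
  rw [isEigen_zero_iff] at hr ⊢
  intro t
  rw [map_res _ hr0, hr]

theorem IsEigen.sqrt_fixed {r : B} (hr0 : 0 ≤ r) (hr : α.IsEigen 0 r) :
    α.IsEigen 0 (CFC.sqrt r) := by
  rw [isEigen_zero_iff] at hr ⊢
  intro t
  rw [map_sqrt _ hr0, hr]

omit [PartialOrder B] [StarOrderedRing B] in
theorem IsEigen.mul_star_fixed {s : ℝ} {b : B} (hb : α.IsEigen s b) :
    α.IsEigen 0 (b * star b) := by
  simpa using hb.mul hb.conj

/-- The extended flow acts on an eigenvector by a nonzero scalar, so a multiple of b serves as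
preimage at every z. -/
theorem IsEigen.mem_kmsDomain {s : ℝ} {b : B} (hb : α.IsEigen s b) (hf : b ∈ φ.finiteSpan) :
    b ∈ α.kmsDomain φ := by
  refine Set.mem_iInter.2 fun z => ⟨Complex.exp (-(s * z * Complex.I)) • b,
    ⟨(hb.smul _).isEntire, Submodule.smul_mem _ _ hf⟩, ?_⟩
  rw [(hb.smul _).extend_eq, smul_smul, ← Complex.exp_add, add_neg_cancel, Complex.exp_zero,
    one_smul]

theorem IsKMSWeight.invariant_val (hK : α.IsKMSWeight β φ) (t : ℝ) (b : B) (hb : 0 ≤ b) :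
    φ.val (α.toFun t b) = φ.val b := by
  rw [φ.val_of_nonneg hb, φ.val_of_nonneg (map_nonneg _ hb)]
  exact hK.invariant t ⟨b, hb⟩

-- At z = -iβ/2 the phase e^{isz} becomes the positive real e^{βs/2}, whose square is the KMS
-- factor.
omit [PartialOrder B] [StarOrderedRing B] in
theorem exp_smul_mul_star (s β : ℝ) (b : B) :
    (Complex.exp (s * (-(Complex.I * β / 2)) * Complex.I) • b) *
      star (Complex.exp (s * (-(Complex.I * β / 2)) * Complex.I) • b) =
      Real.exp (β * s) • (b * star b) := by
  have h1 : Complex.exp (s * (-(Complex.I * β / 2)) * Complex.I) =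
      ((Real.exp (β * s / 2) : ℝ) : ℂ) := by
    rw [Complex.ofReal_exp]
    congr 1
    push_cast
    linear_combination (-(s * β / 2 : ℂ)) * Complex.I_mul_I
  rw [h1, Complex.coe_smul, star_smul, star_trivial, smul_mul_smul_comm, ← Real.exp_add]
  congr 2
  ring

theorem IsKMSWeight.val_of_mem_finiteSpan (hK : α.IsKMSWeight β φ) {s : ℝ} {b : B}
    (hb : α.IsEigen s b) (hf : b ∈ φ.finiteSpan) :
    φ.val (star b * b) = ENNReal.ofReal (Real.exp (β * s)) * φ.val (b * star b) := by
  have h := hK.kms b (hb.mem_kmsDomain hf)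
  rw [CStarWeight.toFun_eq_val, CStarWeight.toFun_eq_val, hb.extend_eq] at h
  refine h.trans ((congrArg φ.val (exp_smul_mul_star s β b)).trans ?_)
  rw [φ.val_smul (Real.exp_pos _).le (mul_star_self_nonneg b)]

/-- The element bb* is fixed. A finite-weight element near it is projected to the fixed points,
which stays as close to bb* and does not raise the weight, and `res` of a large multiple is the
wanted g. -/
theorem PurePoint.exists_fixed_unit (h : α.PurePoint fr) (hφ : φ.IsProper)
    (hinv : ∀ t b, 0 ≤ b → φ.val (α.toFun t b) = φ.val b) {s : ℝ} {b : B}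
    (hb : α.IsEigen s b) {ε : ℝ} (hε : 0 < ε) :
    ∃ g, α.IsEigen 0 g ∧ 0 ≤ g ∧ ‖g‖ ≤ 1 ∧ φ.val g < ∞ ∧ ‖b - g * b‖ < ε := by
  obtain ⟨n, hn⟩ := exists_nat_gt (2 / ε ^ 2)
  have hn0 : 0 < (n : ℝ) := lt_trans (by positivity) hn
  have hn0' : 0 < n := by exact_mod_cast hn0
  obtain ⟨c', hc', hfin, hd⟩ := hφ.denselyDefined (b * star b) (mul_star_self_nonneg b)
    (ε ^ 2 / 8) (by positivity)
  set c := h.proj 0 c' with hc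
  have hc0 : 0 ≤ c := h.proj_zero_nonneg hc'
  have hcfin : φ.val c < ∞ :=
    (h.val_proj_zero_le hφ.lowerSemicontinuous hinv hc').trans_lt hfin
  have hce : α.IsEigen 0 c := h.isEigen_proj 0 c'
  have hcd : ‖b * star b - c‖ < ε ^ 2 / 8 := by
    have : b * star b - c = h.proj 0 (b * star b - c') := by
      rw [map_sub, hb.mul_star_fixed.proj_same h]
    rw [this]
    rw [norm_sub_rev] at hd
    exact (h.norm_proj_le _ _).trans_lt hd
  have hnc0 : 0 ≤ n • c := nsmul_nonneg hc0 n
  have hnce : α.IsEigen 0 (n • c) := by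
    rw [← Nat.cast_smul_eq_nsmul ℂ]
    exact hce.smul _
  refine ⟨res (n • c), hnce.res_fixed hnc0, res_nonneg hnc0, norm_res_le _, ?_, ?_⟩
  · refine (φ.val_mono (res_nonneg hnc0) (res_le hnc0)).trans_lt ?_
    rw [φ.val_nsmul n hc0]
    exact ENNReal.mul_lt_top (by simp) hcfin
  · refine lt_of_pow_lt_pow_left₀ 2 hε.le ?_
    refine (norm_sub_res_nsmul_mul_sq_le hc0 b hn0').trans_lt ?_
    have : (1 : ℝ) / n < ε ^ 2 / 2 := by
      rw [div_lt_div_iff₀ hn0 (by norm_num)]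
      rw [div_lt_iff₀ (by positivity)] at hn
      linarith
    linarith

/-- When φ(b*b) is finite, replace b by g(gb) with g a fixed contraction of finite weight. This is
an eigenvector in the span of finite weights, so the KMS condition applies, and φ(b*b) dominates the
right side throughout. Lower semicontinuity gives the estimate for b. -/
theorem IsKMSWeight.val_eigen_le (hK : α.IsKMSWeight β φ) (h : α.PurePoint fr) {s : ℝ} {b : B}
    (hb : α.IsEigen s b) :
    φ.val (b * star b) ≤ ENNReal.ofReal (Real.exp (-(β * s))) * φ.val (star b * b) := by
  by_cases hfin : φ.val (star b * b) = ∞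
  · rw [hfin, ENNReal.mul_top (by simpa using Real.exp_pos _)]
    exact le_top
  have hfin : φ.val (star b * b) < ∞ := lt_top_iff_ne_top.2 hfin
  choose g hge hg0 hg1 hgfin hgb using fun n : ℕ =>
    h.exists_fixed_unit hK.proper hK.invariant_val hb (Nat.one_div_pos_of_nat (α := ℝ) (n := n))
  have hsg : ∀ n, star (g n) = g n := fun n => (hg0 n).isSelfAdjoint.star_eq
  have hle : ∀ (n : ℕ) (y : B), star (g n * y) * (g n * y) ≤ star y * y := fun n y => by
    have h1 : star (g n * y) * (g n * y) = star y * (star (g n) * g n) * y := by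
      simp only [star_mul, mul_assoc]
    rw [h1]
    refine (CStarAlgebra.star_left_conjugate_le_norm_smul (.star_mul_self _)).trans ?_
    rw [CStarRing.norm_star_mul_self]
    refine (smul_le_smul_of_nonneg_right ?_ (star_mul_self_nonneg y)).trans_eq (one_smul ℝ _)
    nlinarith [hg1 n, norm_nonneg (g n)]
  have hvle : ∀ (n : ℕ) (y : B), φ.val (star (g n * y) * (g n * y)) ≤ φ.val (star y * y) :=
    fun n y => φ.val_mono (star_mul_self_nonneg _) (hle n y)
  have t1 : Tendsto (fun n => g n * b) atTop (𝓝 b) := by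
    rw [tendsto_iff_norm_sub_tendsto_zero]
    refine squeeze_zero (fun _ => norm_nonneg _) (fun n => ?_)
      tendsto_one_div_add_atTop_nhds_zero_nat
    rw [norm_sub_rev]
    exact (hgb n).le
  have t2 : Tendsto (fun n => g n * (g n * b)) atTop (𝓝 b) := by
    have t3 : Tendsto (fun n => g n * (g n * b - b) + g n * b) atTop (𝓝 (0 + b)) := by
      refine Tendsto.add ?_ t1
      refine squeeze_zero_norm (fun n => (norm_mul_le _ _).trans
        (mul_le_of_le_one_left (norm_nonneg _) (hg1 n))) ?_
      simpa using (t1.sub_const b).norm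
    rw [zero_add] at t3
    refine t3.congr fun n => ?_
    rw [mul_sub, sub_add_cancel]
  refine CStarWeight.val_le_of_tendsto hK.proper.lowerSemicontinuous
    (f := fun n => g n * (g n * b) * star (g n * (g n * b)))
    (fun n => mul_star_self_nonneg _) (t2.mul t2.star) fun n => ?_
  have hx : α.IsEigen s (g n * (g n * b)) := by
    simpa using (hge n).mul ((hge n).mul hb)
  have hgg : φ.val (star (g n) * g n) < ∞ := by
    rw [hsg]
    have hgg0 : 0 ≤ g n * g n := by
      have := star_mul_self_nonneg (g n)
      rwa [hsg] at this
    exact (φ.val_mono hgg0 (mul_self_le_of_norm_le (hg0 n) (hg1 n))).trans_lt (hgfin n)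
  -- This is why g is used twice: the element is g* times gb, and both factors have finite square
  -- weight.
  have hmem : g n * (g n * b) ∈ φ.finiteSpan := by
    have := CStarWeight.star_mul_mem_finiteSpan hgg ((hvle n b).trans_lt hfin)
    rwa [hsg] at this
  have hk := hK.val_of_mem_finiteSpan hx hmem
  have h4 : φ.val (star (g n * (g n * b)) * (g n * (g n * b))) ≤ φ.val (star b * b) :=
    (hvle n _).trans (hvle n b)
  calc φ.val (g n * (g n * b) * star (g n * (g n * b)))
      = ENNReal.ofReal (Real.exp (-(β * s))) * (ENNReal.ofReal (Real.exp (β * s)) *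
        φ.val (g n * (g n * b) * star (g n * (g n * b)))) := by
        rw [← mul_assoc (ENNReal.ofReal _), ← ENNReal.ofReal_mul (Real.exp_pos _).le, ← Real.exp_add]
        simp
    _ ≤ _ := by
        rw [← hk]
        gcongr

/-- The KMS condition for eigenvectors, without any domain condition. -/
theorem IsKMSWeight.val_eigen (hK : α.IsKMSWeight β φ) (h : α.PurePoint fr) {s : ℝ} {b : B}
    (hb : α.IsEigen s b) :
    φ.val (star b * b) = ENNReal.ofReal (Real.exp (β * s)) * φ.val (b * star b) := by
  refine le_antisymm ?_ ?_
  -- The other inequality is the same one for b*, which has frequency -s.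
  · have := hK.val_eigen_le h hb.conj
    rwa [star_star, mul_neg, neg_neg] at this
  · calc _ ≤ ENNReal.ofReal (Real.exp (β * s)) *
          (ENNReal.ofReal (Real.exp (-(β * s))) * φ.val (star b * b)) := by
          gcongr
          exact hK.val_eigen_le h hb
      _ = _ := by
          rw [← mul_assoc (ENNReal.ofReal _), ← ENNReal.ofReal_mul (Real.exp_pos _).le, ← Real.exp_add]
          simp

theorem IsKMSWeight.val_fixed (hK : α.IsKMSWeight β φ) (h : α.PurePoint fr) {b : B}
    (hb : α.IsEigen 0 b) : φ.val (star b * b) = φ.val (b * star b) := by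
  simpa using hK.val_eigen h hb

/-- On fixed elements the KMS condition is the trace property, used here for c^{1/2} e. -/
theorem IsKMSWeight.val_conj_fixed_le (hK : α.IsKMSWeight β φ) (h : α.PurePoint fr) {e c : B}
    (he : α.IsEigen 0 e) (hc : α.IsEigen 0 c) (hc0 : 0 ≤ c) :
    φ.val (star e * c * e) ≤ ENNReal.ofReal (‖e‖ ^ 2) * φ.val c := by
  have hss : star (CFC.sqrt c) = CFC.sqrt c := (CFC.sqrt_nonneg c).isSelfAdjoint.star_eq
  have hx : α.IsEigen 0 (CFC.sqrt c * e) := by simpa using (hc.sqrt_fixed hc0).mul he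
  have h1 := hK.val_fixed h hx
  have h2 : star (CFC.sqrt c * e) * (CFC.sqrt c * e) = star e * c * e := by
    conv_rhs => rw [← CFC.sqrt_mul_sqrt_self c hc0]
    simp only [star_mul, hss, mul_assoc]
  have h3 : CFC.sqrt c * e * star (CFC.sqrt c * e) =
      star (CFC.sqrt c) * (e * star e) * CFC.sqrt c := by
    simp only [star_mul, hss, mul_assoc]
  rw [h2] at h1
  rw [h1, ← φ.val_smul (by positivity) hc0]
  refine φ.val_mono (mul_star_self_nonneg _) ?_
  rw [h3]
  refine (CStarAlgebra.star_left_conjugate_le_norm_smul (.mul_star_self _)).trans_eq ?_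
  rw [hss, CFC.sqrt_mul_sqrt_self c hc0, CStarRing.norm_self_mul_star, sq]

/-! ### Restriction of KMS weights to a subalgebra of fixed points -/

section Restriction

variable {A : Type*} [NonUnitalCStarAlgebra A] [PartialOrder A] [StarOrderedRing A]
  {j : A →⋆ₙₐ[ℂ] B} (hj : ∀ a, α.IsEigen 0 (j a))

theorem lowerSemicontinuous_comap (hφ : LowerSemicontinuous φ.toFun) (j : A →⋆ₙₐ[ℂ] B) :
    LowerSemicontinuous (φ.comap j).toFun := by
  have hc : Continuous fun a : {a : A // 0 ≤ a} => (⟨j a.1, map_nonneg j a.2⟩ : {b : B // 0 ≤ b}) :=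
    ((AddMonoidHomClass.continuous_of_bound j 1 fun a => by
      simpa using NonUnitalStarAlgHom.norm_apply_le j a).comp continuous_subtype_val).subtype_mk _
  exact fun a y hy => (hc.tendsto a).eventually (hφ _ y hy)

include hj

theorem IsKMSWeight.isTracial_comap (hK : α.IsKMSWeight β φ) (h : α.PurePoint fr) :
    (φ.comap j).IsTracial := by
  refine CStarWeight.isTracial_of_forall fun a => ?_
  rw [φ.val_comap j (star_mul_self_nonneg a), φ.val_comap j (mul_star_self_nonneg a), map_mul,
    map_mul, map_star]
  exact hK.val_fixed h (hj a)

/-- Choose a fixed c of finite weight within ε of j(a), and let u² = (a - 2ε)₊. Then 2ε u² ≤ u a u ≤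
u c u + ε u² after applying j to the terms from A, so ε u² ≤ u c u, and the right side has finite
weight by the trace property. The element u² of A is close to a. -/
theorem IsKMSWeight.denselyDefined_comap (hK : α.IsKMSWeight β φ) (h : α.PurePoint fr) :
    (φ.comap j).DenselyDefined := by
  intro a ha δ hδ
  -- The cutoff at 2ε moves a by at most δ/2, which is strictly less than δ.
  set ε := δ / 4 with hε
  have hε0 : 0 < ε := by positivity
  obtain ⟨c', hc', hfin, hd⟩ := hK.proper.denselyDefined (j a) (map_nonneg j ha) ε hε0
  set c := h.proj 0 c' with hc
  have hc0 : 0 ≤ c := h.proj_zero_nonneg hc'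
  have hcfin : φ.val c < ∞ :=
    (h.val_proj_zero_le hK.proper.lowerSemicontinuous hK.invariant_val hc').trans_lt hfin
  have hce : α.IsEigen 0 c := h.isEigen_proj 0 c'
  have hcd : ‖j a - c‖ ≤ ε := by
    have : j a - c = h.proj 0 (j a - c') := by
      rw [map_sub, (hj a).proj_same h]
    rw [this]
    rw [norm_sub_rev] at hd
    exact (h.norm_proj_le _ _).trans hd.le
  have hf : Continuous fun x : ℝ => √(max (x - 2 * ε) 0) := by fun_prop
  have hf0 : (fun x : ℝ => √(max (x - 2 * ε) 0)) 0 = 0 := by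
    simp only [zero_sub]
    rw [max_eq_right (by linarith), Real.sqrt_zero]
  set u := cfcₙ (fun x : ℝ => √(max (x - 2 * ε) 0)) a with hu
  have hu0 : 0 ≤ u := cfcₙ_nonneg fun x _ => Real.sqrt_nonneg _
  have hus : star u = u := hu0.isSelfAdjoint.star_eq
  have huu : u * u = cfcₙ (fun x : ℝ => max (x - 2 * ε) 0) a := by
    rw [hu, ← cfcₙ_mul _ _ a hf.continuousOn hf0 hf.continuousOn hf0]
    exact cfcₙ_congr fun x _ => Real.mul_self_sqrt (le_max_right _ _)
  have huu0 : 0 ≤ u * u := by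
    have := star_mul_self_nonneg u
    rwa [hus] at this
  refine ⟨u * u, huu0, ?_, ?_⟩
  -- The function (x - 2ε)₊ is nonzero only where x > 2ε.
  · have h1 : (2 * ε) • (u * u) ≤ u * a * u := by
      have e1 : u * a * u = cfcₙ (fun x : ℝ =>
          √(max (x - 2 * ε) 0) * x * √(max (x - 2 * ε) 0)) a := by
        rw [cfcₙ_mul (fun x : ℝ => √(max (x - 2 * ε) 0) * x) (fun x : ℝ => √(max (x - 2 * ε) 0)) a
            (by fun_prop) (by simp) (by fun_prop) hf0,
          cfcₙ_mul (fun x : ℝ => √(max (x - 2 * ε) 0)) (fun x : ℝ => x) a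
            (by fun_prop) hf0 (by fun_prop) (by simp), cfcₙ_id' ℝ a]
      rw [huu, e1, ← cfcₙ_smul (2 * ε) (fun x : ℝ => max (x - 2 * ε) 0) a (by fun_prop)
        (by simp only [zero_sub]; exact max_eq_right (by linarith))]
      refine cfcₙ_mono (fun x hx => ?_) (by fun_prop) (by fun_prop)
        (by simp only [zero_sub]; rw [max_eq_right (by linarith)]; simp) (by simp)
      have hm := Real.mul_self_sqrt (le_max_right (x - 2 * ε) 0)
      have hx' : √(max (x - 2 * ε) 0) * x * √(max (x - 2 * ε) 0) = max (x - 2 * ε) 0 * x := by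
        linear_combination x * hm
      rw [smul_eq_mul, hx', mul_comm]
      rcases le_total (x - 2 * ε) 0 with hx0 | hx0
      · rw [max_eq_right hx0]
        simp
      · rw [max_eq_left hx0]
        nlinarith
    have h2 : star (j u) * j a * j u ≤ star (j u) * c * j u + ‖j a - c‖ • (star (j u) * j u) :=
      CStarWeight.conj_le_add (j u) (map_nonneg j ha) hc0
    have hjs : star (j u) = j u := by rw [← map_star, hus]
    have hjm : ∀ r : ℝ, j (r • (u * u)) = r • (j u * j u) := fun r => by
      rw [← Complex.coe_smul, map_smul, map_mul, Complex.coe_smul]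
    have h3 : (2 * ε) • (j u * j u) ≤ j u * j a * j u := by
      have := OrderHomClass.mono j h1
      rwa [hjm, map_mul, map_mul] at this
    have hju0 : 0 ≤ j u * j u := by rw [← map_mul]; exact map_nonneg j huu0
    rw [hjs] at h2
    have h4 : ε • (j u * j u) ≤ j u * c * j u := by
      have h5 : ‖j a - c‖ • (j u * j u) ≤ ε • (j u * j u) := smul_le_smul_of_nonneg_right hcd hju0
      have h6 := h3.trans (h2.trans (add_le_add_right h5 _))
      rw [two_mul, add_smul] at h6
      exact le_of_add_le_add_right h6
    have h7 := hK.val_conj_fixed_le h (hj u) hce hc0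
    rw [hjs] at h7
    rw [φ.val_comap j huu0, map_mul]
    have h8 := φ.val_mono (smul_nonneg hε0.le hju0) h4
    rw [φ.val_smul hε0.le hju0] at h8
    have h9 : ENNReal.ofReal ε * φ.val (j u * j u) < ∞ :=
      (h8.trans h7).trans_lt (ENNReal.mul_lt_top ENNReal.ofReal_lt_top hcfin)
    exact ENNReal.lt_top_of_mul_ne_top_right h9.ne (by simpa using hε0)
  · rw [huu]
    have e2 : cfcₙ (fun x : ℝ => max (x - 2 * ε) 0) a - a =
        cfcₙ (fun x : ℝ => max (x - 2 * ε) 0 - x) a := by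
      rw [cfcₙ_sub (fun x : ℝ => max (x - 2 * ε) 0) (fun x : ℝ => x) a (by fun_prop)
        (by simp only [zero_sub]; exact max_eq_right (by linarith)) (by fun_prop) (by simp),
        cfcₙ_id' ℝ a]
    rw [e2]
    refine (norm_cfcₙ_le (c := 2 * ε) fun x hx => ?_).trans_lt (by linarith)
    have hx0 := nonneg_of_mem_quasispectrum ha hx
    rw [Real.norm_eq_abs, abs_le]
    rcases le_total (x - 2 * ε) 0 with hx1 | hx1
    · rw [max_eq_right hx1]
      constructor <;> linarith
    · rw [max_eq_left hx1]
      constructor <;> linarith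

-- Nondegeneracy of j. It is conditional because the elements `unitSqrt r` form an approximate unit
-- only once the restricted weight is known to be densely defined.
variable (hunit : (φ.comap j).DenselyDefined → ∀ b : B, Tendsto
  (fun r : (φ.comap j).FinIdx => star (j (CStarWeight.unitSqrt r)) * b * j (CStarWeight.unitSqrt r))
  atTop (𝓝 b))

omit hj in
theorem val_unitSqrt_lt_top (r : (φ.comap j).FinIdx) :
    φ.val (star (j (CStarWeight.unitSqrt r)) * j (CStarWeight.unitSqrt r)) < ∞ := by
  have := CStarWeight.val_star_unitSqrt_mul_lt_top r
  rwa [φ.val_comap j (star_mul_self_nonneg _), map_mul, map_star] at this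

include hunit

/-- If the restriction vanished, so would all compressions of φ by elements of A, and lower
semicontinuity would give φ = 0. -/
theorem IsKMSWeight.isProper_comap (hK : α.IsKMSWeight β φ) (h : α.PurePoint fr) :
    (φ.comap j).IsProper where
  ne_zero := by
    by_contra! h0
    obtain ⟨b, hb⟩ := hK.proper.ne_zero
    rw [CStarWeight.toFun_eq_val] at hb
    refine hb (le_antisymm ?_ bot_le)
    refine CStarWeight.val_le_of_tendsto hK.proper.lowerSemicontinuous
      (fun r => star_left_conjugate_nonneg b.2 _)
      (hunit (hK.denselyDefined_comap hj h) b.1) fun r => ?_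
    refine (φ.val_conj_le _ b.2).trans ?_
    have := h0 ⟨star (CStarWeight.unitSqrt r) * CStarWeight.unitSqrt r, star_mul_self_nonneg _⟩
    rw [CStarWeight.toFun_eq_val, φ.val_comap j (star_mul_self_nonneg _), map_mul, map_star] at this
    rw [this, mul_zero]
  lowerSemicontinuous := lowerSemicontinuous_comap hK.proper.lowerSemicontinuous j
  dense := CStarWeight.denselyDefined_iff.1 (hK.denselyDefined_comap hj h)

-- Compression by the fixed element j(e) commutes with the averages and is norm continuous on
-- weights, so b may be replaced by its fixed-point projection; there the trace property applies.
omit hunit [PartialOrder A] [StarOrderedRing A] in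
theorem IsKMSWeight.val_conj_le_self (hK : α.IsKMSWeight β φ) (h : α.PurePoint fr) {e : A}
    (he : φ.val (star (j e) * j e) < ∞) (he1 : ‖e‖ ≤ 1) {b : B} (hb : 0 ≤ b) :
    φ.val (star (j e) * b * j e) ≤ φ.val b := by
  have hfix : ∀ t, α.toFun t (j e) = j e := isEigen_zero_iff.1 (hj e)
  have havg : ∀ n, star (j e) * α.avg fr 0 n b * j e = α.avg fr 0 n (star (j e) * b * j e) := by
    intro n
    induction n with
    | zero => rfl
    | succ n ih =>
      rw [avg_succ_apply, avg_succ_apply, ← ih]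
      simp only [map_mul, map_star, hfix, mul_add, add_mul, mul_smul_comm, smul_mul_assoc]
  have h1 : φ.val (star (j e) * h.proj 0 b * j e) = φ.val (star (j e) * b * j e) := by
    refine CStarWeight.val_conj_tendsto_unique he (fun n => avg_zero_nonneg n hb)
      (h.tendsto_avg 0 b) fun n => ?_
    rw [havg, val_avg_zero hK.invariant_val n (star_left_conjugate_nonneg hb _)]
  rw [← h1]
  refine (hK.val_conj_fixed_le h (hj e) (h.isEigen_proj 0 b) (h.proj_zero_nonneg hb)).trans ?_
  have h2 : ‖j e‖ ^ 2 ≤ 1 :=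
    pow_le_one₀ (norm_nonneg _) ((NonUnitalStarAlgHom.norm_apply_le j e).trans he1)
  calc _ ≤ 1 * φ.val (h.proj 0 b) := by
        gcongr
        exact ENNReal.ofReal_le_one.2 h2
    _ ≤ φ.val b := by
        rw [one_mul]
        exact h.val_proj_zero_le hK.proper.lowerSemicontinuous hK.invariant_val hb

/-- A KMS weight is the supremum of its compressions to the approximate unit of its restriction. -/
theorem IsKMSWeight.iSup_conj (hK : α.IsKMSWeight β φ) (h : α.PurePoint fr) {b : B} (hb : 0 ≤ b) :
    ⨆ r : (φ.comap j).FinIdx, φ.val (star (j (CStarWeight.unitSqrt r)) * b *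
      j (CStarWeight.unitSqrt r)) = φ.val b := by
  refine le_antisymm (iSup_le fun r => ?_) ?_
  · exact hK.val_conj_le_self hj h (val_unitSqrt_lt_top r) (CStarWeight.norm_unitSqrt_le r) hb
  · exact CStarWeight.val_le_of_tendsto hK.proper.lowerSemicontinuous
      (fun r => star_left_conjugate_nonneg hb _) (hunit (hK.denselyDefined_comap hj h) b)
      fun r => le_iSup (fun r : (φ.comap j).FinIdx => φ.val (star (j (CStarWeight.unitSqrt r)) * b *
        j (CStarWeight.unitSqrt r))) r

end Restriction

end CStarFlow
end ToeplitzKMS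

namespace ToeplitzKMS

open StdModule

/-! ### Nondegeneracy -/

section Nondegenerate

variable {A : Type*} [NonUnitalCStarAlgebra A]

/-- One approximate unit with good image is enough for all: σ(q)a is near a for some q in it, and
σ(p_i)σ(q) = σ(p_i q) tends to σ(q). -/
theorem IsNondegenerate.tendsto {σ : A →⋆ₙₐ[ℂ] A} (hσ : IsNondegenerate σ) {κ : Type*}
    {l : Filter κ} {p : κ → A} (hp1 : ∀ᶠ i in l, ‖p i‖ ≤ 1)
    (hp : ∀ a, Tendsto (fun i => p i * a) l (𝓝 a)) (a : A) :
    Tendsto (fun i => σ (p i) * a) l (𝓝 a) := by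
  obtain ⟨l₀, h₀, h₁⟩ := hσ
  refine Metric.tendsto_nhds.2 fun ε hε => ?_
  have := h₁.neBot
  have h2 : Tendsto (fun q => σ q * a) l₀ (𝓝 a) := tendsto_map'_iff.1 (h₁.tendsto_mul_right a)
  have := h₀.neBot
  obtain ⟨q, hq⟩ := ((Metric.tendsto_nhds.1 h2) (ε / 3) (by positivity)).exists
  have h3 : Tendsto (fun i => (‖p i * q - q‖ + 0) * ‖a‖) l (𝓝 ((0 + 0) * ‖a‖)) :=
    ((tendsto_iff_norm_sub_tendsto_zero.1 (hp q)).add_const 0).mul_const _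
  simp only [add_zero, zero_mul] at h3
  filter_upwards [hp1, h3.eventually_lt_const (show (0 : ℝ) < ε / 3 by positivity)] with i hi1 hi
  rw [dist_eq_norm] at hq ⊢
  have e1 : σ (p i) * a - a = σ (p i) * (a - σ q * a) + (σ (p i * q - q) * a) + (σ q * a - a) := by
    rw [map_sub, map_mul]
    noncomm_ring
  have e2 : ‖σ (p i) * (a - σ q * a)‖ ≤ ‖σ q * a - a‖ := by
    rw [norm_sub_rev (σ q * a) a]
    refine (norm_mul_le _ _).trans (mul_le_of_le_one_left (norm_nonneg _) ?_)
    exact (NonUnitalStarAlgHom.norm_apply_le σ _).trans hi1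
  have e3 : ‖σ (p i * q - q) * a‖ ≤ ‖p i * q - q‖ * ‖a‖ :=
    (norm_mul_le _ _).trans (by gcongr; exact NonUnitalStarAlgHom.norm_apply_le σ _)
  rw [e1]
  have e4 := norm_add₃_le (a := σ (p i) * (a - σ q * a)) (b := σ (p i * q - q) * a)
    (c := σ q * a - a)
  linarith

theorem tendsto_wordHom {ρ : ℕ → A →⋆ₙₐ[ℂ] A} (hρ : ∀ n, IsNondegenerate (ρ n)) {κ : Type*}
    {l : Filter κ} (u : List ℕ) {p : κ → A} (hp1 : ∀ᶠ i in l, ‖p i‖ ≤ 1)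
    (hp : ∀ a, Tendsto (fun i => p i * a) l (𝓝 a)) (a : A) :
    Tendsto (fun i => wordHom ρ u (p i) * a) l (𝓝 a) := by
  induction u generalizing p with
  | nil => exact hp a
  | cons n u ih =>
    -- The induction runs over all nets p, here applied to the image net ρ_n(p_i).
    exact ih (hp1.mono fun i hi => (NonUnitalStarAlgHom.norm_apply_le (ρ n) _).trans hi)
      ((hρ n).tendsto hp1 hp)

end Nondegenerate

/-! ### Monomials -/

section Monomials

variable {A : Type*} [NonUnitalCStarAlgebra A] (ρ : ℕ → A →⋆ₙₐ[ℂ] A)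

/-- The isometry `T_𝔫 : ξ ↦ δ_𝔫 ⊗ ξ` of the Fock module. -/
noncomputable def consWord : List ℕ → Adjointable (List ℕ) A
  | [] => 1
  | i :: u => consOp i * consWord u

theorem consWord_append (u v : List ℕ) :
    (consWord (u ++ v) : Adjointable (List ℕ) A) = consWord u * consWord v := by
  induction u with
  | nil => simp [consWord]
  | cons i u ih => simp only [List.cons_append, consWord, ih, mul_assoc]

theorem star_consWord_mul_self (u : List ℕ) :
    star (consWord u) * consWord u = (1 : Adjointable (List ℕ) A) := by
  induction u with
  | nil => simp [consWord]
  | cons i u ih =>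
    rw [consWord, star_mul, mul_assoc, ← mul_assoc (star (consOp i)), star_consOp_mul_consOp,
      if_pos rfl, one_mul, ih]

/-- The relations T_i* T_j = δ_ij cancel a common prefix. What remains is a word on one side, or
zero when neither word is a prefix of the other. -/
theorem star_consWord_mul_cases (v u : List ℕ) :
    (∃ w, u = v ++ w ∧ star (consWord v) * consWord u = (consWord w : Adjointable (List ℕ) A)) ∨
    (∃ w, v = u ++ w ∧ star (consWord v) * consWord u =
      star (consWord w : Adjointable (List ℕ) A)) ∨
    star (consWord v) * consWord u = (0 : Adjointable (List ℕ) A) := by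
  induction v generalizing u with
  | nil => exact Or.inl ⟨u, rfl, by simp [consWord]⟩
  | cons i v ih =>
    match u with
    | [] => exact Or.inr (Or.inl ⟨i :: v, rfl, by simp [consWord]⟩)
    | j :: u =>
      have h : star (consWord (i :: v)) * consWord (j :: u) =
          star (consWord v) * ((if i = j then 1 else 0 : Adjointable (List ℕ) A) * consWord u) := by
        rw [consWord, consWord, star_mul, mul_assoc, ← mul_assoc (star (consOp i)),
          star_consOp_mul_consOp]
      by_cases hij : i = j
      · subst hij
        rw [if_pos rfl, one_mul] at h
        rw [h]
        rcases ih u with ⟨w, hw, e⟩ | ⟨w, hw, e⟩ | e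
        · exact Or.inl ⟨w, by rw [hw]; rfl, e⟩
        · exact Or.inr (Or.inl ⟨w, by rw [hw]; rfl, e⟩)
        · exact Or.inr (Or.inr e)
      · rw [if_neg hij, zero_mul, mul_zero] at h
        exact Or.inr (Or.inr h)

theorem star_consWord_mul_of_length_eq {v u : List ℕ} (h : v.length = u.length) (hne : v ≠ u) :
    star (consWord v) * consWord u = (0 : Adjointable (List ℕ) A) := by
  rcases star_consWord_mul_cases (A := A) v u with ⟨w, hw, _⟩ | ⟨w, hw, _⟩ | e
  · rw [hw, List.length_append] at h
    have : w = [] := List.length_eq_zero_iff.1 (by omega)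
    rw [this, List.append_nil] at hw
    exact absurd hw.symm hne
  · rw [hw, List.length_append] at h
    have : w = [] := List.length_eq_zero_iff.1 (by omega)
    rw [this, List.append_nil] at hw
    exact absurd hw hne
  · exact e

/-- The covariance relation. It pushes coefficients into the middle and is the reason why monomials
are closed under multiplication. -/
theorem leftAct_mul_consOp (a : A) (i : ℕ) :
    leftAct ρ a * consOp i = consOp i * leftAct ρ (ρ i a) := by
  refine Adjointable.ext fun f l => ?_
  change wordHom ρ l a * consFun i f l = consFun i (fun l' => wordHom ρ l' (ρ i a) * f l') l
  match l with
  | [] => simp [consFun]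
  | j :: l =>
    by_cases h : j = i
    · subst h
      rw [consFun_cons, consFun_cons]
      rfl
    · simp [consFun, h]

theorem leftAct_mul_consWord (a : A) (u : List ℕ) :
    leftAct ρ a * consWord u = consWord u * leftAct ρ (wordHom ρ u a) := by
  induction u generalizing a with
  | nil =>
    rw [consWord, mul_one, one_mul]
    rfl
  | cons i u ih =>
    rw [consWord, ← mul_assoc, leftAct_mul_consOp, mul_assoc, ih, mul_assoc]
    rfl

/-- The monomial `T_𝔲 a T_𝔳*`. -/
noncomputable def mono (u : List ℕ) (a : A) (v : List ℕ) : Adjointable (List ℕ) A :=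
  consWord u * leftAct ρ a * star (consWord v)

theorem star_mono (u : List ℕ) (a : A) (v : List ℕ) :
    star (mono ρ u a v) = mono ρ v (star a) u := by
  simp only [mono, star_mul, star_star, map_star, mul_assoc]

theorem leftAct_mul_mono (c : A) (u : List ℕ) (a : A) (v : List ℕ) :
    leftAct ρ c * mono ρ u a v = mono ρ u (wordHom ρ u c * a) v := by
  rw [mono, mono, ← mul_assoc, ← mul_assoc, leftAct_mul_consWord, map_mul, mul_assoc (consWord u)]

theorem mono_mul_mono (u : List ℕ) (a : A) (v u' : List ℕ) (a' : A) (v' : List ℕ) :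
    mono ρ u a v * mono ρ u' a' v' = 0 ∨
      ∃ u₁ b v₁, mono ρ u a v * mono ρ u' a' v' = mono ρ u₁ b v₁ := by
  have h : mono ρ u a v * mono ρ u' a' v' = consWord u * leftAct ρ a *
      (star (consWord v) * consWord u') * (leftAct ρ a' * star (consWord v')) := by
    simp only [mono, mul_assoc]
  rcases star_consWord_mul_cases (A := A) v u' with ⟨w, _, e⟩ | ⟨w, _, e⟩ | e
  · refine Or.inr ⟨u ++ w, wordHom ρ w a * a', v', ?_⟩
    rw [h, e, mul_assoc (consWord u), leftAct_mul_consWord, mono, consWord_append, map_mul]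
    simp only [mul_assoc]
  · refine Or.inr ⟨u, a * star (wordHom ρ w (star a')), v' ++ w, ?_⟩
    have e2 : star (consWord w) * leftAct ρ a' =
        leftAct ρ (star (wordHom ρ w (star a'))) * star (consWord w) := by
      have := congrArg star (leftAct_mul_consWord ρ (star a') w)
      rwa [star_mul, star_mul, ← map_star, star_star, ← map_star] at this
    rw [h, e, mono, consWord_append, star_mul, map_mul]
    calc _ = consWord u * leftAct ρ a * (star (consWord w) * leftAct ρ a') *
          star (consWord v') := by simp only [mul_assoc]
      _ = _ := by rw [e2]; simp only [mul_assoc]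
  · left
    rw [h, e, mul_zero, zero_mul]

theorem mono_add (u : List ℕ) (a b : A) (v : List ℕ) :
    mono ρ u (a + b) v = mono ρ u a v + mono ρ u b v := by
  simp only [mono, map_add, mul_add, add_mul]

theorem mono_smul (u : List ℕ) (c : ℂ) (a : A) (v : List ℕ) :
    mono ρ u (c • a) v = c • mono ρ u a v := by
  simp only [mono, map_smul, mul_smul_comm, smul_mul_assoc]

theorem norm_consWord_le (u : List ℕ) : ‖(consWord u : Adjointable (List ℕ) A)‖ ≤ 1 := by
  have h : ‖(consWord u : Adjointable (List ℕ) A)‖ * ‖(consWord u : Adjointable (List ℕ) A)‖ ≤ 1 := by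
    rw [← CStarRing.norm_star_mul_self, star_consWord_mul_self, Adjointable.norm_def]
    exact ContinuousLinearMap.norm_id_le
  nlinarith [norm_nonneg (consWord u : Adjointable (List ℕ) A)]

theorem norm_mono_le (u : List ℕ) (a : A) (v : List ℕ) : ‖mono ρ u a v‖ ≤ ‖a‖ := by
  have h1 := norm_consWord_le (A := A) u
  have h2 : ‖star (consWord v : Adjointable (List ℕ) A)‖ ≤ 1 := by
    rw [norm_star]
    exact norm_consWord_le v
  have h3 : ‖leftAct ρ a‖ ≤ ‖a‖ := NonUnitalStarAlgHom.norm_apply_le _ a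
  calc ‖mono ρ u a v‖ ≤ ‖(consWord u : Adjointable (List ℕ) A)‖ * ‖leftAct ρ a‖ *
        ‖star (consWord v : Adjointable (List ℕ) A)‖ :=
        (norm_mul_le _ _).trans (by gcongr; exact norm_mul_le _ _)
    _ ≤ 1 * ‖a‖ * 1 := by gcongr
    _ = ‖a‖ := by ring

theorem tendsto_mono {κ : Type*} {l : Filter κ} {p : κ → A} {a : A} (h : Tendsto p l (𝓝 a))
    (u v : List ℕ) : Tendsto (fun i => mono ρ u (p i) v) l (𝓝 (mono ρ u a v)) := by
  rw [tendsto_iff_norm_sub_tendsto_zero] at h ⊢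
  refine squeeze_zero (fun _ => norm_nonneg _) (fun i => ?_) h
  have : mono ρ u (p i) v - mono ρ u a v = mono ρ u (p i - a) v := by
    rw [sub_eq_iff_eq_add, ← mono_add, sub_add_cancel]
  rw [this]
  exact norm_mono_le ρ u _ v

/-- The linear span of the monomials. -/
noncomputable def monoSpan : NonUnitalStarSubalgebra ℂ (Adjointable (List ℕ) A) where
  carrier := Submodule.span ℂ (Set.range fun m : List ℕ × A × List ℕ => mono ρ m.1 m.2.1 m.2.2)
  zero_mem' := zero_mem _
  add_mem' := add_mem
  smul_mem' c _ h := Submodule.smul_mem _ c h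
  mul_mem' {s t} hs ht := by
    change s ∈ Submodule.span ℂ _ at hs
    change t ∈ Submodule.span ℂ _ at ht
    induction hs using Submodule.span_induction with
    | zero => rw [zero_mul]; exact zero_mem _
    | add a b _ _ ha hb => rw [add_mul]; exact add_mem ha hb
    | smul c a _ ha => rw [smul_mul_assoc]; exact Submodule.smul_mem _ c ha
    | mem s hs =>
      induction ht using Submodule.span_induction with
      | zero => rw [mul_zero]; exact zero_mem _
      | add a b _ _ ha hb => rw [mul_add]; exact add_mem ha hb
      | smul c a _ ha => rw [mul_smul_comm]; exact Submodule.smul_mem _ c ha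
      | mem t ht =>
        obtain ⟨m, rfl⟩ := hs
        obtain ⟨m', rfl⟩ := ht
        rcases mono_mul_mono ρ m.1 m.2.1 m.2.2 m'.1 m'.2.1 m'.2.2 with h | ⟨u, b, v, h⟩
        · simp only [h]
          exact zero_mem _
        · simp only [h]
          exact Submodule.subset_span ⟨(u, b, v), rfl⟩
  star_mem' {s} hs := by
    change s ∈ Submodule.span ℂ _ at hs
    induction hs using Submodule.span_induction with
    | zero => rw [star_zero]; exact zero_mem _
    | add a b _ _ ha hb => rw [star_add]; exact add_mem ha hb
    | smul c a _ ha => rw [star_smul]; exact Submodule.smul_mem _ _ ha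
    | mem s hs =>
      obtain ⟨m, rfl⟩ := hs
      simp only [star_mono]
      exact Submodule.subset_span ⟨(m.2.2, star m.2.1, m.1), rfl⟩

theorem mono_mem_monoSpan (u : List ℕ) (a : A) (v : List ℕ) : mono ρ u a v ∈ monoSpan ρ :=
  Submodule.subset_span ⟨(u, a, v), rfl⟩

theorem toeplitz_le_closure_monoSpan : toeplitz ρ ≤ (monoSpan ρ).topologicalClosure := by
  refine NonUnitalStarSubalgebra.topologicalClosure_minimal _ ?_
    (NonUnitalStarSubalgebra.isClosed_topologicalClosure _)
  refine NonUnitalStarAlgebra.adjoin_le (Set.union_subset ?_ ?_)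
  · rintro _ ⟨a, rfl⟩
    have := mono_mem_monoSpan ρ [] a []
    rw [mono, consWord, one_mul, star_one, mul_one] at this
    exact NonUnitalStarSubalgebra.le_topologicalClosure _ this
  · rintro _ ⟨ξ, rfl⟩
    refine (NonUnitalStarSubalgebra.isClosed_topologicalClosure (monoSpan ρ)).mem_of_tendsto
      (summable_creation ρ ξ).hasSum (Eventually.of_forall fun s => ?_)
    refine sum_mem (S := (monoSpan ρ).topologicalClosure) fun i _ => ?_
    have := mono_mem_monoSpan ρ [i] (ξ i) []
    simp only [mono, consWord, mul_one, star_one] at this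
    exact NonUnitalStarSubalgebra.le_topologicalClosure _ this

/-- The element `δ_i ⊗ a` of `ℓ²(ι) ⊗ A`. -/
noncomputable def single {ι : Type*} [DecidableEq ι] (i : ι) (a : A) : StdModule ι A :=
  mk (fun l => if l = i then a else 0) (summable_of_ne_finset_zero (s := {i}) fun l hl => by
    rw [if_neg (by simpa using hl), mul_zero])

theorem single_apply {ι : Type*} [DecidableEq ι] (i : ι) (a : A) (l : ι) :
    single i a l = if l = i then a else 0 := rfl

theorem creation_single (i : ℕ) (a : A) : creation ρ (single i a) = consOp i * leftAct ρ a := by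
  rw [creation, tsum_eq_single i fun k hk => by rw [single_apply, if_neg hk, map_zero, mul_zero],
    single_apply, if_pos rfl]

variable {ρ}
variable (hρ : ∀ n, IsNondegenerate (ρ n))
include hρ

/-- A bare T_i need not lie in the algebra, but T_i p does for p in A. By covariance T_i p T_u a =
T_i T_u ρ_u(p) a, and nondegeneracy lets p run through an approximate unit. -/
theorem consWord_mul_leftAct_mem (u : List ℕ) (a : A) : consWord u * leftAct ρ a ∈ toeplitz ρ := by
  let _ : PartialOrder A := CStarAlgebra.spectralOrder A
  let _ : StarOrderedRing A := CStarAlgebra.spectralOrderedRing A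
  induction u generalizing a with
  | nil =>
    rw [consWord, one_mul]
    exact leftAct_mem ρ a
  | cons i u ih =>
    have hl := CStarAlgebra.increasingApproximateUnit A
    have h1 := tendsto_wordHom hρ u (p := id) hl.eventually_norm
      (fun a => hl.tendsto_mul_right a) a
    have h2 := tendsto_mono ρ h1 u []
    have h3 := h2.const_mul (consOp i)
    have := hl.neBot
    have e : ∀ p : A, consOp i * mono ρ u (wordHom ρ u (id p) * a) [] =
        creation ρ (single i p) * (consWord u * leftAct ρ a) := fun p => by
      have h4 : consWord u * leftAct ρ a = mono ρ u a [] := by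
        rw [mono, consWord, star_one, mul_one]
      rw [creation_single, h4, mul_assoc, leftAct_mul_mono, id]
    have h5 : consWord (i :: u) * leftAct ρ a = consOp i * mono ρ u a [] := by
      rw [mono, consWord, consWord, star_one, mul_one, mul_assoc]
    rw [h5]
    refine (isClosed_toeplitz ρ).mem_of_tendsto h3 (Eventually.of_forall fun p => ?_)
    rw [e]
    exact mul_mem (creation_mem ρ _) (ih a)

theorem mono_mem (u : List ℕ) (a : A) (v : List ℕ) : mono ρ u a v ∈ toeplitz ρ := by
  let _ : PartialOrder A := CStarAlgebra.spectralOrder A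
  let _ : StarOrderedRing A := CStarAlgebra.spectralOrderedRing A
  have hl := CStarAlgebra.increasingApproximateUnit A
  have := hl.neBot
  have h2 := tendsto_mono ρ (hl.tendsto_mul_left a) u v
  refine (isClosed_toeplitz ρ).mem_of_tendsto h2 (Eventually.of_forall fun p => ?_)
  have e : mono ρ u (a * p) v =
      consWord u * leftAct ρ a * star (consWord v * leftAct ρ (star p)) := by
    rw [mono, map_mul, star_mul, ← map_star, star_star]
    simp only [mul_assoc]
  rw [e]
  exact mul_mem (consWord_mul_leftAct_mem hρ u a) (star_mem (consWord_mul_leftAct_mem hρ v _))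

/-- The monomial `T_𝔲 a T_𝔳*`, as an element of the Toeplitz–Pimsner algebra. -/
noncomputable def monoT (u : List ℕ) (a : A) (v : List ℕ) : toeplitz ρ :=
  ⟨mono ρ u a v, mono_mem hρ u a v⟩

theorem dense_span_monoT : Dense (Submodule.span ℂ
    (Set.range fun m : List ℕ × A × List ℕ => monoT hρ m.1 m.2.1 m.2.2) : Set (toeplitz ρ)) := by
  intro b
  rw [Metric.mem_closure_iff]
  intro ε hε
  obtain ⟨c, hc, hd⟩ := Metric.mem_closure_iff.1 (toeplitz_le_closure_monoSpan ρ b.2) ε hε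
  change c ∈ Submodule.span ℂ _ at hc
  have h1 : (Submodule.span ℂ (Set.range fun m : List ℕ × A × List ℕ =>
      monoT hρ m.1 m.2.1 m.2.2)).map (toeplitz ρ).toNonUnitalSubalgebra.toSubmodule.subtype =
      Submodule.span ℂ (Set.range fun m : List ℕ × A × List ℕ => mono ρ m.1 m.2.1 m.2.2) := by
    rw [Submodule.map_span, ← Set.range_comp]
    rfl
  rw [← h1] at hc
  obtain ⟨c', hc', rfl⟩ := hc
  exact ⟨c', hc', hd⟩

theorem toeplitz_induction {p : toeplitz ρ → Prop} (hcl : IsClosed {b | p b})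
    (hmono : ∀ u a v, p (monoT hρ u a v)) (hadd : ∀ a b, p a → p b → p (a + b))
    (b : toeplitz ρ) : p b := by
  have hsub : ∀ b ∈ Submodule.span ℂ
      (Set.range fun m : List ℕ × A × List ℕ => monoT hρ m.1 m.2.1 m.2.2), p b := by
    intro b hb
    induction hb using Submodule.closure_induction with
    | zero =>
      have : monoT hρ [] (0 : A) [] = 0 := Subtype.ext (by simp [monoT, mono])
      rw [← this]
      exact hmono _ _ _
    | add a b _ _ ha hb => exact hadd a b ha hb
    | smul_mem c b hb =>
      obtain ⟨m, rfl⟩ := hb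
      have : c • monoT hρ m.1 m.2.1 m.2.2 = monoT hρ m.1 (c • m.2.1) m.2.2 :=
        Subtype.ext (mono_smul ρ _ _ _ _).symm
      simp only [this]
      exact hmono _ _ _
  exact hcl.closure_subset_iff.2 (fun b hb => hsub b hb) (dense_span_monoT hρ b)

theorem incl_mul_monoT (c : A) (u : List ℕ) (a : A) (v : List ℕ) :
    incl ρ c * monoT hρ u a v = monoT hρ u (wordHom ρ u c * a) v :=
  Subtype.ext (leftAct_mul_mono ρ c u a v)

/-- On a monomial T_u a T_v*, left multiplication by p_i replaces a by ρ_u(p_i) a, which converges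
by nondegeneracy. Contractivity carries this to the closure. -/
theorem tendsto_incl_mul {κ : Type*} {l : Filter κ} {p : κ → A} (hp1 : ∀ i, ‖p i‖ ≤ 1)
    (hp : ∀ a, Tendsto (fun i => p i * a) l (𝓝 a)) (b : toeplitz ρ) :
    Tendsto (fun i => incl ρ (p i) * b) l (𝓝 b) := by
  refine toeplitz_induction hρ (p := fun b => Tendsto (fun i => incl ρ (p i) * b) l (𝓝 b))
    ?_ ?_ ?_ b
  · refine isClosed_of_closure_subset fun b hb => Metric.tendsto_nhds.2 fun ε hε => ?_
    obtain ⟨c, hc, hd⟩ := Metric.mem_closure_iff.1 hb (ε / 3) (by positivity)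
    filter_upwards [Metric.tendsto_nhds.1 hc (ε / 3) (by positivity)] with i hi
    have h1 : dist (incl ρ (p i) * b) (incl ρ (p i) * c) ≤ dist b c := by
      rw [dist_eq_norm, dist_eq_norm, ← mul_sub]
      refine (norm_mul_le _ _).trans (mul_le_of_le_one_left (norm_nonneg _) ?_)
      exact (NonUnitalStarAlgHom.norm_apply_le (incl ρ) _).trans (hp1 i)
    have h2 := dist_triangle4 (incl ρ (p i) * b) (incl ρ (p i) * c) c b
    rw [dist_comm c b] at h2
    linarith
  · intro u a v
    simp only [incl_mul_monoT]
    exact tendsto_subtype_rng.2 (tendsto_mono ρ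
      (tendsto_wordHom hρ u (Eventually.of_forall hp1) hp a) u v)
  · intro a b ha hb
    simp only [mul_add]
    exact ha.add hb

theorem tendsto_incl_conj {κ : Type*} {l : Filter κ} {p : κ → A} (hp1 : ∀ i, ‖p i‖ ≤ 1)
    (hps : ∀ i, star (p i) = p i) (hp : ∀ a, Tendsto (fun i => p i * a) l (𝓝 a))
    (b : toeplitz ρ) :
    Tendsto (fun i => star (incl ρ (p i)) * b * incl ρ (p i)) l (𝓝 b) := by
  have hs : ∀ i, star (incl ρ (p i)) = incl ρ (p i) := fun i => by rw [← map_star, hps]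
  have h1 : Tendsto (fun i => b * incl ρ (p i)) l (𝓝 b) := by
    have := (tendsto_incl_mul hρ hp1 hp (star b)).star
    simpa only [star_mul, star_star, hs] using this
  have h2 := tendsto_incl_mul hρ hp1 hp b
  have h3 : Tendsto (fun i => incl ρ (p i) * (b * incl ρ (p i) - b) + incl ρ (p i) * b) l
      (𝓝 (0 + b)) := by
    refine Tendsto.add ?_ h2
    refine squeeze_zero_norm (fun i => (norm_mul_le _ _).trans
      (mul_le_of_le_one_left (norm_nonneg _)
        ((NonUnitalStarAlgHom.norm_apply_le (incl ρ) _).trans (hp1 i)))) ?_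
    have := (h1.sub_const b).norm
    simpa using this
  rw [zero_add] at h3
  refine h3.congr fun i => ?_
  rw [hs]
  noncomm_ring

omit hρ in
theorem fockConj_consOp (x : ℕ → ℝ) (t : ℝ) (i : ℕ) :
    fockConj x t (consOp i : Adjointable (List ℕ) A) =
      Complex.exp ((x i * t : ℝ) * Complex.I) • consOp i := by
  refine Adjointable.ext fun f l => ?_
  rw [fockConj_apply]
  change Complex.exp _ • consFun i (fun l' => (Complex.exp _ • f l')) l =
    Complex.exp _ • consFun i f l
  match l with
  | [] => simp [consFun]
  | j :: l =>
    by_cases h : j = i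
    · subst h
      rw [consFun_cons, consFun_cons, smul_smul, ← Complex.exp_add]
      congr 2
      push_cast [List.map_cons, List.sum_cons]
      ring
    · simp [consFun, h]

omit hρ in
theorem fockConj_consWord (x : ℕ → ℝ) (t : ℝ) (u : List ℕ) :
    fockConj x t (consWord u : Adjointable (List ℕ) A) =
      Complex.exp (((u.map x).sum * t : ℝ) * Complex.I) • consWord u := by
  induction u with
  | nil => simp [consWord]
  | cons i u ih =>
    rw [consWord, map_mul, ih, fockConj_consOp, smul_mul_smul_comm, ← Complex.exp_add]
    congr 2
    push_cast [List.map_cons, List.sum_cons]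
    ring

theorem isEigen_monoT (x : ℕ → ℝ) (u : List ℕ) (a : A) (v : List ℕ) :
    (quasiFreeFlow ρ x).IsEigen ((u.map x).sum - (v.map x).sum) (monoT hρ u a v) := by
  intro t
  refine Subtype.ext ?_
  change fockConj x t (mono ρ u a v) = _ • mono ρ u a v
  rw [mono, map_mul, map_mul, map_star, fockConj_consWord, fockConj_consWord, fockConj_leftAct,
    star_smul, smul_mul_assoc, smul_mul_smul_comm, Complex.star_def, ← Complex.exp_conj,
    ← Complex.exp_add]
  congr 2
  simp only [map_mul, Complex.conj_ofReal, Complex.conj_I]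
  push_cast
  ring

omit hρ in
theorem isEigen_incl (x : ℕ → ℝ) (a : A) : (quasiFreeFlow ρ x).IsEigen 0 (incl ρ a) :=
  CStarFlow.isEigen_zero_iff.2 fun t => quasiFreeFlow_incl ρ x t a

/-- An enumeration of the frequencies of the monomials. -/
noncomputable def freq (x : ℕ → ℝ) (i : ℕ) : ℝ :=
  ((Denumerable.ofNat (List ℕ × List ℕ) i).1.map x).sum -
    ((Denumerable.ofNat (List ℕ × List ℕ) i).2.map x).sum

theorem purePoint (x : ℕ → ℝ) : (quasiFreeFlow ρ x).PurePoint (freq x) := by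
  refine (dense_span_monoT hρ).mono (Submodule.span_mono ?_)
  rintro _ ⟨m, rfl⟩
  refine ⟨Encodable.encode (m.1, m.2.2), ?_⟩
  rw [freq, Denumerable.ofNat_encode]
  exact isEigen_monoT hρ x m.1 m.2.1 m.2.2

end Monomials

/-- If the closure of the orbit contains the constant sequences, then words with the same
frequency have the same length. -/
theorem length_eq_of_sum_eq {x : ℕ → ℝ}
    (hx : ∀ z : Circle, (fun _ : ℕ => z) ∈ torusClosure x) {u v : List ℕ}
    (h : (u.map x).sum = (v.map x).sum) : u.length = v.length := by
  -- A word defines a continuous character of the torus. Words of equal frequency define characters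
  -- that agree on the orbit, hence on its closure.
  let χ : List ℕ → (ℕ → Circle) → Circle := fun w y => (w.map y).prod
  have hχ : ∀ w, Continuous (χ w) := fun w => continuous_list_prod w fun i _ => continuous_apply i
  have h1 : ∀ w (t : ℝ), χ w (fun n => Circle.exp (x n * t)) = Circle.exp ((w.map x).sum * t) := by
    intro w t
    induction w with
    | nil => simp [χ]
    | cons i w ih =>
      simp only [χ, List.map_cons, List.prod_cons, List.sum_cons, add_mul, Circle.exp_add] at ih ⊢
      rw [ih]
  have h2 : ∀ y ∈ torusClosure x, χ u y = χ v y := by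
    intro y hy
    refine closure_minimal ?_ (isClosed_eq (hχ u) (hχ v)) hy
    rintro _ ⟨t, rfl⟩
    change χ u _ = χ v _
    rw [h1, h1, h]
  -- At the constant sequence e^{i} this says e^{i|u|} = e^{i|v|}; different lengths would make π
  -- rational.
  have h3 := h2 _ (hx (Circle.exp 1))
  simp only [χ, List.map_const', List.prod_replicate, ← Circle.exp_natCast_mul, mul_one] at h3
  obtain ⟨m, hm⟩ := Circle.exp_eq_exp.1 h3
  by_contra hne
  have hm0 : m ≠ 0 := by
    rintro rfl
    simp at hm
    exact hne hm
  have hirr := irrational_pi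
  refine hirr ⟨((u.length : ℚ) - v.length) / (2 * m), ?_⟩
  have : (m : ℝ) ≠ 0 := by exact_mod_cast hm0
  push_cast
  field_simp
  linarith

end ToeplitzKMS

namespace ToeplitzKMS

/-! ### Bounded weights as real-linear functionals. -/

namespace CStarWeight

variable {B : Type*} [NonUnitalCStarAlgebra B] [PartialOrder B] [StarOrderedRing B]

/-- The compressed weight `b ↦ φ(e* b e)`. -/
noncomputable def conj (φ : CStarWeight B) (e : B) : CStarWeight B :=
  ofVal (fun b => φ.val (star e * b * e)) (by simp)
    (fun a b ha hb => by
      rw [mul_add, add_mul, φ.val_add (star_left_conjugate_nonneg ha e)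
        (star_left_conjugate_nonneg hb e)])
    (fun r a hr ha => by
      rw [mul_smul_comm, smul_mul_assoc, φ.val_smul hr (star_left_conjugate_nonneg ha e)])

theorem val_conj' (φ : CStarWeight B) (e : B) {b : B} (hb : 0 ≤ b) :
    (φ.conj e).val b = φ.val (star e * b * e) := val_ofVal hb

/-- A weight is bounded if it is bounded on the unit ball. -/
def IsBounded (ψ : CStarWeight B) : Prop :=
  ∃ C : ℝ≥0, ∀ b, 0 ≤ b → ψ.val b ≤ ENNReal.ofReal ‖b‖ * C

theorem isBounded_conj {φ : CStarWeight B} {e : B} (he : φ.val (star e * e) < ∞) :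
    (φ.conj e).IsBounded := by
  refine ⟨(φ.val (star e * e)).toNNReal, fun b hb => ?_⟩
  rw [val_conj' φ e hb, ENNReal.coe_toNNReal he.ne]
  exact φ.val_conj_le e hb

variable {ψ : CStarWeight B}

theorem IsBounded.ne_top (h : ψ.IsBounded) {b : B} (hb : 0 ≤ b) : ψ.val b ≠ ∞ := by
  obtain ⟨C, hC⟩ := h
  exact ((hC b hb).trans_lt (ENNReal.mul_lt_top ENNReal.ofReal_lt_top ENNReal.coe_lt_top)).ne

/-- The linear functional `b ↦ ψ(b + b*)` attached to a bounded weight. -/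
noncomputable def lin (ψ : CStarWeight B) (b : B) : ℝ :=
  (ψ.val (b + star b)⁺).toReal - (ψ.val (b + star b)⁻).toReal

/-- Comparing two decompositions gives (b + b*)₊ + v = u + (b + b*)₋, and the weight is additive and
finite. Any convenient decomposition may therefore replace the Jordan decomposition. -/
theorem IsBounded.lin_eq (h : ψ.IsBounded) {b u v : B} (hu : 0 ≤ u) (hv : 0 ≤ v)
    (hb : b + star b = u - v) : ψ.lin b = (ψ.val u).toReal - (ψ.val v).toReal := by
  have hsa : IsSelfAdjoint (b + star b) := IsSelfAdjoint.add_star_self b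
  have hp := CFC.posPart_nonneg (b + star b)
  have hn := CFC.negPart_nonneg (b + star b)
  have h1 : (b + star b)⁺ + v = u + (b + star b)⁻ := by
    have := CFC.posPart_sub_negPart (b + star b) hsa
    rw [hb] at this ⊢
    rw [sub_eq_iff_eq_add] at this
    rw [this]
    abel
  have h2 := congrArg ENNReal.toReal (congrArg ψ.val h1)
  rw [ψ.val_add hp hv, ψ.val_add hu hn, ENNReal.toReal_add (h.ne_top hp) (h.ne_top hv),
    ENNReal.toReal_add (h.ne_top hu) (h.ne_top hn)] at h2
  rw [lin]
  linarith

theorem IsBounded.lin_add (h : ψ.IsBounded) (a b : B) : ψ.lin (a + b) = ψ.lin a + ψ.lin b := by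
  have hp := fun b : B => CFC.posPart_nonneg (b + star b)
  have hn := fun b : B => CFC.negPart_nonneg (b + star b)
  have hs := fun b : B => CFC.posPart_sub_negPart (b + star b) (IsSelfAdjoint.add_star_self b)
  rw [h.lin_eq (add_nonneg (hp a) (hp b)) (add_nonneg (hn a) (hn b)), ψ.val_add (hp a) (hp b),
    ψ.val_add (hn a) (hn b), ENNReal.toReal_add (h.ne_top (hp a)) (h.ne_top (hp b)),
    ENNReal.toReal_add (h.ne_top (hn a)) (h.ne_top (hn b)), lin, lin]
  · ring
  · rw [add_sub_add_comm, hs, hs, star_add]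
    abel

theorem IsBounded.lin_of_nonneg (h : ψ.IsBounded) {b : B} (hb : 0 ≤ b) :
    ψ.lin b = 2 * (ψ.val b).toReal := by
  rw [h.lin_eq (add_nonneg hb hb) le_rfl (by rw [hb.isSelfAdjoint.star_eq, sub_zero]),
    ψ.val_add hb hb, ENNReal.toReal_add (h.ne_top hb) (h.ne_top hb), val_zero]
  simp
  ring

theorem IsBounded.continuous_lin (h : ψ.IsBounded) : Continuous ψ.lin := by
  obtain ⟨C, hC⟩ := id h
  let G : B →+ ℝ := AddMonoidHom.mk' ψ.lin h.lin_add
  refine AddMonoidHomClass.continuous_of_bound G (4 * C) fun b => ?_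
  have hb : ∀ c : B, 0 ≤ c → ‖c‖ ≤ 2 * ‖b‖ → 0 ≤ (ψ.val c).toReal ∧
      (ψ.val c).toReal ≤ 2 * C * ‖b‖ := fun c hc hcb => by
    refine ⟨ENNReal.toReal_nonneg, ?_⟩
    have := ENNReal.toReal_mono (ENNReal.mul_ne_top ENNReal.ofReal_ne_top ENNReal.coe_ne_top)
      (hC c hc)
    rw [ENNReal.toReal_mul, ENNReal.toReal_ofReal (norm_nonneg _), ENNReal.coe_toReal] at this
    nlinarith [C.2, norm_nonneg c, NNReal.coe_nonneg C]
  have hn : ‖b + star b‖ ≤ 2 * ‖b‖ := (norm_add_le _ _).trans (by rw [norm_star]; linarith)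
  have h1 := hb _ (CFC.posPart_nonneg (b + star b)) ((CStarAlgebra.norm_posPart_le _).trans hn)
  have h2 := hb _ (CFC.negPart_nonneg (b + star b)) ((CStarAlgebra.norm_negPart_le _).trans hn)
  change |ψ.lin b| ≤ 4 * C * ‖b‖
  rw [lin, abs_le]
  constructor <;> nlinarith

theorem IsBounded.lin_neg (h : ψ.IsBounded) (b : B) : ψ.lin (-b) = -ψ.lin b := by
  have h0 : ψ.lin 0 = 0 := by
    have := h.lin_add 0 0
    rw [add_zero] at this
    linarith
  have := h.lin_add b (-b)
  rw [add_neg_cancel, h0] at this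
  linarith

end CStarWeight

namespace CStarFlow

/-- At time π/s the flow sends b to -b, while invariance preserves the functional. -/
theorem IsEigen.lin_eq_zero {B : Type*} [NonUnitalCStarAlgebra B] [PartialOrder B]
    [StarOrderedRing B] {α : CStarFlow B} {ψ : CStarWeight B} (h : ψ.IsBounded)
    (hinv : ∀ t b, 0 ≤ b → ψ.val (α.toFun t b) = ψ.val b) {s : ℝ} (hs : s ≠ 0) {b : B}
    (hb : α.IsEigen s b) : ψ.lin b = 0 := by
  have hd : α.toFun (Real.pi / s) b + star (α.toFun (Real.pi / s) b) =
      α.toFun (Real.pi / s) (b + star b)⁺ - α.toFun (Real.pi / s) (b + star b)⁻ := by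
    rw [← map_star (α.toFun _) b, ← _root_.map_add (α.toFun _), ← map_sub (α.toFun _),
      CFC.posPart_sub_negPart _ (IsSelfAdjoint.add_star_self b)]
  have h1 : ψ.lin (α.toFun (Real.pi / s) b) = ψ.lin b := by
    rw [h.lin_eq (map_nonneg (α.toFun _) (CFC.posPart_nonneg (b + star b)))
      (map_nonneg (α.toFun _) (CFC.negPart_nonneg (b + star b))) hd,
      hinv _ _ (CFC.posPart_nonneg _), hinv _ _ (CFC.negPart_nonneg _), CStarWeight.lin]
  have h2 : s * (Real.pi / s) = Real.pi := by field_simp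
  rw [hb, h2, Complex.exp_pi_mul_I, neg_one_smul, h.lin_neg] at h1
  linarith

end CStarFlow

/-! ### Restricting KMS weights to the coefficient algebra -/

section Restriction

variable {A : Type*} [NonUnitalCStarAlgebra A] [PartialOrder A] [StarOrderedRing A]
  {ρ : ℕ → A →⋆ₙₐ[ℂ] A} (hρ : ∀ n, IsNondegenerate (ρ n)) {x : ℕ → ℝ} {β : ℝ}

omit [PartialOrder A] [StarOrderedRing A] in
theorem monoT_mul_star_monoT (u : List ℕ) (a : A) (v : List ℕ) (b : A) :
    monoT hρ u a [] * star (monoT hρ v b []) = monoT hρ u (a * star b) v := by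
  refine Subtype.ext ?_
  change mono ρ u a [] * star (mono ρ v b []) = mono ρ u (a * star b) v
  simp only [mono, consWord, star_one, mul_one, star_mul, map_mul, ← map_star, mul_assoc]

omit [PartialOrder A] [StarOrderedRing A] in
theorem star_monoT_mul_incl_mul_monoT (u : List ℕ) (a c b : A) :
    star (monoT hρ u a []) * incl ρ c * monoT hρ u b [] =
      incl ρ (star a * wordHom ρ u c * b) := by
  rw [mul_assoc, incl_mul_monoT]
  refine Subtype.ext ?_
  change star (mono ρ u a []) * mono ρ u _ [] = leftAct ρ _
  simp only [mono, consWord, star_one, mul_one, star_mul, map_mul, ← map_star]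
  rw [mul_assoc, ← mul_assoc (star (consWord u)), star_consWord_mul_self, one_mul, mul_assoc]

omit [PartialOrder A] [StarOrderedRing A] in
theorem star_monoT_mul_incl_mul_monoT_of_ne {u v : List ℕ} (hl : u.length = v.length)
    (hne : u ≠ v) (a c b : A) :
    star (monoT hρ u a []) * incl ρ c * monoT hρ v b [] = 0 := by
  rw [mul_assoc, incl_mul_monoT]
  refine Subtype.ext ?_
  change star (mono ρ u a []) * mono ρ v _ [] = 0
  simp only [mono, consWord, star_one, mul_one, star_mul, ← map_star]
  rw [mul_assoc, ← mul_assoc (star (consWord u)), star_consWord_mul_of_length_eq hl hne, zero_mul,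
    mul_zero]

theorem monoT_nonneg (u : List ℕ) {a : A} (ha : 0 ≤ a) : 0 ≤ monoT hρ u a u := by
  have h := monoT_mul_star_monoT hρ u (CFC.sqrt a) u (CFC.sqrt a)
  rw [(CFC.sqrt_nonneg a).isSelfAdjoint.star_eq, CFC.sqrt_mul_sqrt_self a ha] at h
  rw [← h]
  exact mul_star_self_nonneg _

omit [PartialOrder A] [StarOrderedRing A] in
theorem monoT_mul_monoT_singleton (i j : ℕ) (a b : A) :
    monoT hρ [i] a [i] * monoT hρ [j] b [j] = if i = j then monoT hρ [i] (a * b) [i] else 0 := by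
  have h : mono ρ [i] a [i] * mono ρ [j] b [j] = consWord [i] * leftAct ρ a *
      (star (consWord [i]) * consWord [j]) * (leftAct ρ b * star (consWord [j])) := by
    simp only [mono, mul_assoc]
  split_ifs with hij
  · subst hij
    refine Subtype.ext ?_
    change mono ρ [i] a [i] * mono ρ [i] b [i] = mono ρ [i] (a * b) [i]
    rw [h, star_consWord_mul_self, mul_one]
    simp only [mono, map_mul, mul_assoc]
  · refine Subtype.ext ?_
    change mono ρ [i] a [i] * mono ρ [j] b [j] = 0
    rw [h, star_consWord_mul_of_length_eq (v := [i]) (u := [j]) rfl (by simpa using hij), mul_zero, zero_mul]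

/-- The summands are pairwise orthogonal, so squaring the sum K squares each coefficient; p² ≤ p
gives K² ≤ K, hence ‖K‖² ≤ ‖K‖. -/
theorem norm_sum_monoT_le (F : Finset ℕ) {p : A} (hp : 0 ≤ p) (hp1 : ‖p‖ ≤ 1) :
    ‖∑ n ∈ F, monoT hρ [n] p [n]‖ ≤ 1 := by
  set K := ∑ n ∈ F, monoT hρ [n] p [n] with hK
  have hK0 : 0 ≤ K := Finset.sum_nonneg fun n _ => monoT_nonneg hρ [n] hp
  have hKs : star K = K := hK0.isSelfAdjoint.star_eq
  have hKK : K * K = ∑ n ∈ F, monoT hρ [n] (p * p) [n] := by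
    rw [hK, Finset.sum_mul_sum]
    refine Finset.sum_congr rfl fun n hn => ?_
    rw [Finset.sum_eq_single_of_mem n hn, monoT_mul_monoT_singleton, if_pos rfl]
    intro m _ hm
    rw [monoT_mul_monoT_singleton, if_neg hm.symm]
  have hle : star K * K ≤ K := by
    rw [hKs, hKK, ← sub_nonneg, hK, ← Finset.sum_sub_distrib]
    refine Finset.sum_nonneg fun n _ => ?_
    have h1 : monoT hρ [n] p [n] - monoT hρ [n] (p * p) [n] = monoT hρ [n] (p - p * p) [n] := by
      rw [sub_eq_iff_eq_add]
      exact Subtype.ext (by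
        change mono ρ [n] p [n] = mono ρ [n] (p - p * p) [n] + mono ρ [n] (p * p) [n]
        rw [← mono_add, sub_add_cancel])
    rw [h1]
    exact monoT_nonneg hρ [n] (sub_nonneg.2 (mul_self_le_of_norm_le hp hp1))
  have h2 := CStarAlgebra.norm_le_norm_of_nonneg_of_le (star_mul_self_nonneg K) hle
  rw [CStarRing.norm_star_mul_self] at h2
  nlinarith [norm_nonneg K]

variable {φ : CStarWeight (toeplitz ρ)}

include hρ

theorem tendsto_incl_unitSqrt {τ : CStarWeight A} (hτ : τ.DenselyDefined) (b : toeplitz ρ) :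
    Tendsto (fun r : τ.FinIdx => star (incl ρ (CStarWeight.unitSqrt r)) * b *
      incl ρ (CStarWeight.unitSqrt r)) atTop (𝓝 b) :=
  tendsto_incl_conj hρ CStarWeight.norm_unitSqrt_le CStarWeight.star_unitSqrt
    hτ.tendsto_unitSqrt_mul b

/-- Insert the approximate unit of A. For X = a^{1/2} T_n e the element X*X = e ρ_n(a) e lies in A,
while XX* = a^{1/2} T_n e² T_n* a^{1/2}. Summing the latter over n stays below a, and the KMS
condition for X* translates this into the claim. -/
theorem tsum_val_le_of_isKMSWeight (hK : (quasiFreeFlow ρ x).IsKMSWeight β φ) {a : A}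
    (ha : 0 ≤ a) :
    ∑' n, ENNReal.ofReal (Real.exp (-β * x n)) * (φ.comap (incl ρ)).val (ρ n a) ≤
      (φ.comap (incl ρ)).val a := by
  have hpp := purePoint hρ x
  set τ := φ.comap (incl ρ) with hτ
  have htr : τ.IsTracial := hK.isTracial_comap (isEigen_incl x) hpp
  have hdd : τ.DenselyDefined := hK.denselyDefined_comap (isEigen_incl x) hpp
  have hlsc : LowerSemicontinuous τ.toFun :=
    CStarFlow.lowerSemicontinuous_comap hK.proper.lowerSemicontinuous _
  rw [ENNReal.tsum_eq_iSup_sum]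
  refine iSup_le fun F => ?_
  have h1 : ∀ n, ENNReal.ofReal (Real.exp (-β * x n)) * τ.val (ρ n a) =
      ⨆ r : τ.FinIdx, ENNReal.ofReal (Real.exp (-β * x n)) *
        τ.val (star (CStarWeight.unitSqrt r) * ρ n a * CStarWeight.unitSqrt r) := fun n => by
    rw [← ENNReal.mul_iSup, htr.iSup_conj hlsc hdd (map_nonneg (ρ n) ha)]
  simp only [h1]
  -- The compressions increase with r, so the finite sum and the supremum can be exchanged and one r
  -- serves all n.
  rw [ENNReal.finsetSum_iSup_of_monotone fun n => (htr.monotone_conj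
    (map_nonneg (ρ n) ha)).const_mul' _]
  refine iSup_le fun r => ?_
  set e := CStarWeight.unitSqrt r with he
  set s := CFC.sqrt a with hs
  have hss : star s = s := (CFC.sqrt_nonneg a).isSelfAdjoint.star_eq
  have hsa : s * s = a := CFC.sqrt_mul_sqrt_self a ha
  have hes : star e = e := CStarWeight.star_unitSqrt r
  have his : star (incl ρ s) = incl ρ s := by rw [← map_star, hss]
  have h2 : ∀ n, ENNReal.ofReal (Real.exp (-β * x n)) * τ.val (star e * ρ n a * e) =
      φ.val (star (incl ρ s) * monoT hρ [n] (CStarWeight.unit r) [n] * incl ρ s) := fun n => by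
    set X := incl ρ s * monoT hρ [n] e [] with hX
    have hXe : (quasiFreeFlow ρ x).IsEigen (x n) X := by
      have := (isEigen_incl (ρ := ρ) x s).mul (isEigen_monoT hρ x [n] e [])
      simpa using this
    have h3 := hK.val_eigen hpp hXe.conj
    have h4 : star X * X = incl ρ (star e * ρ n a * e) := by
      have := star_monoT_mul_incl_mul_monoT hρ [n] e (s * s) e
      rw [hsa] at this
      rw [hX, star_mul, his, mul_assoc, ← mul_assoc (incl ρ s), ← map_mul, hsa, ← mul_assoc, this]
      rfl
    have h5 : X * star X = star (incl ρ s) * monoT hρ [n] (CStarWeight.unit r) [n] * incl ρ s := by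
      rw [hX, star_mul, his, mul_assoc, ← mul_assoc (monoT hρ [n] e []), monoT_mul_star_monoT, hes,
        he, CStarWeight.unitSqrt_mul_self, mul_assoc]
    rw [star_star, h5, h4] at h3
    rw [h3, hτ, φ.val_comap _ (star_left_conjugate_nonneg (map_nonneg (ρ n) ha) e)]
    rw [show -β * x n = β * -x n by ring]
  simp only [h2]
  have hu0 := CStarWeight.unit_nonneg r
  rw [← φ.val_sum F _ fun n _ => star_left_conjugate_nonneg (monoT_nonneg hρ [n] hu0) _,
    ← Finset.sum_mul, ← Finset.mul_sum, show τ.val a = φ.val (incl ρ a) from φ.val_comap _ ha]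
  have hK0 : 0 ≤ ∑ n ∈ F, monoT hρ [n] (CStarWeight.unit r) [n] :=
    Finset.sum_nonneg fun n _ => monoT_nonneg hρ [n] hu0
  refine φ.val_mono (star_left_conjugate_nonneg hK0 _) ?_
  refine (CStarAlgebra.star_left_conjugate_le_norm_smul hK0.isSelfAdjoint).trans ?_
  rw [his, ← map_mul, hsa]
  exact (smul_le_smul_of_nonneg_right (norm_sum_monoT_le hρ F hu0 (CStarWeight.norm_unit_le r))
    (map_nonneg _ ha)).trans_eq (one_smul ℝ _)

theorem IsKMSWeight.isProper_comap_incl (hK : (quasiFreeFlow ρ x).IsKMSWeight β φ) :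
    (φ.comap (incl ρ)).IsProper :=
  hK.isProper_comap (isEigen_incl x) (fun hd b => tendsto_incl_unitSqrt hρ hd b) (purePoint hρ x)

/-- For W = e* Z the KMS condition expresses φ(WW*) through φ(W*W), and W*W lies in A by hypothesis,
where the two weights coincide. -/
theorem val_compress_eq {φ' : CStarWeight (toeplitz ρ)}
    (hK : (quasiFreeFlow ρ x).IsKMSWeight β φ) (hK' : (quasiFreeFlow ρ x).IsKMSWeight β φ')
    (hc : φ.comap (incl ρ) = φ'.comap (incl ρ)) {e : A} {s : ℝ} {Z : toeplitz ρ}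
    (hZ : (quasiFreeFlow ρ x).IsEigen s Z)
    (hZA : ∃ a, star Z * incl ρ (e * star e) * Z = incl ρ a) :
    (φ.conj (incl ρ e)).val (Z * star Z) = (φ'.conj (incl ρ e)).val (Z * star Z) := by
  obtain ⟨a, ha⟩ := hZA
  have hpp := purePoint hρ x
  set W := star (incl ρ e) * Z with hW
  have hWe : (quasiFreeFlow ρ x).IsEigen s W := by
    simpa using (isEigen_incl (ρ := ρ) x e).conj.mul hZ
  have h1 : star (incl ρ e) * (Z * star Z) * incl ρ e = W * star W := by
    rw [hW, star_mul, star_star]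
    simp only [mul_assoc]
  have h2 : star W * W = incl ρ a := by
    rw [hW, star_mul, star_star, ← ha, map_mul, map_star]
    simp only [mul_assoc]
  have ha0 : 0 ≤ incl ρ a := by rw [← h2]; exact star_mul_self_nonneg W
  have key : ∀ χ : CStarWeight (toeplitz ρ), (quasiFreeFlow ρ x).IsKMSWeight β χ →
      (χ.conj (incl ρ e)).val (Z * star Z) =
        ENNReal.ofReal (Real.exp (β * -s)) * χ.val (incl ρ a) := fun χ hχ => by
    have h3 := hχ.val_eigen hpp hWe.conj
    rw [star_star, h2] at h3
    rw [χ.val_conj' _ (mul_star_self_nonneg Z), h1, h3]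
  rw [key φ hK, key φ' hK']
  -- Only the image of a is known to be positive. Replacing a by |a| provides a positive element of
  -- A with the same image.
  have h4 : incl ρ (CFC.sqrt (star a * a)) = incl ρ a := by
    rw [map_sqrt _ (star_mul_self_nonneg a), map_mul, map_star, ha0.isSelfAdjoint.star_eq]
    exact CFC.sqrt_mul_self _ ha0
  have h5 := CFC.sqrt_nonneg (star a * a)
  rw [← h4, ← φ.val_comap _ h5, ← φ'.val_comap _ h5, hc]

/-- Different frequencies: both functionals vanish by invariance. Equal frequencies: the monomial is
XY* with X and Y eigenvectors of the same frequency, and polarization reduces it to squares ZZ* with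
Z* A Z inside A. -/
theorem lin_monoT_eq (hx : ∀ z : Circle, (fun _ : ℕ => z) ∈ torusClosure x)
    {φ' : CStarWeight (toeplitz ρ)}
    (hK : (quasiFreeFlow ρ x).IsKMSWeight β φ) (hK' : (quasiFreeFlow ρ x).IsKMSWeight β φ')
    (hc : φ.comap (incl ρ) = φ'.comap (incl ρ)) {e : A}
    (he : φ.val (star (incl ρ e) * incl ρ e) < ∞) (he' : φ'.val (star (incl ρ e) * incl ρ e) < ∞)
    (u : List ℕ) (a : A) (v : List ℕ) :
    (φ.conj (incl ρ e)).lin (monoT hρ u a v) = (φ'.conj (incl ρ e)).lin (monoT hρ u a v) := by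
  have hbd := CStarWeight.isBounded_conj he
  have hbd' := CStarWeight.isBounded_conj he'
  have hadd : ∀ a b : A, monoT hρ u (a + b) v = monoT hρ u a v + monoT hρ u b v := fun a b =>
    Subtype.ext (mono_add ρ u a b v)
  by_cases hs : (u.map x).sum = (v.map x).sum
  · have hl := length_eq_of_sum_eq hx hs
    have ha : a ∈ Submodule.span ℂ {a : A | 0 ≤ a} := by
      rw [CStarAlgebra.span_nonneg]
      trivial
    induction ha using Submodule.closure_induction with
    | zero =>
      have : monoT hρ u (0 : A) v = 0 := Subtype.ext (by simp [monoT, mono])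
      rw [this, hbd.lin_of_nonneg le_rfl, hbd'.lin_of_nonneg le_rfl]
      simp
    | add a b _ _ ha hb => rw [hadd, hbd.lin_add, hbd'.lin_add, ha, hb]
    | smul_mem c a ha =>
      set d := CFC.sqrt a with hd
      have hds : star d = d := (CFC.sqrt_nonneg a).isSelfAdjoint.star_eq
      set X := monoT hρ u (c • d) [] with hX
      set Y := monoT hρ v d [] with hY
      have hXY : monoT hρ u (c • a) v = X * star Y := by
        rw [hX, hY, monoT_mul_star_monoT, hds, smul_mul_assoc, hd, CFC.sqrt_mul_sqrt_self a ha]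
      -- The functional sees only the self-adjoint part, so this one polarization suffices.
      have hdec : X * star Y + star (X * star Y) =
          (X + Y) * star (X + Y) - (X * star X + Y * star Y) := by
        simp only [star_add, star_mul, star_star]
        noncomm_ring
      have hXe : (quasiFreeFlow ρ x).IsEigen (u.map x).sum X := by
        simpa using isEigen_monoT hρ x u (c • d) []
      have hYe : (quasiFreeFlow ρ x).IsEigen (u.map x).sum Y := by
        rw [hs]
        simpa using isEigen_monoT hρ x v d []
      have hXA := star_monoT_mul_incl_mul_monoT hρ u (c • d) (e * star e) (c • d)
      have hYA := star_monoT_mul_incl_mul_monoT hρ v d (e * star e) d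
      -- Equality of lengths is decisive here: distinct words of the same length have orthogonal
      -- ranges, so the cross terms vanish.
      have hZA : ∃ a, star (X + Y) * incl ρ (e * star e) * (X + Y) = incl ρ a := by
        by_cases huv : u = v
        · subst huv
          have : X + Y = monoT hρ u (c • d + d) [] := Subtype.ext (mono_add ρ u _ _ []).symm
          rw [this]
          exact ⟨_, star_monoT_mul_incl_mul_monoT hρ u _ _ _⟩
        · have e1 := star_monoT_mul_incl_mul_monoT_of_ne hρ hl huv (c • d) (e * star e) d
          have e2 := star_monoT_mul_incl_mul_monoT_of_ne hρ hl.symm (Ne.symm huv) d (e * star e)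
            (c • d)
          refine ⟨star (c • d) * wordHom ρ u (e * star e) * (c • d) +
            star d * wordHom ρ v (e * star e) * d, ?_⟩
          rw [star_add, add_mul, add_mul, mul_add, mul_add, e1, e2, add_zero, zero_add, hXA, hYA,
            ← map_add]
      have n1 := mul_star_self_nonneg (X + Y)
      have n2 := mul_star_self_nonneg X
      have n3 := mul_star_self_nonneg Y
      rw [hXY, hbd.lin_eq n1 (add_nonneg n2 n3) hdec, hbd'.lin_eq n1 (add_nonneg n2 n3) hdec,
        CStarWeight.val_add _ n2 n3, CStarWeight.val_add _ n2 n3,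
        val_compress_eq hρ hK hK' hc (hXe.add hYe) hZA,
        val_compress_eq hρ hK hK' hc hXe ⟨_, hXA⟩, val_compress_eq hρ hK hK' hc hYe ⟨_, hYA⟩]
  · have hfix : ∀ t, (quasiFreeFlow ρ x).toFun t (incl ρ e) = incl ρ e := fun t =>
      quasiFreeFlow_incl ρ x t e
    have hinv : ∀ χ : CStarWeight (toeplitz ρ), (quasiFreeFlow ρ x).IsKMSWeight β χ → ∀ t b, 0 ≤ b →
        (χ.conj (incl ρ e)).val ((quasiFreeFlow ρ x).toFun t b) = (χ.conj (incl ρ e)).val b := by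
      intro χ hχ t b hb
      rw [χ.val_conj' _ hb, χ.val_conj' _ (map_nonneg _ hb),
        ← hχ.invariant_val t _ (star_left_conjugate_nonneg hb (incl ρ e)), map_mul, map_mul,
        map_star, hfix]
    have hs' := sub_ne_zero.2 hs
    rw [(isEigen_monoT hρ x u a v).lin_eq_zero hbd (hinv φ hK) hs',
      (isEigen_monoT hρ x u a v).lin_eq_zero hbd' (hinv φ' hK') hs']

/-- A KMS weight is determined by its restriction to the coefficient algebra. -/
theorem eq_of_comap_eq (hx : ∀ z : Circle, (fun _ : ℕ => z) ∈ torusClosure x)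
    {φ' : CStarWeight (toeplitz ρ)}
    (hK : (quasiFreeFlow ρ x).IsKMSWeight β φ) (hK' : (quasiFreeFlow ρ x).IsKMSWeight β φ')
    (hc : φ.comap (incl ρ) = φ'.comap (incl ρ)) : φ = φ' := by
  refine CStarWeight.ext_val fun b hb => ?_
  have hpp := purePoint hρ x
  -- The restriction is a separate variable τ so that the suprema for both weights run over the same
  -- index type.
  have h1 : ∀ (χ : CStarWeight (toeplitz ρ)) (τ : CStarWeight A), χ.comap (incl ρ) = τ →
      (quasiFreeFlow ρ x).IsKMSWeight β χ →
      (∀ r : τ.FinIdx, χ.val (star (incl ρ (CStarWeight.unitSqrt r)) *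
        incl ρ (CStarWeight.unitSqrt r)) < ∞) ∧
      χ.val b = ⨆ r : τ.FinIdx, χ.val (star (incl ρ (CStarWeight.unitSqrt r)) * b *
        incl ρ (CStarWeight.unitSqrt r)) := by
    rintro χ τ rfl hχ
    exact ⟨fun r => CStarFlow.val_unitSqrt_lt_top r, (hχ.iSup_conj (isEigen_incl x)
      (fun hd b => tendsto_incl_unitSqrt hρ hd b) hpp hb).symm⟩
  obtain ⟨f1, e1⟩ := h1 φ _ rfl hK
  obtain ⟨f2, e2⟩ := h1 φ' _ hc.symm hK'
  rw [e1, e2]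
  refine iSup_congr fun r => ?_
  set e := CStarWeight.unitSqrt r
  have hbd := CStarWeight.isBounded_conj (f1 r)
  have hbd' := CStarWeight.isBounded_conj (f2 r)
  have h2 : (φ.conj (incl ρ e)).lin b = (φ'.conj (incl ρ e)).lin b := by
    refine toeplitz_induction hρ
      (p := fun b => (φ.conj (incl ρ e)).lin b = (φ'.conj (incl ρ e)).lin b) ?_ ?_ ?_ b
    · exact isClosed_eq hbd.continuous_lin hbd'.continuous_lin
    · exact lin_monoT_eq hρ hx hK hK' hc (f1 r) (f2 r)
    · intro a b ha hb
      rw [hbd.lin_add, hbd'.lin_add, ha, hb]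
  rw [hbd.lin_of_nonneg hb, hbd'.lin_of_nonneg hb] at h2
  rw [← φ.val_conj' _ hb, ← φ'.val_conj' _ hb,
    ← ENNReal.toReal_eq_toReal_iff' (hbd.ne_top hb) (hbd'.ne_top hb)]
  linarith

end Restriction
end ToeplitzKMS

namespace ToeplitzKMS

/-! ### The Pedersen ideal -/

section Pedersen

variable {A : Type*} [NonUnitalCStarAlgebra A]

/-- In the unitization (1 - y)⁻¹ = 1 + z; the element z is the nonscalar part of the Neumann
inverse. -/
theorem exists_quasi_inverse {y : A} (hy : ‖y‖ < 1) : ∃ z : A, z = y + z * y := by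
  have h1 : ‖(y : Unitization ℂ A)‖ < 1 := by rwa [Unitization.norm_inr]
  let u := Units.oneSub (y : Unitization ℂ A) h1
  have hu : (u⁻¹ : (Unitization ℂ A)ˣ).1 * (1 - (y : Unitization ℂ A)) = 1 := u.inv_mul
  rw [sub_eq_add_neg] at hu
  have h2 := congrArg (fun t => t.fst) hu
  have h3 := congrArg (fun t => t.snd) hu
  simp only [Unitization.fst_mul, Unitization.fst_add, Unitization.fst_neg, Unitization.fst_one,
    Unitization.fst_inr, neg_zero, add_zero, mul_one] at h2
  simp only [Unitization.snd_mul, Unitization.snd_add, Unitization.snd_neg, Unitization.snd_one,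
    Unitization.snd_inr, Unitization.fst_add, Unitization.fst_neg, Unitization.fst_one,
    Unitization.fst_inr, neg_zero, add_zero, zero_add, h2, one_smul, mul_neg] at h3
  refine ⟨(u⁻¹ : (Unitization ℂ A)ˣ).1.snd, ?_⟩
  rw [← sub_eq_zero, ← h3]
  abel

variable [PartialOrder A] [StarOrderedRing A]

/-- The element `(a - ε)₊`. -/
noncomputable def cutoff (ε : ℝ) (a : A) : A := cfcₙ (fun x : ℝ => max (x - ε) 0) a

theorem cutoff_nonneg (ε : ℝ) (a : A) : 0 ≤ cutoff ε a := cfcₙ_nonneg fun _ _ => le_max_right _ _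

theorem cutoff_le {ε : ℝ} (hε : 0 < ε) {a : A} (ha : 0 ≤ a) : cutoff ε a ≤ a := by
  conv_rhs => rw [← cfcₙ_id' ℝ a]
  refine cfcₙ_mono (fun x hx => ?_) (by fun_prop) (by fun_prop) (by simpa using hε.le) rfl
  have := nonneg_of_mem_quasispectrum ha hx
  exact max_le (by linarith) this

theorem norm_sub_cutoff_le {ε : ℝ} (hε : 0 < ε) {a : A} (ha : 0 ≤ a) : ‖a - cutoff ε a‖ ≤ ε := by
  have h0 : max ((0 : ℝ) - ε) 0 = 0 := by simpa using hε.le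
  have : a - cutoff ε a = cfcₙ (fun x : ℝ => x - max (x - ε) 0) a := by
    rw [cfcₙ_sub (fun x : ℝ => x) (fun x => max (x - ε) 0) a (by fun_prop) rfl (by fun_prop) h0,
      cfcₙ_id' ℝ a, cutoff]
  rw [this]
  refine norm_cfcₙ_le fun x hx => ?_
  have := nonneg_of_mem_quasispectrum ha hx
  rw [Real.norm_eq_abs, abs_le]
  rcases max_cases (x - ε) 0 with h | h <;> constructor <;> linarith

/-- Let g = (a - ε)₊ and let m satisfy m a g = g. For c in I near a, the element m c g = (1 - m(a -
c)) g lies in I, and 1 - m(a - c) is invertible in the unitization, so g lies in I. -/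
theorem cutoff_mem {I : Submodule ℂ A} (hI : IsAlgIdeal I) (hd : Dense (I : Set A)) {a : A}
    (ha : 0 ≤ a) {ε : ℝ} (hε : 0 < ε) : cutoff ε a ∈ I := by
  -- This function equals 1/x for x ≥ ε and vanishes at 0, as functional calculus without a unit
  -- requires.
  set h : ℝ → ℝ := fun x => x / max x ε ^ 2 with hh
  have hm : ∀ x, 0 < max x ε := fun x => lt_max_of_lt_right hε
  have hc : Continuous h := by
    refine continuous_id.div (by fun_prop) fun x => ?_
    have := hm x
    positivity
  have h0 : max ((0 : ℝ) - ε) 0 = 0 := by simpa using hε.le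
  have hh0 : h 0 = 0 := by simp [hh]
  set m := cfcₙ h a with hm'
  set g := cutoff ε a with hg
  have hmag : m * a * g = g := by
    have e1 : m * a = cfcₙ (fun x => h x * x) a := by
      rw [cfcₙ_mul h (fun x => x) a hc.continuousOn hh0 (by fun_prop) rfl, cfcₙ_id' ℝ a]
    rw [e1, hg, cutoff, ← cfcₙ_mul (fun x => h x * x) (fun x => max (x - ε) 0) a
      (by fun_prop) (by simp) (by fun_prop) h0]
    refine cfcₙ_congr fun x _ => ?_
    rcases le_total x ε with hx | hx
    · simp [max_eq_right (sub_nonpos.2 hx)]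
    · have : x ≠ 0 := (hε.trans_le hx).ne'
      simp only [hh, max_eq_left hx]
      field_simp
  obtain ⟨c, hc', hca⟩ := Metric.mem_closure_iff.1 (hd a) (1 / (‖m‖ + 1)) (by positivity)
  have hy : ‖m * (a - c)‖ < 1 := by
    rw [dist_eq_norm] at hca
    calc _ ≤ ‖m‖ * ‖a - c‖ := norm_mul_le _ _
      _ ≤ (‖m‖ + 1) * ‖a - c‖ := by gcongr; linarith
      _ < (‖m‖ + 1) * (1 / (‖m‖ + 1)) := by gcongr
      _ = 1 := by field_simp
  obtain ⟨z, hz⟩ := exists_quasi_inverse hy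
  have hmem : m * c * g ∈ I := (hI _ (hI c hc' m).2 g).1
  have hgz : g = m * c * g + z * (m * c * g) := by
    have e2 : m * c * g = g - m * (a - c) * g := by
      rw [mul_sub, sub_mul, hmag]
      abel
    have e3 : z * g = m * (a - c) * g + z * (m * (a - c) * g) := by
      conv_lhs => rw [hz, add_mul, mul_assoc z]
    rw [e2, mul_sub z, e3]
    abel
  rw [hgz]
  exact I.add_mem hmem (hI _ hmem z).2

theorem cutoff_mem_pedersenIdeal {a : A} (ha : 0 ≤ a) {ε : ℝ} (hε : 0 < ε) :
    cutoff ε a ∈ pedersenIdeal A :=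
  Submodule.mem_sInf.2 fun _ hI => cutoff_mem hI.1 hI.2 ha hε

end Pedersen

/-! ### The branching sum of a weight -/

section Branch

variable {A : Type*} [NonUnitalCStarAlgebra A] [PartialOrder A] [StarOrderedRing A]

namespace CStarWeight

/-- A lower semicontinuous weight is countably additive. -/
theorem val_hasSum {φ : CStarWeight A} (hφ : LowerSemicontinuous φ.toFun) {ι : Type*} {f : ι → A}
    {a : A} (hf : ∀ i, 0 ≤ f i) (h : HasSum f a) : φ.val a = ∑' i, φ.val (f i) := by
  refine le_antisymm ?_ ?_
  · refine val_le_of_tendsto hφ (fun s => Finset.sum_nonneg fun i _ => hf i) h fun s => ?_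
    rw [φ.val_sum s f fun i _ => hf i]
    exact ENNReal.sum_le_tsum s
  · rw [ENNReal.tsum_eq_iSup_sum]
    refine iSup_le fun s => ?_
    rw [← φ.val_sum s f fun i _ => hf i]
    exact φ.val_mono (Finset.sum_nonneg fun i _ => hf i) (sum_le_hasSum s (fun i _ => hf i) h)

/-- The weight `a ↦ ∑ n, exp (-β x_n) τ(ρ_n(a))`, as a function. -/
noncomputable def branch (τ : CStarWeight A) (ρ : ℕ → A →⋆ₙₐ[ℂ] A) (x : ℕ → ℝ) (β : ℝ) (a : A) :
    ℝ≥0∞ := ∑' n, ENNReal.ofReal (Real.exp (-β * x n)) * τ.val (ρ n a)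

variable {τ : CStarWeight A} {ρ : ℕ → A →⋆ₙₐ[ℂ] A} {x : ℕ → ℝ} {β : ℝ}

theorem branch_hasSum (hτ : LowerSemicontinuous τ.toFun) {ι : Type*} {f : ι → A}
    {a : A} (hf : ∀ i, 0 ≤ f i) (h : HasSum f a) :
    τ.branch ρ x β a = ∑' i, τ.branch ρ x β (f i) := by
  simp only [branch]
  rw [ENNReal.tsum_comm]
  refine tsum_congr fun n => ?_
  rw [val_hasSum hτ (f := fun i => ρ n (f i)) (fun i => map_nonneg _ (hf i))
    (h.map (ρ n) (map_continuous (ρ n))), ENNReal.tsum_mul_left]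

/-- If the branching sum is dominated by `τ` on the Pedersen ideal, then everywhere. -/
theorem branch_le (hτ : LowerSemicontinuous τ.toFun)
    (h : ∀ a, 0 ≤ a → a ∈ pedersenIdeal A → τ.branch ρ x β a ≤ τ.val a) {a : A} (ha : 0 ≤ a) :
    τ.branch ρ x β a ≤ τ.val a := by
  have h1 : LowerSemicontinuous fun a : {a : A // 0 ≤ a} => τ.branch ρ x β a.1 := by
    have h2 : ∀ n, LowerSemicontinuous fun a : {a : A // 0 ≤ a} =>
        ENNReal.ofReal (Real.exp (-β * x n)) * τ.val (ρ n a.1) := fun n => by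
      have h3 := CStarFlow.lowerSemicontinuous_comap hτ (ρ n)
      have h4 : Continuous fun y : ℝ≥0∞ => ENNReal.ofReal (Real.exp (-β * x n)) * y :=
        ENNReal.continuous_const_mul ENNReal.ofReal_ne_top
      have h5 := h4.comp_lowerSemicontinuous h3 fun _ _ h => mul_le_mul_right h _
      convert h5 using 1
      funext a
      rw [Function.comp_apply, toFun_eq_val, val_comap _ _ a.2]
    exact lowerSemicontinuous_tsum h2
  have h6 : Tendsto (fun k : ℕ => (⟨cutoff (1 / ((k : ℝ) + 1)) a, cutoff_nonneg _ a⟩ :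
      {a : A // 0 ≤ a})) atTop (𝓝 ⟨a, ha⟩) := by
    rw [tendsto_subtype_rng, tendsto_iff_norm_sub_tendsto_zero]
    refine squeeze_zero (fun _ => norm_nonneg _) (fun k => ?_) tendsto_one_div_add_atTop_nhds_zero_nat
    rw [norm_sub_rev]
    exact norm_sub_cutoff_le (by positivity) ha
  -- The sublevel set of the branching sum at height τ(a) is closed by lower semicontinuity,
  -- contains all cutoffs of a, and hence contains their limit a.
  have h7 := (h1.isClosed_preimage (τ.val a)).mem_of_tendsto h6 (Eventually.of_forall fun k => by
    have hk : (0 : ℝ) < 1 / ((k : ℝ) + 1) := by positivity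
    exact (h _ (cutoff_nonneg _ a) (cutoff_mem_pedersenIdeal ha hk)).trans
      (τ.val_mono (cutoff_nonneg _ a) (cutoff_le hk ha)))
  exact h7

end CStarWeight
end Branch
end ToeplitzKMS

namespace ToeplitzKMS

open StdModule

/-! ### Matrix entries of elements of the Toeplitz–Pimsner algebra -/

section Columns

variable {A : Type*} [NonUnitalCStarAlgebra A]

theorem eq_of_forall_mul_eq {x y : A} (h : ∀ a, x * a = y * a) : x = y := by
  rw [← sub_eq_zero, ← CStarRing.mul_star_self_eq_zero_iff, sub_mul, h, sub_self]

theorem StdModule.Adjointable.map_rsmul {ι : Type*} (T : Adjointable ι A) (f : StdModule ι A)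
    (a : A) : T (f.rsmul a) = (T f).rsmul a := by
  refine eq_of_ip_eq fun k => ?_
  have h : ∀ g, ip k (T g) = ip (star T k) g := fun g => by
    have := ip_star_right (star T) k g
    rwa [star_star] at this
  rw [h, ip_rsmul, ip_rsmul, h]

variable {ι : Type*} [DecidableEq ι]

theorem ip_single (i : ι) (a : A) (f : StdModule ι A) : ip (single i a) f = star a * f i := by
  rw [ip, tsum_eq_single i]
  · rw [single_apply, if_pos rfl]
  · intro j hj
    rw [single_apply, if_neg hj, star_zero, zero_mul]

theorem norm_single (i : ι) (a : A) : ‖single i a‖ = ‖a‖ := by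
  rw [StdModule.norm_def, ip_single, single_apply, if_pos rfl, CStarRing.norm_star_mul_self,
    Real.sqrt_mul_self (norm_nonneg a)]

/-- `ξ` is the column of `T` at `w`. -/
def IsCol (T : Adjointable ι A) (w : ι) (ξ : StdModule ι A) : Prop :=
  ∀ a, T (single w a) = ξ.rsmul a

theorem IsCol.apply {T : Adjointable ι A} {w : ι} {ξ : StdModule ι A} (h : IsCol T w ξ) (a : A)
    (v : ι) : T (single w a) v = ξ v * a := by
  rw [h a, rsmul_apply]

theorem IsCol.add {T S : Adjointable ι A} {w : ι} {ξ η : StdModule ι A} (h : IsCol T w ξ)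
    (h' : IsCol S w η) : IsCol (T + S) w (ξ + η) := fun a => by
  ext v
  rw [Adjointable.add_apply, StdModule.add_apply, h.apply, h'.apply, rsmul_apply, StdModule.add_apply, add_mul]

theorem IsCol.smul {T : Adjointable ι A} {w : ι} {ξ : StdModule ι A} (h : IsCol T w ξ) (c : ℂ) :
    IsCol (c • T) w (c • ξ) := fun a => by
  ext v
  rw [Adjointable.smul_apply, StdModule.smul_apply, h.apply, rsmul_apply, StdModule.smul_apply, smul_mul_assoc]

theorem IsCol.mul_left {T : Adjointable ι A} {w : ι} {ξ : StdModule ι A} (h : IsCol T w ξ)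
    (S : Adjointable ι A) : IsCol (S * T) w (S ξ) := fun a => by
  rw [Adjointable.mul_apply, h a, S.map_rsmul]

/-- Without a unit there is no vector δ_w ⊗ 1 to test on. Testing on δ_w ⊗ p with p = ⟨ξ, ξ⟩ bounds
‖p‖³ by ‖T‖² ‖p‖², up to one more factor ‖p‖ on both sides. -/
theorem IsCol.norm_le {T : Adjointable ι A} {w : ι} {ξ : StdModule ι A} (h : IsCol T w ξ) :
    ‖ξ‖ ≤ ‖T‖ := by
  set p := ip ξ ξ with hp
  have hps : star p = p := star_ip ξ ξ
  have h1 : ∀ a : A, ‖star a * p * a‖ ≤ (‖T‖ * ‖a‖) ^ 2 := fun a => by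
    have h2 := T.le_opNorm (single w a)
    rw [norm_single, h a] at h2
    have h3 : ip (ξ.rsmul a) (ξ.rsmul a) = star a * p * a := by
      rw [ip_rsmul, ← star_ip, ip_rsmul, star_mul, hps]
    rw [← h3, ← norm_sq]
    gcongr
  have h4 : ‖p‖ ^ 2 * ‖p‖ ^ 2 ≤ (‖T‖ * ‖p‖) ^ 2 * ‖p‖ := by
    have h5 : ‖p‖ * ‖p‖ = ‖p * p‖ := by
      conv_rhs => rw [← hps]
      rw [hps, ← CStarRing.norm_star_mul_self, hps]
    have h6 : ‖p * p‖ * ‖p * p‖ = ‖star p * p * p * p‖ := by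
      rw [← CStarRing.norm_star_mul_self, star_mul, hps]
      simp only [mul_assoc]
    rw [sq, h5, h6]
    exact (norm_mul_le _ _).trans (by gcongr; exact h1 p)
  have h7 : ‖p‖ ≤ ‖T‖ ^ 2 := by
    rcases (norm_nonneg p).eq_or_lt with h0 | h0
    · rw [← h0]
      positivity
    · have : 0 < ‖p‖ ^ 3 := by positivity
      nlinarith
  rw [← norm_sq] at h7
  exact le_of_sq_le_sq h7 (norm_nonneg _)

theorem isClosed_exists_isCol (w : ι) : IsClosed {T : Adjointable ι A | ∃ ξ, IsCol T w ξ} := by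
  refine isSeqClosed_iff_isClosed.1 fun T S hT hS => ?_
  choose ξ hξ using hT
  have hsub : ∀ m n, IsCol (T m - T n) w (ξ m - ξ n) := fun m n => by
    have := (hξ m).add ((hξ n).smul (-1))
    simpa [sub_eq_add_neg] using this
  have hc : CauchySeq ξ := by
    have := hS.cauchySeq
    rw [Metric.cauchySeq_iff] at this ⊢
    intro ε hε
    obtain ⟨N, hN⟩ := this ε hε
    refine ⟨N, fun m hm n hn => lt_of_le_of_lt ?_ (hN m hm n hn)⟩
    rw [dist_eq_norm, dist_eq_norm]
    exact (hsub m n).norm_le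
  obtain ⟨η, hη⟩ := cauchySeq_tendsto_of_complete hc
  refine ⟨η, fun a => ?_⟩
  ext v
  have hev : ∀ {u : ℕ → StdModule ι A} {g : StdModule ι A}, Tendsto u atTop (𝓝 g) →
      Tendsto (fun n => u n v) atTop (𝓝 (g v)) := fun {u g} hu => by
    rw [tendsto_iff_norm_sub_tendsto_zero] at hu ⊢
    exact squeeze_zero (fun _ => norm_nonneg _) (fun n => norm_apply_le (u n - g) v) hu
  have h1 : Tendsto (fun n => T n (single w a)) atTop (𝓝 (S (single w a))) := by
    rw [tendsto_iff_norm_sub_tendsto_zero] at hS ⊢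
    refine squeeze_zero (fun _ => norm_nonneg _) (fun n => ?_)
      (by simpa using hS.mul_const ‖single w a‖)
    exact (T n - S).le_opNorm (single w a)
  refine tendsto_nhds_unique (hev h1) ?_
  simp only [fun n => (hξ n).apply a v]
  exact (hev hη).mul_const a

end Columns

/-! ### Entries at pairs of words: products, flow, and diagonals of monomials. -/

section Entries

variable {A : Type*} [NonUnitalCStarAlgebra A] {ρ : ℕ → A →⋆ₙₐ[ℂ] A}

theorem consWord_apply_append (u : List ℕ) (f : Fock A) (l : List ℕ) :
    (consWord u) f (u ++ l) = f l := by
  induction u with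
  | nil => rfl
  | cons i u ih =>
    change consFun i ((consWord u) f) (i :: (u ++ l)) = f l
    rw [consFun_cons, ih]

theorem consWord_apply_of_not_prefix {u l : List ℕ} (h : ¬ u <+: l) (f : Fock A) :
    (consWord u) f l = 0 := by
  induction u generalizing l with
  | nil => exact absurd List.nil_prefix h
  | cons i u ih =>
    change consFun i ((consWord u) f) l = 0
    match l with
    | [] => rfl
    | j :: l =>
      by_cases hj : j = i
      · subst hj
        rw [consFun_cons]
        exact ih fun h' => h (by simpa using h')
      · exact if_neg hj

theorem star_consWord_apply (v : List ℕ) (f : Fock A) (l : List ℕ) :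
    (star (consWord v : Adjointable (List ℕ) A)) f l = f (v ++ l) := by
  induction v generalizing f l with
  | nil =>
    rw [consWord, star_one]
    rfl
  | cons i v ih =>
    rw [consWord, star_mul]
    change (star (consWord v : Adjointable (List ℕ) A)) ((star (consOp i)) f) l = _
    rw [ih, star_consOp_apply]
    rfl

theorem exists_isCol_mono (u : List ℕ) (a : A) (v w : List ℕ) : ∃ ξ, IsCol (mono ρ u a v) w ξ := by
  suffices h : ∃ ξ, IsCol (leftAct ρ a * star (consWord v)) w ξ by
    obtain ⟨ξ, hξ⟩ := h
    rw [mono, mul_assoc]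
    exact ⟨_, hξ.mul_left _⟩
  by_cases h : ∃ l, w = v ++ l
  · obtain ⟨w', rfl⟩ := h
    refine ⟨single w' (wordHom ρ w' a), fun b => ?_⟩
    ext l
    change wordHom ρ l a * (star (consWord v : Adjointable (List ℕ) A)) _ l = _
    rw [star_consWord_apply, single_apply, rsmul_apply, single_apply]
    by_cases hl : l = w'
    · subst hl
      simp
    · simp [hl]
  · refine ⟨0, fun b => ?_⟩
    ext l
    change wordHom ρ l a * (star (consWord v : Adjointable (List ℕ) A)) _ l = _
    rw [star_consWord_apply, single_apply, if_neg fun h' => h ⟨l, h'.symm⟩, rsmul_apply, mul_zero,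
      StdModule.zero_apply, zero_mul]

/-- This is not automatic for adjointable operators: the identity has no column when A has no unit.
Monomials have columns, and the property survives linear combinations and norm limits. -/
theorem exists_isCol {T : Adjointable (List ℕ) A} (hT : T ∈ toeplitz ρ) (w : List ℕ) :
    ∃ ξ, IsCol T w ξ := by
  refine closure_minimal (t := {T : Adjointable (List ℕ) A | ∃ ξ, IsCol T w ξ}) ?_
    (isClosed_exists_isCol w) (toeplitz_le_closure_monoSpan ρ hT)
  intro S hS
  change S ∈ Submodule.span ℂ _ at hS
  induction hS using Submodule.span_induction with
  | mem S hS =>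
    obtain ⟨m, rfl⟩ := hS
    exact exists_isCol_mono _ _ _ _
  | zero => exact ⟨0, fun a => by ext v; simp⟩
  | add S S' _ _ h h' =>
    obtain ⟨ξ, hξ⟩ := h
    obtain ⟨η, hη⟩ := h'
    exact ⟨_, hξ.add hη⟩
  | smul c S _ h =>
    obtain ⟨ξ, hξ⟩ := h
    exact ⟨_, hξ.smul c⟩

/-- The matrix entry of `b` at the words `v`, `w`. -/
noncomputable def ent (b : toeplitz ρ) (v w : List ℕ) : A := (exists_isCol b.2 w).choose v

theorem ent_mul (b : toeplitz ρ) (v w : List ℕ) (a : A) : ent b v w * a = b.1 (single w a) v :=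
  ((exists_isCol b.2 w).choose_spec.apply a v).symm

theorem ent_eq_of {b : toeplitz ρ} {v w : List ℕ} {c : A}
    (h : ∀ a, b.1 (single w a) v = c * a) : ent b v w = c :=
  eq_of_forall_mul_eq fun a => by rw [ent_mul, h]

theorem ent_add (b c : toeplitz ρ) (v w : List ℕ) : ent (b + c) v w = ent b v w + ent c v w :=
  ent_eq_of fun a => by
    rw [add_mul, ent_mul, ent_mul]
    rfl

theorem ent_smul (r : ℂ) (b : toeplitz ρ) (v w : List ℕ) : ent (r • b) v w = r • ent b v w :=
  ent_eq_of fun a => by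
    rw [smul_mul_assoc, ent_mul]
    rfl

theorem ent_star (b : toeplitz ρ) (v w : List ℕ) : ent (star b) v w = star (ent b w v) := by
  refine ent_eq_of fun a => ?_
  refine star_injective (eq_of_forall_mul_eq fun c => star_injective ?_)
  have h1 := ip_star_right b.1 (single v c) (single w a)
  rw [ip_single, ← star_ip, ip_single, ← ent_mul, star_mul, star_star] at h1
  simp only [star_mul, star_star, mul_assoc] at h1 ⊢
  exact h1

theorem norm_ent_le (b : toeplitz ρ) (v w : List ℕ) : ‖ent b v w‖ ≤ ‖b‖ :=
  (norm_apply_le _ v).trans (exists_isCol b.2 w).choose_spec.norm_le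

/-- Entries of b*c are inner products of columns, so the sum converges in norm; countable additivity
of the trace can then be applied. -/
theorem hasSum_ent (b c : toeplitz ρ) (w w' : List ℕ) :
    HasSum (fun v => star (ent b v w) * ent c v w') (ent (star b * c) w w') := by
  have h : ent (star b * c) w w' =
      ip (exists_isCol b.2 w).choose (exists_isCol c.2 w').choose := by
    refine ent_eq_of fun a => star_injective (eq_of_forall_mul_eq fun d => star_injective ?_)
    have h1 := ip_star_right b.1 (single w d) (c.1 (single w' a))
    rw [ip_single, (exists_isCol b.2 w).choose_spec d, (exists_isCol c.2 w').choose_spec a,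
      ip_rsmul, ← star_ip, ip_rsmul, star_mul, star_ip] at h1
    rw [star_mul, star_star, star_mul, star_star, ← mul_assoc, ← h1,
      ← (exists_isCol c.2 w').choose_spec a]
    rfl
  rw [h]
  exact (summable_ip _ _).hasSum

theorem ent_incl_mul (e : A) (b : toeplitz ρ) (v w : List ℕ) :
    ent (incl ρ e * b) v w = wordHom ρ v e * ent b v w :=
  ent_eq_of fun a => by
    rw [mul_assoc, ent_mul]
    rfl

theorem ent_mul_incl (b : toeplitz ρ) (e : A) (v w : List ℕ) :
    ent (b * incl ρ e) v w = ent b v w * wordHom ρ w e := by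
  have := ent_star (star (incl ρ e) * star b) v w
  rw [star_mul, star_star, star_star] at this
  rw [this, ← map_star, ent_incl_mul, ent_star, star_mul, star_star, map_star, star_star]

theorem ent_incl (a : A) (w : List ℕ) : ent (incl ρ a) w w = wordHom ρ w a :=
  ent_eq_of fun b => by
    change wordHom ρ w a * (single w b : Fock A) w = _
    rw [single_apply, if_pos rfl]

theorem ent_flow (x : ℕ → ℝ) (t : ℝ) (b : toeplitz ρ) (v w : List ℕ) :
    ent ((quasiFreeFlow ρ x).toFun t b) v w =
      Complex.exp ((((v.map x).sum - (w.map x).sum) * t : ℝ) * Complex.I) • ent b v w := by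
  refine ent_eq_of fun a => ?_
  change fockConj x t b.1 (single w a) v = _
  have h : phaseOp (fun l : List ℕ => -((l.map x).sum * t)) (single w a) =
      Complex.exp ((-((w.map x).sum * t) : ℝ) * Complex.I) • (single w a : Fock A) := by
    ext l
    rw [phaseOp_apply, StdModule.smul_apply, single_apply]
    by_cases hl : l = w
    · rw [hl]
    · rw [if_neg hl, smul_zero, smul_zero]
  rw [fockConj_apply, h, map_smul, StdModule.smul_apply, smul_smul, ← Complex.exp_add, ← ent_mul,
    smul_mul_assoc]
  congr 2
  push_cast
  ring

/-- The flow multiplies the entry by the phase of x_v - x_w, the eigenvector equation by the phase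
of s. At a suitable time the two differ by a sign. -/
theorem ent_eq_zero_of_isEigen {x : ℕ → ℝ} {s : ℝ} {b : toeplitz ρ}
    (hb : (quasiFreeFlow ρ x).IsEigen s b) {v w : List ℕ}
    (h : (v.map x).sum - (w.map x).sum ≠ s) : ent b v w = 0 := by
  set d := (v.map x).sum - (w.map x).sum with hd
  have h0 : d - s ≠ 0 := sub_ne_zero.2 h
  have h1 := ent_flow x (Real.pi / (d - s)) b v w
  rw [hb, ent_smul, ← hd] at h1
  have h2 : Complex.exp ((d * (Real.pi / (d - s)) : ℝ) * Complex.I) =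
      -Complex.exp ((s * (Real.pi / (d - s)) : ℝ) * Complex.I) := by
    have h3 : d * (Real.pi / (d - s)) = s * (Real.pi / (d - s)) + Real.pi := by
      field_simp
      ring
    rw [h3, Complex.ofReal_add, add_mul, Complex.exp_add, Complex.exp_pi_mul_I, mul_neg_one]
  rw [h2, neg_smul, eq_neg_iff_add_eq_zero, ← two_smul ℂ, smul_smul, smul_eq_zero] at h1
  exact h1.resolve_left (mul_ne_zero two_ne_zero (Complex.exp_ne_zero _))

theorem wordHom_append_singleton (l : List ℕ) (n : ℕ) (a : A) :
    wordHom ρ (l ++ [n]) a = ρ n (wordHom ρ l a) := by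
  induction l generalizing a with
  | nil => rfl
  | cons i l ih => exact ih (ρ i a)

section Monomials

variable (hρ : ∀ n, IsNondegenerate (ρ n))

theorem ent_monoT_append (u : List ℕ) (a : A) (l : List ℕ) :
    ent (monoT hρ u a u) (u ++ l) (u ++ l) = wordHom ρ l a := by
  refine ent_eq_of fun b => ?_
  change (consWord u) ((leftAct ρ a) ((star (consWord u : Adjointable (List ℕ) A)) _)) (u ++ l) = _
  rw [consWord_apply_append, leftAct_apply, star_consWord_apply, single_apply, if_pos rfl]

theorem ent_monoT_of_not_prefix {u : List ℕ} (a : A) (v : List ℕ) {w : List ℕ} (h : ¬ u <+: w) :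
    ent (monoT hρ u a v) w w = 0 := by
  refine ent_eq_of fun b => ?_
  change (consWord u) ((leftAct ρ a * star (consWord v) : Adjointable (List ℕ) A) _) w = _
  rw [consWord_apply_of_not_prefix h, zero_mul]

theorem ent_monoT_of_ne {u : List ℕ} (a : A) {v : List ℕ} (w : List ℕ) (h : u ≠ v) :
    ent (monoT hρ u a v) w w = 0 := by
  by_cases hp : u <+: w
  · obtain ⟨l, rfl⟩ := hp
    refine ent_eq_of fun b => ?_
    change (consWord u) ((leftAct ρ a) ((star (consWord v : Adjointable (List ℕ) A)) _)) (u ++ l) = _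
    rw [consWord_apply_append, leftAct_apply, star_consWord_apply, single_apply,
      if_neg fun h' => h (List.append_cancel_right h').symm, mul_zero, zero_mul]
  · exact ent_monoT_of_not_prefix hρ a v hp

/-- A diagonal entry at w is nonzero only if u = v is a prefix, w = u ++ l, and it is then ρ_l(a).
The length condition excludes that u becomes a prefix only after n is appended. -/
theorem ent_monoT_append_singleton (u : List ℕ) (a : A) (v : List ℕ) {w : List ℕ}
    (hw : u.length ≤ w.length) (n : ℕ) :
    ent (monoT hρ u a v) (w ++ [n]) (w ++ [n]) = ρ n (ent (monoT hρ u a v) w w) := by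
  by_cases huv : u = v
  · subst huv
    by_cases hp : u <+: w
    · obtain ⟨l, rfl⟩ := hp
      rw [List.append_assoc, ent_monoT_append, ent_monoT_append, wordHom_append_singleton]
    · have hp' : ¬ u <+: w ++ [n] := fun h =>
        hp (List.prefix_of_prefix_length_le h (List.prefix_append _ _) hw)
      rw [ent_monoT_of_not_prefix hρ a u hp, ent_monoT_of_not_prefix hρ a u hp', map_zero]
  · rw [ent_monoT_of_ne hρ a _ huv, ent_monoT_of_ne hρ a _ huv, map_zero]

/-- The diagonal of `b` is eventually determined by its entries on shorter words. -/
def DiagEventually (b : toeplitz ρ) (N : ℕ) : Prop :=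
  ∀ w : List ℕ, N ≤ w.length → ∀ n, ent b (w ++ [n]) (w ++ [n]) = ρ n (ent b w w)

include hρ in
theorem exists_diagEventually {b : toeplitz ρ} (hb : b.1 ∈ monoSpan ρ) :
    ∃ N, DiagEventually b N := by
  suffices h : ∀ c : Adjointable (List ℕ) A, c ∈ Submodule.span ℂ
      (Set.range fun m : List ℕ × A × List ℕ => mono ρ m.1 m.2.1 m.2.2) →
      ∃ (hc : c ∈ toeplitz ρ) (N : ℕ), DiagEventually ⟨c, hc⟩ N by
    obtain ⟨_, h⟩ := h b.1 hb
    exact h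
  intro c hc
  induction hc using Submodule.span_induction with
  | mem c hc =>
    obtain ⟨m, rfl⟩ := hc
    exact ⟨mono_mem hρ _ _ _, m.1.length, fun w hw n =>
      ent_monoT_append_singleton hρ m.1 m.2.1 m.2.2 hw n⟩
  | zero =>
    have h0 : ∀ v w, ent (0 : toeplitz ρ) v w = 0 := fun v w => by
      have := ent_smul 0 (0 : toeplitz ρ) v w
      rwa [zero_smul, zero_smul] at this
    exact ⟨zero_mem _, 0, fun w _ n => (h0 _ _).trans ((h0 _ _).symm ▸ (map_zero _).symm)⟩
  | add c d _ _ hc hd =>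
    obtain ⟨hc, N, hN⟩ := hc
    obtain ⟨hd, M, hM⟩ := hd
    refine ⟨add_mem hc hd, max N M, fun w hw n => ?_⟩
    have := ent_add (⟨c, hc⟩ : toeplitz ρ) ⟨d, hd⟩
    change ent (⟨c, hc⟩ + ⟨d, hd⟩ : toeplitz ρ) _ _ = ρ n (ent (⟨c, hc⟩ + ⟨d, hd⟩ : toeplitz ρ) _ _)
    rw [this, this, hN w ((le_max_left _ _).trans hw), hM w ((le_max_right _ _).trans hw), map_add]
  | smul r c _ hc =>
    obtain ⟨hc, N, hN⟩ := hc
    refine ⟨SMulMemClass.smul_mem r hc, N, fun w hw n => ?_⟩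
    change ent (r • (⟨c, hc⟩ : toeplitz ρ)) _ _ = ρ n (ent (r • (⟨c, hc⟩ : toeplitz ρ)) _ _)
    rw [ent_smul, ent_smul, hN w hw, map_smul]

end Monomials

variable [PartialOrder A] [StarOrderedRing A]

theorem ent_self_nonneg {b : toeplitz ρ} (hb : 0 ≤ b) (w : List ℕ) : 0 ≤ ent b w w := by
  have h := hasSum_ent (CFC.sqrt b) (CFC.sqrt b) w w
  rw [(CFC.sqrt_nonneg b).isSelfAdjoint.star_eq, CFC.sqrt_mul_sqrt_self b hb] at h
  exact ge_of_tendsto' h fun s => Finset.sum_nonneg fun v _ => star_mul_self_nonneg _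

end Entries
end ToeplitzKMS

namespace ToeplitzKMS

open StdModule

/-! ### The truncated functionals -/

section Truncated

variable {A : Type*} [NonUnitalCStarAlgebra A] [PartialOrder A] [StarOrderedRing A]

/-- A lower semicontinuous trace which dominates its branching sum. -/
structure IsSubinvariant (τ : CStarWeight A) (ρ : ℕ → A →⋆ₙₐ[ℂ] A) (x : ℕ → ℝ) (β : ℝ) : Prop where
  lsc : LowerSemicontinuous τ.toFun
  tracial : τ.IsTracial
  branch_le : ∀ {a : A}, 0 ≤ a → τ.branch ρ x β a ≤ τ.val a

/-- The functional used at a word of length `l` when truncating at length `k`, as a function of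
`j = k - l`: it is `0` for `j < 0`, `τ` for `j = 0`, and the defect of invariance for `j > 0`. -/
noncomputable def level (τ : CStarWeight A) (ρ : ℕ → A →⋆ₙₐ[ℂ] A) (x : ℕ → ℝ) (β : ℝ) (j : ℤ)
    (a : A) : ℝ≥0∞ :=
  if j < 0 then 0 else if j = 0 then τ.val a else τ.val a - τ.branch ρ x β a

/-- The weight of a word. -/
noncomputable def wordWt (x : ℕ → ℝ) (β : ℝ) (w : List ℕ) : ℝ≥0∞ :=
  ENNReal.ofReal (Real.exp (-β * (w.map x).sum))

/-- The KMS functional truncated at words of length `k`. -/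
noncomputable def trunc (τ : CStarWeight A) (ρ : ℕ → A →⋆ₙₐ[ℂ] A) (x : ℕ → ℝ) (β : ℝ) (k : ℤ)
    (T : toeplitz ρ) : ℝ≥0∞ :=
  ∑' w : List ℕ, wordWt x β w * level τ ρ x β (k - w.length) (ent T w w)

variable {τ : CStarWeight A} {ρ : ℕ → A →⋆ₙₐ[ℂ] A} {x : ℕ → ℝ} {β : ℝ}

theorem level_le (j : ℤ) (a : A) : level τ ρ x β j a ≤ τ.val a := by
  rw [level]
  split_ifs
  · exact zero_le
  · exact le_rfl
  · exact tsub_le_self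

theorem level_zero (j : ℤ) : level τ ρ x β j 0 = 0 :=
  le_antisymm ((level_le j 0).trans_eq τ.val_zero) zero_le

theorem level_smul {r : ℝ} (hr : 0 ≤ r) (j : ℤ) {a : A} (ha : 0 ≤ a) :
    level τ ρ x β j (r • a) = ENNReal.ofReal r * level τ ρ x β j a := by
  have h : τ.branch ρ x β (r • a) = ENNReal.ofReal r * τ.branch ρ x β a := by
    rw [CStarWeight.branch, CStarWeight.branch, ← ENNReal.tsum_mul_left]
    refine tsum_congr fun n => ?_
    have : ρ n (r • a) = r • ρ n a := by
      rw [← Complex.coe_smul, ← Complex.coe_smul, map_smul]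
    rw [this, τ.val_smul hr (map_nonneg (ρ n) ha), mul_left_comm]
  simp only [level, τ.val_smul hr ha, h, ← ENNReal.mul_sub fun _ _ => ENNReal.ofReal_ne_top]
  split_ifs <;> simp

/-- Each single term of the branching sum is dominated by τ(a), and its coefficient is positive. -/
theorem val_wordHom_lt_top (h : IsSubinvariant τ ρ x β) (w : List ℕ) {a : A} (ha : 0 ≤ a)
    (hfin : τ.val a < ∞) : τ.val (wordHom ρ w a) < ∞ := by
  induction w generalizing a with
  | nil => exact hfin
  | cons i w ih =>
    refine ih (a := ρ i a) (map_nonneg (ρ i) ha) ?_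
    have h1 : ENNReal.ofReal (Real.exp (-β * x i)) * τ.val (ρ i a) < ∞ :=
      ((ENNReal.le_tsum i).trans (h.branch_le ha)).trans_lt hfin
    refine lt_top_iff_ne_top.2 fun h2 => ?_
    rw [h2, ENNReal.mul_top (by simpa using Real.exp_pos _)] at h1
    exact h1.ne rfl

/-- The trace and the branching sum are both countably additive. Finiteness of τ(a) permits
subtracting them, since subtraction in [0, ∞] is truncated. -/
theorem level_hasSum (h : IsSubinvariant τ ρ x β) (j : ℤ) {ι : Type*} {f : ι → A} {a : A}
    (hf : ∀ i, 0 ≤ f i) (hs : HasSum f a) (hfin : τ.val a < ∞) :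
    level τ ρ x β j a = ∑' i, level τ ρ x β j (f i) := by
  have ha : 0 ≤ a := ge_of_tendsto' hs fun s => Finset.sum_nonneg fun i _ => hf i
  have h1 := CStarWeight.val_hasSum h.lsc hf hs
  simp only [level]
  split_ifs
  · rw [tsum_zero]
  · exact h1
  · refine (ENNReal.eq_sub_of_add_eq ((h.branch_le ha).trans_lt hfin).ne ?_).symm
    rw [CStarWeight.branch_hasSum h.lsc hf hs, ← ENNReal.tsum_add, h1]
    exact tsum_congr fun i => tsub_add_cancel_of_le (h.branch_le (hf i))

theorem level_add (h : IsSubinvariant τ ρ x β) (j : ℤ) {a b : A} (ha : 0 ≤ a) (hb : 0 ≤ b)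
    (ha' : τ.val a < ∞) (hb' : τ.val b < ∞) :
    level τ ρ x β j (a + b) = level τ ρ x β j a + level τ ρ x β j b := by
  have hs : HasSum (fun i : Bool => cond i a b) (a + b) := by
    simpa using hasSum_fintype (fun i : Bool => cond i a b)
  rw [level_hasSum h j (by rintro (_ | _) <;> assumption) hs
    (by rw [τ.val_add ha hb]; exact ENNReal.add_lt_top.2 ⟨ha', hb'⟩), tsum_bool, add_comm]
  rfl

theorem level_star (h : IsSubinvariant τ ρ x β) (j : ℤ) (c : A) :
    level τ ρ x β j (star c * c) = level τ ρ x β j (c * star c) := by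
  have : τ.branch ρ x β (star c * c) = τ.branch ρ x β (c * star c) := by
    simp only [CStarWeight.branch, map_mul, map_star, h.tracial.val_eq]
  simp only [level, h.tracial.val_eq, this]

variable (τ) in
/-- The diagonal entries have finite trace. -/
def FinDiag (T : toeplitz ρ) : Prop := ∀ w, τ.val (ent T w w) < ∞

theorem ent_mono {S T : toeplitz ρ} (hST : S ≤ T) (w : List ℕ) : ent S w w ≤ ent T w w := by
  have := ent_self_nonneg (sub_nonneg.2 hST) w
  have h2 := ent_add (T - S) S w w
  rw [sub_add_cancel] at h2
  rw [h2]
  exact le_add_of_nonneg_left this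

omit [PartialOrder A] [StarOrderedRing A] in
theorem ent_conj (e : A) (T : toeplitz ρ) (w : List ℕ) :
    ent (star (incl ρ e) * T * incl ρ e) w w =
      star (wordHom ρ w e) * ent T w w * wordHom ρ w e := by
  rw [ent_mul_incl, ← map_star, ent_incl_mul, map_star]

theorem finDiag_conj (h : IsSubinvariant τ ρ x β) {e : A} (he : τ.val (star e * e) < ∞)
    {T : toeplitz ρ} (hT : 0 ≤ T) : FinDiag τ (star (incl ρ e) * T * incl ρ e) := fun w => by
  rw [ent_conj]
  refine (τ.val_conj_le _ (ent_self_nonneg hT w)).trans_lt ?_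
  rw [← map_star, ← map_mul]
  exact ENNReal.mul_lt_top ENNReal.ofReal_lt_top
    (val_wordHom_lt_top h w (star_mul_self_nonneg e) he)

theorem FinDiag.mono {S T : toeplitz ρ} (hT : FinDiag τ T) (hS : 0 ≤ S) (hST : S ≤ T) :
    FinDiag τ S := fun w =>
  (τ.val_mono (ent_self_nonneg hS w) (ent_mono hST w)).trans_lt (hT w)

theorem trunc_add (h : IsSubinvariant τ ρ x β) (k : ℤ) {S T : toeplitz ρ} (hS : 0 ≤ S)
    (hT : 0 ≤ T) (hS' : FinDiag τ S) (hT' : FinDiag τ T) :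
    trunc τ ρ x β k (S + T) = trunc τ ρ x β k S + trunc τ ρ x β k T := by
  rw [trunc, trunc, trunc, ← ENNReal.tsum_add]
  refine tsum_congr fun w => ?_
  rw [ent_add, level_add h _ (ent_self_nonneg hS w) (ent_self_nonneg hT w) (hS' w) (hT' w), mul_add]

theorem trunc_mono (h : IsSubinvariant τ ρ x β) (k : ℤ) {S T : toeplitz ρ} (hS : 0 ≤ S)
    (hST : S ≤ T) (hT' : FinDiag τ T) : trunc τ ρ x β k S ≤ trunc τ ρ x β k T := by
  have h0 := sub_nonneg.2 hST
  have := trunc_add h k h0 hS (hT'.mono h0 (sub_le_self T hS)) (hT'.mono hS hST)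
  rw [sub_add_cancel] at this
  rw [this]
  exact le_add_self

theorem trunc_smul {r : ℝ} (hr : 0 ≤ r) (k : ℤ) {T : toeplitz ρ} (hT : 0 ≤ T) :
    trunc τ ρ x β k (r • T) = ENNReal.ofReal r * trunc τ ρ x β k T := by
  rw [trunc, trunc, ← ENNReal.tsum_mul_left]
  refine tsum_congr fun w => ?_
  rw [← Complex.coe_smul, ent_smul, Complex.coe_smul, level_smul hr _ (ent_self_nonneg hT w),
    mul_left_comm]

theorem wordWt_append_singleton (w : List ℕ) (n : ℕ) :
    wordWt x β (w ++ [n]) = wordWt x β w * ENNReal.ofReal (Real.exp (-β * x n)) := by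
  rw [wordWt, wordWt, ← ENNReal.ofReal_mul (Real.exp_pos _).le, ← Real.exp_add]
  simp [mul_add]

/-- Raising k by one removes the branching sum at each word w of length k and adds τ at the words w
++ [n]. For large k the entry there is ρ_n applied to the entry at w, so what is added equals what
was removed. -/
theorem trunc_succ (h : IsSubinvariant τ ρ x β) {T : toeplitz ρ} (hT : 0 ≤ T) {N k : ℕ}
    (hN : DiagEventually T N) (hk : N ≤ k) :
    trunc τ ρ x β (k + 1) T = trunc τ ρ x β k T := by
  set D : List ℕ → ℝ≥0∞ := fun w => wordWt x β w * (τ.val (ent T w w) - τ.branch ρ x β (ent T w w))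
  set V : List ℕ → ℝ≥0∞ := fun w => wordWt x β w * τ.val (ent T w w)
  have e1 : trunc τ ρ x β (k + 1) T = (∑' w, if w.length < k then D w else 0) +
      ((∑' w, if w.length = k then D w else 0) + ∑' w, if w.length = k + 1 then V w else 0) := by
    rw [trunc, ← ENNReal.tsum_add, ← ENNReal.tsum_add]
    refine tsum_congr fun w => ?_
    simp only [level]
    rcases lt_trichotomy w.length k with h1 | h1 | h1
    · rw [if_neg (by omega), if_neg (by omega), if_pos h1, if_neg (by omega), if_neg (by omega),
        add_zero, add_zero]
    · rw [if_neg (by omega), if_neg (by omega), if_neg (by omega), if_pos h1, if_neg (by omega),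
        add_zero, zero_add]
    · rw [if_neg (by omega : ¬ w.length < k), if_neg (by omega : ¬ w.length = k), zero_add, zero_add]
      by_cases h2 : w.length = k + 1
      · rw [if_neg (by omega), if_pos (by omega), if_pos h2]
      · rw [if_pos (by omega), if_neg h2, mul_zero]
  have e2 : trunc τ ρ x β k T = (∑' w, if w.length < k then D w else 0) +
      ∑' w, if w.length = k then V w else 0 := by
    rw [trunc, ← ENNReal.tsum_add]
    refine tsum_congr fun w => ?_
    simp only [level]
    rcases lt_trichotomy w.length k with h1 | h1 | h1
    · rw [if_neg (by omega), if_neg (by omega), if_pos h1, if_neg (by omega), add_zero]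
    · rw [if_neg (by omega), if_pos (by omega), if_neg (by omega), if_pos h1, zero_add]
    · rw [if_pos (by omega), if_neg (by omega), if_neg (by omega), mul_zero, add_zero]
  -- Nonempty words are indexed by their initial part and last letter.
  have hinj : Function.Injective fun p : List ℕ × ℕ => p.1 ++ [p.2] := fun p q hpq => by
    have := List.append_inj' hpq rfl
    exact Prod.ext this.1 (by simpa using this.2)
  have e3 : (∑' w, if w.length = k + 1 then V w else 0) =
      ∑' w, if w.length = k then wordWt x β w * τ.branch ρ x β (ent T w w) else 0 := by
    rw [← hinj.tsum_eq, ENNReal.tsum_prod']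
    · refine tsum_congr fun w => ?_
      simp only [List.length_append, List.length_singleton, add_left_inj]
      by_cases hw : w.length = k
      · simp only [if_pos hw, CStarWeight.branch, ← ENNReal.tsum_mul_left]
        refine tsum_congr fun n => ?_
        simp only [V]
        rw [hN w (by omega) n, wordWt_append_singleton, mul_assoc]
      · simp [if_neg hw]
    · intro w hw
      have hw' : w ≠ [] := by
        rintro rfl
        simp at hw
      exact ⟨(w.dropLast, w.getLast hw'), List.dropLast_append_getLast hw'⟩
  rw [e1, e2, e3, ← ENNReal.tsum_add]
  congr 1
  refine tsum_congr fun w => ?_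
  by_cases hw : w.length = k
  · simp only [if_pos hw, D, V]
    rw [← mul_add, tsub_add_cancel_of_le (h.branch_le (ent_self_nonneg hT w))]
  · simp [if_neg hw]

theorem trunc_eq_of_le (h : IsSubinvariant τ ρ x β) {T : toeplitz ρ} (hT : 0 ≤ T) {N : ℕ}
    (hN : DiagEventually T N) {k : ℤ} (hk : N ≤ k) : trunc τ ρ x β k T = trunc τ ρ x β N T := by
  lift k to ℕ using by omega
  induction k, (Int.ofNat_le.1 hk) using Nat.le_induction with
  | base => rfl
  | succ k hk' ih =>
    rw [← ih (by omega), ← trunc_succ h hT hN hk']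
    rfl

/-- The diagonal of an element of A is determined from length 0 on, so k = 0 computes all
truncations, and there only the empty word contributes. -/
theorem trunc_incl (h : IsSubinvariant τ ρ x β) {a : A} (ha : 0 ≤ a) {k : ℤ} (hk : 0 ≤ k) :
    trunc τ ρ x β k (incl ρ a) = τ.val a := by
  have hN : DiagEventually (incl ρ a) 0 := fun w _ n => by
    rw [ent_incl, ent_incl, wordHom_append_singleton]
  rw [trunc_eq_of_le h (map_nonneg (incl ρ) ha) hN (by simpa using hk), trunc,
    tsum_eq_single ([] : List ℕ)]
  · rw [ent_incl]
    simp [wordWt, level, wordHom]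
  · intro w hw
    have : 0 < w.length := List.length_pos_iff.2 hw
    rw [level, if_pos (by simpa using this), mul_zero]

/-- The Lipschitz constant is uniform in k, because every truncation takes the value τ(e*e) at e*e.
This lets limits in k pass from polynomials to the closure. -/
theorem trunc_conj_le_add (h : IsSubinvariant τ ρ x β) {e : A} (he : τ.val (star e * e) < ∞)
    {k : ℤ} (hk : 0 ≤ k) {S T : toeplitz ρ} (hS : 0 ≤ S) (hT : 0 ≤ T) :
    trunc τ ρ x β k (star (incl ρ e) * S * incl ρ e) ≤
      trunc τ ρ x β k (star (incl ρ e) * T * incl ρ e) +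
        ENNReal.ofReal ‖S - T‖ * τ.val (star e * e) := by
  have he0 := star_mul_self_nonneg e
  have hi : star (incl ρ e) * incl ρ e = incl ρ (star e * e) := by rw [map_mul, map_star]
  have hi0 : 0 ≤ incl ρ (star e * e) := map_nonneg _ he0
  have hf : FinDiag τ (‖S - T‖ • incl ρ (star e * e)) := fun w => by
    rw [← Complex.coe_smul, ent_smul, Complex.coe_smul, ent_incl,
      τ.val_smul (norm_nonneg _) (map_nonneg (wordHom ρ w) he0)]
    exact ENNReal.mul_lt_top ENNReal.ofReal_lt_top (val_wordHom_lt_top h w he0 he)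
  have h1 := CStarWeight.conj_le_add (incl ρ e) hS hT
  have hT1 := star_left_conjugate_nonneg hT (incl ρ e)
  have h2 := smul_nonneg (norm_nonneg (S - T)) hi0
  rw [hi] at h1
  refine (trunc_mono h k (star_left_conjugate_nonneg hS _) h1 fun w => ?_).trans_eq ?_
  · rw [ent_add, τ.val_add (ent_self_nonneg hT1 w) (ent_self_nonneg h2 w)]
    exact ENNReal.add_lt_top.2 ⟨finDiag_conj h he hT w, hf w⟩
  · rw [trunc_add h k hT1 h2 (finDiag_conj h he hT) hf, trunc_smul (norm_nonneg _) k hi0,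
      trunc_incl h he0 hk]

/-- All nonzero entries X_vw have x_v - x_w = s and one common length difference d. Expand both
diagonals into entries and use traciality of each level: the word weights at w and v differ by
e^{βs}, and k - |w| = (k + d) - |v|. -/
theorem trunc_eigen (h : IsSubinvariant τ ρ x β)
    (hx : ∀ z : Circle, (fun _ : ℕ => z) ∈ torusClosure x) {s : ℝ} {X : toeplitz ρ}
    (hX : (quasiFreeFlow ρ x).IsEigen s X) (h1 : FinDiag τ (star X * X))
    (h2 : FinDiag τ (X * star X)) :
    ∃ d : ℤ, ∀ k : ℤ, trunc τ ρ x β k (star X * X) =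
      ENNReal.ofReal (Real.exp (β * s)) * trunc τ ρ x β (k + d) (X * star X) := by
  have hsum : ∀ {v w}, ent X v w ≠ 0 → (v.map x).sum - (w.map x).sum = s := fun {v w} h0 => by
    by_contra hne
    exact h0 (ent_eq_zero_of_isEigen hX hne)
  obtain ⟨d, hd⟩ : ∃ d : ℤ, ∀ v w, ent X v w ≠ 0 → (v.length : ℤ) - w.length = d := by
    by_cases hex : ∃ v w, ent X v w ≠ 0
    · obtain ⟨v₀, w₀, h0⟩ := hex
      refine ⟨v₀.length - w₀.length, fun v w hvw => ?_⟩
      have e1 := hsum h0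
      have e2 := hsum hvw
      -- Concatenation turns equality of two frequency differences into equality of two word
      -- frequencies.
      have := length_eq_of_sum_eq hx (u := v ++ w₀) (v := v₀ ++ w) (by
        simp only [List.map_append, List.sum_append]
        linarith)
      simp only [List.length_append] at this
      omega
    · push Not at hex
      exact ⟨0, fun v w hvw => absurd (hex v w) hvw⟩
  refine ⟨d, fun k => ?_⟩
  have e1 : ∀ w, wordWt x β w * level τ ρ x β (k - w.length) (ent (star X * X) w w) =
      ∑' v, wordWt x β w * level τ ρ x β (k - w.length) (star (ent X v w) * ent X v w) := fun w => by
    rw [level_hasSum h _ (fun v => star_mul_self_nonneg _) (hasSum_ent X X w w) (h1 w),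
      ENNReal.tsum_mul_left]
  have e2 : ∀ v, wordWt x β v * level τ ρ x β (k + d - v.length) (ent (X * star X) v v) =
      ∑' w, wordWt x β v * level τ ρ x β (k + d - v.length) (star (ent X v w) * ent X v w) :=
    fun v => by
    have := hasSum_ent (star X) (star X) v v
    rw [star_star] at this
    rw [level_hasSum h _ (fun v => star_mul_self_nonneg _) this (h2 v), ← ENNReal.tsum_mul_left]
    refine tsum_congr fun w => ?_
    rw [ent_star, star_star, level_star h]
  rw [trunc, trunc, tsum_congr e1, tsum_congr e2, ENNReal.tsum_comm, ← ENNReal.tsum_mul_left]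
  refine tsum_congr fun v => ?_
  rw [← ENNReal.tsum_mul_left]
  refine tsum_congr fun w => ?_
  by_cases h0 : ent X v w = 0
  · rw [h0, mul_zero, level_zero, level_zero, mul_zero, mul_zero, mul_zero]
  · have e3 := hd v w h0
    rw [show k + d - v.length = k - w.length by omega, ← mul_assoc]
    congr 1
    rw [wordWt, wordWt, ← ENNReal.ofReal_mul (Real.exp_pos _).le, ← Real.exp_add, ← hsum h0]
    congr 2
    ring

end Truncated
end ToeplitzKMS

namespace ToeplitzKMS

open StdModule

/-! ### Limits of the compressed truncated functionals. -/

section Limit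

variable {A : Type*} [NonUnitalCStarAlgebra A] [PartialOrder A] [StarOrderedRing A]
  {τ : CStarWeight A} {ρ : ℕ → A →⋆ₙₐ[ℂ] A} {x : ℕ → ℝ} {β : ℝ}

theorem level_mono (h : IsSubinvariant τ ρ x β) (j : ℤ) {a b : A} (ha : 0 ≤ a) (hab : a ≤ b)
    (hb : τ.val b < ∞) : level τ ρ x β j a ≤ level τ ρ x β j b := by
  have h0 := sub_nonneg.2 hab
  have h1 := level_add h j h0 ha ((τ.val_mono h0 (sub_le_self b ha)).trans_lt hb)
    ((τ.val_mono ha hab).trans_lt hb)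
  rw [sub_add_cancel] at h1
  rw [h1]
  exact le_add_self

/-- Expand T as S*S with S its square root. Traciality moves the compression to the inside of each
entry, where it appears as ρ_w(e e*), and each level is monotone on elements of finite trace. -/
theorem trunc_conj_mono (h : IsSubinvariant τ ρ x β) {e f : A} (hef : e * star e ≤ f * star f)
    (he : τ.val (star e * e) < ∞) (hf : τ.val (star f * f) < ∞) (k : ℤ) {T : toeplitz ρ}
    (hT : 0 ≤ T) : trunc τ ρ x β k (star (incl ρ e) * T * incl ρ e) ≤
      trunc τ ρ x β k (star (incl ρ f) * T * incl ρ f) := by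
  set S := CFC.sqrt T with hS
  have hSS : star S * S = T := by
    rw [(CFC.sqrt_nonneg T).isSelfAdjoint.star_eq, CFC.sqrt_mul_sqrt_self T hT]
  have key : ∀ g : A, τ.val (star g * g) < ∞ → ∀ w,
      (level τ ρ x β (k - w.length) (ent (star (incl ρ g) * T * incl ρ g) w w) =
        ∑' v, level τ ρ x β (k - w.length)
          (star (star (ent S v w)) * wordHom ρ w (g * star g) * star (ent S v w))) ∧
      ∀ v, τ.val (star (star (ent S v w)) * wordHom ρ w (g * star g) * star (ent S v w)) < ∞ := by
    intro g hg w
    have e1 : star (incl ρ g) * T * incl ρ g = star (S * incl ρ g) * (S * incl ρ g) := by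
      rw [star_mul, ← hSS]
      simp only [mul_assoc]
    have e2 := finDiag_conj h hg hT w
    have e3 := hasSum_ent (S * incl ρ g) (S * incl ρ g) w w
    rw [← e1] at e3
    have e4 : ∀ v, star (star (ent S v w)) * wordHom ρ w (g * star g) * star (ent S v w) =
        ent (S * incl ρ g) v w * star (ent (S * incl ρ g) v w) := fun v => by
      rw [ent_mul_incl, star_star, map_mul, map_star, star_mul]
      simp only [mul_assoc]
    constructor
    · rw [level_hasSum h _ (fun v => star_mul_self_nonneg _) e3 e2]
      refine tsum_congr fun v => ?_
      rw [e4, level_star h]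
    · intro v
      rw [e4, ← h.tracial.val_eq]
      exact (τ.val_mono (star_mul_self_nonneg _)
        (le_hasSum e3 v fun _ _ => star_mul_self_nonneg _)).trans_lt e2
  refine ENNReal.tsum_le_tsum fun w => mul_le_mul_right ?_ _
  rw [(key e he w).1, (key f hf w).1]
  refine ENNReal.tsum_le_tsum fun v => level_mono h _ ?_ ?_ ((key f hf w).2 v)
  · exact star_left_conjugate_nonneg (map_nonneg (wordHom ρ w) (mul_star_self_nonneg e)) _
  · refine star_left_conjugate_le_conjugate ?_ _
    rw [← sub_nonneg, ← map_sub]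
    exact map_nonneg (wordHom ρ w) (sub_nonneg.2 hef)

variable (τ ρ x β) in
/-- The compression by `e` of the limit of the truncated functionals. -/
noncomputable def compr (e : A) (T : toeplitz ρ) : ℝ≥0∞ :=
  liminf (fun k : ℤ => trunc τ ρ x β k (star (incl ρ e) * T * incl ρ e)) atTop

/-- Only the diagonal matters; invariance under the flow and under the fixed-point projection will
follow from this. -/
theorem compr_congr (e : A) {S T : toeplitz ρ} (hST : ∀ w, ent S w w = ent T w w) :
    compr τ ρ x β e S = compr τ ρ x β e T := by
  simp only [compr, trunc, ent_conj, hST]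

-- To keep the approximant positive, approximate the square root by a polynomial p and take p*p.
omit [PartialOrder A] [StarOrderedRing A] in
theorem exists_near_polynomial (hρ : ∀ n, IsNondegenerate (ρ n)) {T : toeplitz ρ} (hT : 0 ≤ T)
    {δ : ℝ} (hδ : 0 < δ) : ∃ q, 0 ≤ q ∧ q.1 ∈ monoSpan ρ ∧ ‖T - q‖ < δ := by
  have hc : Continuous fun p : toeplitz ρ => T - star p * p := by fun_prop
  obtain ⟨p, hp, hpδ⟩ := (dense_span_monoT hρ).exists_mem_open
    (isOpen_lt hc.norm (continuous_const (y := δ))) ⟨CFC.sqrt T, by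
      change ‖T - _‖ < δ
      rw [(CFC.sqrt_nonneg T).isSelfAdjoint.star_eq, CFC.sqrt_mul_sqrt_self T hT, sub_self,
        norm_zero]
      exact hδ⟩
  have hp' : p.1 ∈ monoSpan ρ := by
    clear hpδ
    change p ∈ Submodule.span ℂ _ at hp
    induction hp using Submodule.span_induction with
    | mem p hp =>
      obtain ⟨m, rfl⟩ := hp
      exact mono_mem_monoSpan ρ _ _ _
    | zero => exact zero_mem _
    | add p q _ _ hp hq => exact (monoSpan ρ).add_mem' hp hq
    | smul c p _ hp => exact (monoSpan ρ).smul_mem' c hp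
  exact ⟨star p * p, star_mul_self_nonneg p, (monoSpan ρ).mul_mem' ((monoSpan ρ).star_mem' hp') hp', hpδ⟩

/-- For a nearby positive polynomial the truncations are eventually constant, and the uniform
Lipschitz bound keeps those of T within ε/2 of that constant, so the upper and lower limits agree.
-/
theorem tendsto_compr (h : IsSubinvariant τ ρ x β) (hρ : ∀ n, IsNondegenerate (ρ n)) {e : A}
    (he : τ.val (star e * e) < ∞) {T : toeplitz ρ} (hT : 0 ≤ T) :
    Tendsto (fun k : ℤ => trunc τ ρ x β k (star (incl ρ e) * T * incl ρ e)) atTop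
      (𝓝 (compr τ ρ x β e T)) := by
  refine tendsto_of_le_liminf_of_limsup_le le_rfl ?_
  refine ENNReal.le_of_forall_pos_le_add fun ε hε _ => ?_
  set C := τ.val (star e * e) with hC
  obtain ⟨q, hq, hqm, hTq⟩ := exists_near_polynomial hρ hT
    (δ := ε / 2 / (C.toReal + 1)) (by positivity)
  have hsmall : ENNReal.ofReal ‖T - q‖ * C ≤ (ε / 2 : ℝ≥0) := by
    rw [← ENNReal.ofReal_toReal he.ne, ← ENNReal.ofReal_mul (norm_nonneg _),
      ← ENNReal.ofReal_coe_nnreal]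
    refine ENNReal.ofReal_le_ofReal ?_
    have h1 : ‖T - q‖ * (C.toReal + 1) ≤ ε / 2 := by
      rw [← le_div_iff₀ (by positivity)]
      exact hTq.le
    push_cast
    nlinarith [norm_nonneg (T - q)]
  obtain ⟨N, hN⟩ := exists_diagEventually hρ hqm
  -- Compressing by an element of A does not change the length from which the diagonal is
  -- determined.
  have hN' : DiagEventually (star (incl ρ e) * q * incl ρ e) N := fun w hw n => by
    rw [ent_conj, ent_conj, hN w hw, wordHom_append_singleton, map_mul, map_mul, map_star]
  set c := trunc τ ρ x β N (star (incl ρ e) * q * incl ρ e) with hc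
  have hk : ∀ k : ℤ, N ≤ k → trunc τ ρ x β k (star (incl ρ e) * q * incl ρ e) = c := fun k hk =>
    trunc_eq_of_le h (star_left_conjugate_nonneg hq _) hN' hk
  have hup : limsup (fun k : ℤ => trunc τ ρ x β k (star (incl ρ e) * T * incl ρ e)) atTop ≤
      c + (ε / 2 : ℝ≥0) := by
    refine limsup_le_of_le (by isBoundedDefault) (eventually_atTop.2 ⟨N, fun k hNk => ?_⟩)
    refine (trunc_conj_le_add h he ((Int.natCast_nonneg N).trans hNk) hT hq).trans ?_
    rw [hk k hNk]
    gcongr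
  have hlow : c - (ε / 2 : ℝ≥0) ≤ compr τ ρ x β e T := by
    refine le_liminf_of_le (by isBoundedDefault) (eventually_atTop.2 ⟨N, fun k hNk => ?_⟩)
    rw [tsub_le_iff_right, ← hk k hNk]
    refine (trunc_conj_le_add h he ((Int.natCast_nonneg N).trans hNk) hq hT).trans ?_
    rw [norm_sub_rev]
    gcongr
  refine hup.trans ?_
  rw [tsub_le_iff_right] at hlow
  calc _ ≤ compr τ ρ x β e T + (ε / 2 : ℝ≥0) + (ε / 2 : ℝ≥0) := by gcongr
    _ = _ := by rw [add_assoc, ← ENNReal.coe_add, add_halves]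

section

variable (h : IsSubinvariant τ ρ x β) (hρ : ∀ n, IsNondegenerate (ρ n))
include h hρ

theorem compr_add {e : A} (he : τ.val (star e * e) < ∞) {S T : toeplitz ρ} (hS : 0 ≤ S)
    (hT : 0 ≤ T) : compr τ ρ x β e (S + T) = compr τ ρ x β e S + compr τ ρ x β e T := by
  refine tendsto_nhds_unique (tendsto_compr h hρ he (add_nonneg hS hT))
    (((tendsto_compr h hρ he hS).add (tendsto_compr h hρ he hT)).congr fun k => ?_)
  rw [mul_add, add_mul, trunc_add h k (star_left_conjugate_nonneg hS _)
    (star_left_conjugate_nonneg hT _) (finDiag_conj h he hS) (finDiag_conj h he hT)]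

theorem compr_smul {e : A} (he : τ.val (star e * e) < ∞) {r : ℝ} (hr : 0 ≤ r) {T : toeplitz ρ}
    (hT : 0 ≤ T) : compr τ ρ x β e (r • T) = ENNReal.ofReal r * compr τ ρ x β e T := by
  refine tendsto_nhds_unique (tendsto_compr h hρ he (smul_nonneg hr hT))
    ((ENNReal.Tendsto.const_mul (tendsto_compr h hρ he hT)
      (Or.inr ENNReal.ofReal_ne_top)).congr fun k => ?_)
  rw [mul_smul_comm, smul_mul_assoc, trunc_smul hr k (star_left_conjugate_nonneg hT _)]

theorem compr_le_add {e : A} (he : τ.val (star e * e) < ∞) {S T : toeplitz ρ} (hS : 0 ≤ S)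
    (hT : 0 ≤ T) :
    compr τ ρ x β e S ≤ compr τ ρ x β e T + ENNReal.ofReal ‖S - T‖ * τ.val (star e * e) :=
  le_of_tendsto_of_tendsto (tendsto_compr h hρ he hS)
    ((tendsto_compr h hρ he hT).add tendsto_const_nhds)
    (eventually_atTop.2 ⟨0, fun _ hk => trunc_conj_le_add h he hk hS hT⟩)

theorem compr_conj_mono {e f : A} (hef : e * star e ≤ f * star f) (he : τ.val (star e * e) < ∞)
    (hf : τ.val (star f * f) < ∞) {T : toeplitz ρ} (hT : 0 ≤ T) :
    compr τ ρ x β e T ≤ compr τ ρ x β f T :=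
  le_of_tendsto_of_tendsto' (tendsto_compr h hρ he hT) (tendsto_compr h hρ hf hT) fun k =>
    trunc_conj_mono h hef he hf k hT

theorem compr_incl {e : A} (he : τ.val (star e * e) < ∞) {a : A} (ha : 0 ≤ a) :
    compr τ ρ x β e (incl ρ a) = τ.val (star e * a * e) := by
  refine tendsto_nhds_unique (tendsto_compr h hρ he (map_nonneg (incl ρ) ha))
    (tendsto_const_nhds.congr' (eventually_atTop.2 ⟨0, fun k hk => ?_⟩))
  dsimp only
  rw [← map_star, ← map_mul, ← map_mul, trunc_incl h (star_left_conjugate_nonneg ha e) hk]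

/-- Both sides are squares of the one element X = f* b e, compressed on both sides so that X*X and
XX* have diagonals of finite trace. The shift d from `trunc_eigen` is invisible in the limit. -/
theorem compr_eigen (hx : ∀ z : Circle, (fun _ : ℕ => z) ∈ torusClosure x) {e f : A}
    (he : τ.val (star e * e) < ∞) (hf : τ.val (star f * f) < ∞) {s : ℝ} {b : toeplitz ρ}
    (hb : (quasiFreeFlow ρ x).IsEigen s b) :
    compr τ ρ x β e (star b * incl ρ (f * star f) * b) =
      ENNReal.ofReal (Real.exp (β * s)) *
        compr τ ρ x β f (b * incl ρ (e * star e) * star b) := by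
  set X := star (incl ρ f) * b * incl ρ e with hX
  have hXe : (quasiFreeFlow ρ x).IsEigen s X := by
    simpa using ((isEigen_incl (ρ := ρ) x f).conj.mul hb).mul (isEigen_incl (ρ := ρ) x e)
  have e1 : star (incl ρ e) * (star b * incl ρ (f * star f) * b) * incl ρ e = star X * X := by
    rw [hX, star_mul, star_mul, star_star, map_mul, map_star]
    simp only [mul_assoc]
  have e2 : star (incl ρ f) * (b * incl ρ (e * star e) * star b) * incl ρ f = X * star X := by
    rw [hX, star_mul, star_mul, star_star, map_mul, map_star]
    simp only [mul_assoc]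
  have n1 : 0 ≤ star b * incl ρ (f * star f) * b :=
    star_left_conjugate_nonneg (map_nonneg (incl ρ) (mul_star_self_nonneg f)) b
  have n2 : 0 ≤ b * incl ρ (e * star e) * star b :=
    star_right_conjugate_nonneg (map_nonneg (incl ρ) (mul_star_self_nonneg e)) b
  have t1 := tendsto_compr h hρ he n1
  have t2 := tendsto_compr h hρ hf n2
  have f1 := finDiag_conj h he n1
  have f2 := finDiag_conj h hf n2
  rw [e1] at t1 f1
  rw [e2] at t2 f2
  obtain ⟨d, hd⟩ := trunc_eigen h hx hXe f1 f2
  refine tendsto_nhds_unique t1 ?_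
  simp only [hd]
  exact ENNReal.Tendsto.const_mul (t2.comp (tendsto_atTop_add_const_right atTop d tendsto_id))
    (Or.inr ENNReal.ofReal_ne_top)

end

-- Diagonal entries have frequency 0, so they vanish on eigenvectors of nonzero frequency.
omit [PartialOrder A] [StarOrderedRing A] in
theorem ent_proj_zero (hpp : (quasiFreeFlow ρ x).PurePoint (freq x)) (T : toeplitz ρ)
    (w : List ℕ) : ent (hpp.proj 0 T) w w = ent T w w := by
  let D : toeplitz ρ →ₗ[ℂ] A :=
    { toFun := fun T => ent T w w
      map_add' := fun S T => ent_add S T w w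
      map_smul' := fun c T => ent_smul c T w w }
  have hD : Continuous D := AddMonoidHomClass.continuous_of_bound D 1 fun T => by
    rw [one_mul]
    exact norm_ent_le T w w
  refine hpp.induction (p := fun T => D (hpp.proj 0 T) = D T)
    (isClosed_eq (hD.comp (hpp.proj 0).continuous) hD) (fun i b hb => ?_) (fun a b ha hb => ?_) T
  · by_cases hi : freq x i = 0
    · rw [hi] at hb
      rw [hb.proj_same hpp]
    · rw [hb.proj_eq_zero hpp hi, _root_.map_zero]
      exact (ent_eq_zero_of_isEigen hb (by rw [sub_self]; exact Ne.symm hi)).symm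
  · rw [_root_.map_add, _root_.map_add, _root_.map_add, ha, hb]

end Limit
end ToeplitzKMS

namespace ToeplitzKMS

open CStarWeight

/-! ### The KMS weight extending a given trace. -/

section Extension

variable {A : Type*} [NonUnitalCStarAlgebra A] [PartialOrder A] [StarOrderedRing A]
  {τ : CStarWeight A} {ρ : ℕ → A →⋆ₙₐ[ℂ] A} {x : ℕ → ℝ} {β : ℝ}
  (h : IsSubinvariant τ ρ x β) (hρ : ∀ n, IsNondegenerate (ρ n))

include h hρ in
theorem monotone_compr {T : toeplitz ρ} (hT : 0 ≤ T) :
    Monotone fun r : τ.FinIdx => compr τ ρ x β (unitSqrt r) T := fun r s hrs => by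
  refine compr_conj_mono h hρ ?_ (val_star_unitSqrt_mul_lt_top r) (val_star_unitSqrt_mul_lt_top s) hT
  simp only [star_unitSqrt, unitSqrt_mul_self]
  exact unit_mono hrs

/-- The weight on the Toeplitz–Pimsner algebra which extends `τ`. -/
noncomputable def kmsExt : CStarWeight (toeplitz ρ) :=
  ofVal (fun T => ⨆ r : τ.FinIdx, compr τ ρ x β (unitSqrt r) T)
    (by
      have h0 : ∀ r : τ.FinIdx, compr τ ρ x β (unitSqrt r) 0 = 0 := fun r => by
        have := compr_smul h hρ (val_star_unitSqrt_mul_lt_top r) le_rfl (le_refl (0 : toeplitz ρ))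
        simpa using this
      simp only [h0, ciSup_const])
    (fun S T hS hT => by
      rw [ENNReal.iSup_add_iSup_of_monotone (monotone_compr h hρ hS) (monotone_compr h hρ hT)]
      exact iSup_congr fun r => compr_add h hρ (val_star_unitSqrt_mul_lt_top r) hS hT)
    (fun c T hc hT => by
      rw [ENNReal.mul_iSup]
      exact iSup_congr fun r => compr_smul h hρ (val_star_unitSqrt_mul_lt_top r) hc hT)

theorem val_kmsExt {T : toeplitz ρ} (hT : 0 ≤ T) :
    (kmsExt h hρ).val T = ⨆ r : τ.FinIdx, compr τ ρ x β (unitSqrt r) T := val_ofVal hT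

/-- A supremum of functions that are Lipschitz on the positive cone. -/
theorem lowerSemicontinuous_kmsExt : LowerSemicontinuous (kmsExt h hρ).toFun := by
  refine lowerSemicontinuous_of_forall fun b hb y hy => ?_
  rw [val_kmsExt h hρ hb] at hy
  obtain ⟨r, hr⟩ := lt_iSup_iff.1 hy
  obtain ⟨η, hη, hyη⟩ := ENNReal.lt_iff_exists_add_pos_lt.1 hr
  have hfin := val_star_unitSqrt_mul_lt_top r
  set C := τ.val (star (unitSqrt r) * unitSqrt r)
  refine ⟨η / (C.toReal + 1), by positivity, fun b' hb' hd => ?_⟩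
  rw [val_kmsExt h hρ hb']
  refine lt_of_lt_of_le ?_ (le_iSup _ r)
  have h1 : ENNReal.ofReal ‖b - b'‖ * C ≤ η := by
    rw [← ENNReal.ofReal_toReal hfin.ne, ← ENNReal.ofReal_mul (norm_nonneg _),
      ← ENNReal.ofReal_coe_nnreal]
    refine ENNReal.ofReal_le_ofReal ?_
    rw [norm_sub_rev, lt_div_iff₀ (by positivity)] at hd
    nlinarith [norm_nonneg (b - b')]
  have h2 := hyη.trans_le ((compr_le_add h hρ hfin hb hb').trans (add_le_add_right h1 _))
  exact lt_of_add_lt_add_right h2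

theorem comap_kmsExt (hdd : τ.DenselyDefined) : (kmsExt h hρ).comap (incl ρ) = τ :=
  ext_val fun a ha => by
    rw [val_comap _ _ ha, val_kmsExt h hρ (map_nonneg (incl ρ) ha),
      ← h.tracial.iSup_conj h.lsc hdd ha]
    exact iSup_congr fun r => compr_incl h hρ (val_star_unitSqrt_mul_lt_top r) ha

theorem isProper_kmsExt (hτ : τ.IsProper) : (kmsExt h hρ).IsProper where
  ne_zero := by
    obtain ⟨a, ha⟩ := hτ.ne_zero
    refine ⟨⟨incl ρ a.1, map_nonneg (incl ρ) a.2⟩, ?_⟩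
    rw [toFun_eq_val] at ha ⊢
    rwa [← val_comap _ _ a.2, comap_kmsExt h hρ hτ.denselyDefined]
  lowerSemicontinuous := lowerSemicontinuous_kmsExt h hρ
  dense := by
    -- Compressions of b by the approximate unit converge to b, and their weight is at most ‖b‖
    -- times that of an element of A of finite trace.
    refine denselyDefined_iff.1 fun b hb δ hδ => ?_
    obtain ⟨r, hr⟩ := ((tendsto_incl_unitSqrt hρ hτ.denselyDefined b).eventually
      (Metric.ball_mem_nhds b hδ)).exists
    refine ⟨_, star_left_conjugate_nonneg hb (incl ρ (unitSqrt r)), ?_, by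
      rwa [← dist_eq_norm]⟩
    refine (val_conj_le _ _ hb).trans_lt (ENNReal.mul_lt_top ENNReal.ofReal_lt_top ?_)
    rw [← map_star, ← map_mul, ← val_comap _ _ (star_mul_self_nonneg _),
      comap_kmsExt h hρ hτ.denselyDefined]
    exact val_star_unitSqrt_mul_lt_top r

/-- Insert the approximate unit between b* and b. Both sides become double suprema, over the
compressing index and the inserted index, and `compr_eigen` exchanges the two roles. -/
theorem kmsExt_eigen (hdd : τ.DenselyDefined)
    (hx : ∀ z : Circle, (fun _ : ℕ => z) ∈ torusClosure x) {s : ℝ}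
    {b : toeplitz ρ} (hb : (quasiFreeFlow ρ x).IsEigen s b) :
    (kmsExt h hρ).val (star b * b) =
      ENNReal.ofReal (Real.exp (β * s)) * (kmsExt h hρ).val (b * star b) := by
  have hfin := fun r : τ.FinIdx => val_star_unitSqrt_mul_lt_top r
  have key : ∀ (r : τ.FinIdx) (c : toeplitz ρ), compr τ ρ x β (unitSqrt r) (star c * c) =
      ⨆ i : τ.FinIdx, compr τ ρ x β (unitSqrt r)
        (star c * incl ρ (unitSqrt i * star (unitSqrt i)) * c) := by
    intro r c
    have hn : ∀ i : τ.FinIdx, 0 ≤ star c * incl ρ (unitSqrt i * star (unitSqrt i)) * c := fun i =>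
      star_left_conjugate_nonneg (map_nonneg (incl ρ) (mul_star_self_nonneg _)) c
    refine le_antisymm ?_ (iSup_le fun i => ?_)
    -- The inserted elements converge in norm, and the compression by a fixed r is Lipschitz.
    · have ht : Tendsto (fun i : τ.FinIdx => ‖star c * c -
          star c * incl ρ (unitSqrt i * star (unitSqrt i)) * c‖) atTop (𝓝 0) := by
        have h1 : Tendsto (fun i : τ.FinIdx => incl ρ (unit i) * c) atTop (𝓝 c) :=
          tendsto_incl_mul hρ norm_unit_le hdd.tendsto_unit_mul c
        have h2 := ((tendsto_const_nhds (x := star c * c)).sub (h1.const_mul (star c))).norm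
        rw [sub_self, norm_zero] at h2
        refine h2.congr fun i => ?_
        rw [star_unitSqrt, unitSqrt_mul_self, mul_assoc]
      have h3 : Tendsto (fun i : τ.FinIdx => (⨆ i : τ.FinIdx, compr τ ρ x β (unitSqrt r)
          (star c * incl ρ (unitSqrt i * star (unitSqrt i)) * c)) + ENNReal.ofReal ‖star c * c -
          star c * incl ρ (unitSqrt i * star (unitSqrt i)) * c‖ *
            τ.val (star (unitSqrt r) * unitSqrt r)) atTop
          (𝓝 ((⨆ i : τ.FinIdx, compr τ ρ x β (unitSqrt r)
          (star c * incl ρ (unitSqrt i * star (unitSqrt i)) * c)) + ENNReal.ofReal 0 *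
            τ.val (star (unitSqrt r) * unitSqrt r))) :=
        tendsto_const_nhds.add (ENNReal.Tendsto.mul_const (ENNReal.tendsto_ofReal ht)
          (Or.inr (hfin r).ne))
      rw [ENNReal.ofReal_zero, zero_mul, add_zero] at h3
      refine ge_of_tendsto' h3 fun i => (compr_le_add h hρ (hfin r) (star_mul_self_nonneg c)
        (hn i)).trans ?_
      gcongr
      exact le_iSup (fun i : τ.FinIdx => compr τ ρ x β (unitSqrt r)
        (star c * incl ρ (unitSqrt i * star (unitSqrt i)) * c)) i
    · have hle : star c * incl ρ (unitSqrt i * star (unitSqrt i)) * c ≤ star c * c := by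
        have h0 : 0 ≤ incl ρ (unit i) := map_nonneg (incl ρ) (unit_nonneg i)
        rw [star_unitSqrt, unitSqrt_mul_self]
        refine (CStarAlgebra.star_left_conjugate_le_norm_smul h0.isSelfAdjoint).trans ?_
        exact (smul_le_smul_of_nonneg_right ((NonUnitalStarAlgHom.norm_apply_le (incl ρ) _).trans
          (norm_unit_le i)) (star_mul_self_nonneg c)).trans_eq (one_smul ℝ _)
      have h4 := compr_add h hρ (β := β) (x := x) (hfin r) (sub_nonneg.2 hle) (hn i)
      rw [sub_add_cancel] at h4
      rw [h4]
      exact le_add_self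
  have key' : ∀ r : τ.FinIdx, compr τ ρ x β (unitSqrt r) (b * star b) =
      ⨆ i : τ.FinIdx, compr τ ρ x β (unitSqrt r)
        (b * incl ρ (unitSqrt i * star (unitSqrt i)) * star b) := fun r => by
    have := key r (star b)
    rwa [star_star] at this
  rw [val_kmsExt h hρ (star_mul_self_nonneg b), val_kmsExt h hρ (mul_star_self_nonneg b),
    iSup_congr fun r => key r b, iSup_congr key', iSup_comm, ENNReal.mul_iSup]
  refine iSup_congr fun i => ?_
  rw [ENNReal.mul_iSup]
  exact iSup_congr fun r => compr_eigen h hρ hx (hfin r) (hfin i) hb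

/-- Each compression is bounded and invariant under the fixed-point projection, so Parseval applies
to it; the compressions increase, so the supremum passes through finite sums. -/
theorem kmsExt_tsum_proj (b : toeplitz ρ) :
    ∑' s : ℝ, (kmsExt h hρ).val (star ((purePoint hρ x).proj s b) * (purePoint hρ x).proj s b) =
      (kmsExt h hρ).val (star b * b) := by
  have hr : ∀ r : τ.FinIdx, compr τ ρ x β (unitSqrt r) (star b * b) = ⨆ F : Finset ℝ, ∑ s ∈ F,
      compr τ ρ x β (unitSqrt r)
        (star ((purePoint hρ x).proj s b) * (purePoint hρ x).proj s b) := fun r => by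
    have hfin := val_star_unitSqrt_mul_lt_top r
    have h0 : compr τ ρ x β (unitSqrt r) 0 = 0 := by
      simpa using compr_smul h hρ hfin le_rfl (le_refl (0 : toeplitz ρ))
    rw [← ENNReal.tsum_eq_iSup_sum]
    refine ((purePoint hρ x).tsum_proj_eq
      (C := (τ.val (star (unitSqrt r) * unitSqrt r)).toNNReal)
      (fun S T hS hT => compr_add h hρ hfin hS hT) (fun T hT => ?_)
      (fun T _ => compr_congr _ fun w => ent_proj_zero _ T w) b).symm
    have := compr_le_add h hρ (β := β) (x := x) hfin hT le_rfl
    rwa [h0, zero_add, sub_zero, mul_comm, ← ENNReal.coe_toNNReal hfin.ne] at this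
  rw [val_kmsExt h hρ (star_mul_self_nonneg b), iSup_congr hr, iSup_comm,
    ENNReal.tsum_eq_iSup_sum]
  refine iSup_congr fun F => ?_
  rw [← ENNReal.finsetSum_iSup_of_monotone fun s => monotone_compr h hρ (star_mul_self_nonneg _)]
  exact Finset.sum_congr rfl fun s _ => val_kmsExt h hρ (star_mul_self_nonneg _)

/-- The flow leaves diagonals unchanged, which gives invariance. For an entire b with c =
α_{-iβ/2}(b), the component of c at s is e^{βs/2} times that of b, so the eigenvector identity
matches the Parseval sums for b and c* term by term. -/
theorem isKMSWeight_kmsExt (hτ : τ.IsProper)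
    (hx : ∀ z : Circle, (fun _ : ℕ => z) ∈ torusClosure x) :
    (quasiFreeFlow ρ x).IsKMSWeight β (kmsExt h hρ) where
  proper := isProper_kmsExt h hρ hτ
  invariant t b := by
    rw [toFun_eq_val, toFun_eq_val, val_kmsExt h hρ b.2, val_kmsExt h hρ (map_nonneg _ b.2)]
    refine iSup_congr fun r => compr_congr _ fun w => ?_
    rw [ent_flow, sub_self, zero_mul, Complex.ofReal_zero, zero_mul, Complex.exp_zero, one_smul]
  kms b hb := by
    set hpp := purePoint hρ x
    -- Membership in the KMS domain is used only at z = 0, where it says that b is entire.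
    have hent : (quasiFreeFlow ρ x).IsEntire b := by
      obtain ⟨c, ⟨hc, _⟩, rfl⟩ := Set.mem_iInter.1 hb 0
      have := (quasiFreeFlow ρ x).extend_ofReal hc 0
      rw [Complex.ofReal_zero] at this
      rwa [this, (quasiFreeFlow ρ x).map_zero]
    set c := (quasiFreeFlow ρ x).extend (-(Complex.I * β / 2)) b with hc
    have h1 : ∀ s : ℝ, (kmsExt h hρ).val (star (hpp.proj s b) * hpp.proj s b) =
        (kmsExt h hρ).val (hpp.proj s c * star (hpp.proj s c)) := fun s => by
      rw [kmsExt_eigen h hρ hτ.denselyDefined hx (hpp.isEigen_proj s b), hc,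
        hpp.proj_extend s hent, CStarFlow.exp_smul_mul_star,
        val_smul _ (Real.exp_pos _).le (mul_star_self_nonneg _)]
    have h2 := kmsExt_tsum_proj h hρ (star c)
    rw [star_star] at h2
    -- The component of c* at s is the adjoint of the component of c at -s, hence the reindexing by
    -- negation.
    rw [toFun_eq_val, toFun_eq_val, ← kmsExt_tsum_proj h hρ b, ← h2, tsum_congr h1,
      ← (Equiv.neg ℝ).tsum_eq]
    refine tsum_congr fun s => ?_
    rw [hpp.proj_star, star_star, Equiv.neg_apply]

end Extension
end ToeplitzKMS

/-- Let `A` be a separable C*-algebra, `ρ` a sequence of nondegenerate `*`-endomorphisms satisfying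
the two standing conditions, and `x` a real sequence such that `K_x` contains all constant
sequences. For each `β`, restriction to `A` is a bijection from the `γ_x`-`β`-KMS weights on the
Toeplitz–Pimsner algebra of `ρ` onto the (proper) tracial weights `τ` on `A` satisfying
`∑ n, exp (-β x_n) τ(ρ_n(a)) ≤ τ(a)` for all positive `a` in the Pedersen ideal. -/
theorem theorem5p1 {A : Type*} [NonUnitalCStarAlgebra A] [PartialOrder A] [StarOrderedRing A]
    [TopologicalSpace.SeparableSpace A]
    (ρ : ℕ → A →⋆ₙₐ[ℂ] A)
    (hnondeg : ∀ n, ToeplitzKMS.IsNondegenerate (ρ n))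
    (hlimsup : ToeplitzKMS.LimsupNorm ρ)
    (hideal : ToeplitzKMS.NoInvariantIdeal ρ)
    (x : ℕ → ℝ)
    (hx : ∀ z : Circle, (fun _ : ℕ => z) ∈ ToeplitzKMS.torusClosure x)
    (β : ℝ) :
    Set.BijOn (ToeplitzKMS.CStarWeight.comap (ToeplitzKMS.incl ρ))
      {φ : ToeplitzKMS.CStarWeight (ToeplitzKMS.toeplitz ρ) |
        (ToeplitzKMS.quasiFreeFlow ρ x).IsKMSWeight β φ}
      {τ : ToeplitzKMS.CStarWeight A | τ.IsProper ∧ τ.IsTracial ∧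
        ∀ (a : A) (ha : 0 ≤ a), a ∈ ToeplitzKMS.pedersenIdeal A →
          ∑' n, ENNReal.ofReal (Real.exp (-β * x n)) * τ.toFun ⟨ρ n a, map_nonneg (ρ n) ha⟩ ≤
            τ.toFun ⟨a, ha⟩} := by
  refine ⟨fun φ hφ => ⟨ToeplitzKMS.IsKMSWeight.isProper_comap_incl hnondeg hφ,
    hφ.isTracial_comap (ToeplitzKMS.isEigen_incl x) (ToeplitzKMS.purePoint hnondeg x),
    fun a ha _ => ?_⟩, fun φ hφ φ' hφ' hc => ToeplitzKMS.eq_of_comap_eq hnondeg hx hφ hφ' hc,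
    fun τ hτ => ?_⟩
  · simp only [ToeplitzKMS.CStarWeight.toFun_eq_val]
    exact ToeplitzKMS.tsum_val_le_of_isKMSWeight hnondeg hφ ha
  · obtain ⟨hp, htr, hle⟩ := hτ
    simp only [ToeplitzKMS.CStarWeight.toFun_eq_val] at hle
    have h : ToeplitzKMS.IsSubinvariant τ ρ x β := ⟨hp.lowerSemicontinuous, htr, fun ha =>
      ToeplitzKMS.CStarWeight.branch_le hp.lowerSemicontinuous hle ha⟩
    exact ⟨ToeplitzKMS.kmsExt h hnondeg, ToeplitzKMS.isKMSWeight_kmsExt h hnondeg hp hx,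
      ToeplitzKMS.comap_kmsExt h hnondeg hp.denselyDefined⟩
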